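/- Let $n\ge 1$. A \emph{twisted virtual twin diagram} on $n$ strands is a union of $n$ (piecewise smooth, e.g. smooth or polygonal) curves in $\mathbb{R}\times[0,1]$, called strands, joining the points $(1,1),\dots,(n,1)$ bijectively to the points $(1,0),\dots,(n,0)$, such that: (1) each strand is monotonic in the second coordinate, i.e. it is the graph $x=f(y)$ of a function of the height $y$; (2) distinct strands meet only in transverse double points, each labelled as a real or a virtual crossing; (3) the strands may carry finitely many bars, placed at points of height in $(0,1)$ that are not crossings. Two diagrams are \emph{equivalent} if they are related by a finite sequence of planar isotopies through twisted virtual twin diagrams (which carry strands to strands, real crossings to real crossings, virtual crossings to virtual crossings, and bars to bars) and of the following local moves and their inverses. Each move replaces the part of a diagram inside a box $[a,c]\times[p,q]$ that the strands enter and leave only through the top and bottom edges, and changes nothing outside. To describe the pictures, number the strand positions in the box from left to right by $1,2,\dots$, and read from top to bottom; $\sigma_i$ and $\rho_i$ denote a real, respectively virtual, crossing of the strands in positions $i,i+1$, $\gamma_j$ denotes a bar on the strand in position $j$, and $1$ denotes a picture without crossings and bars. The moves are: \begin{itemize} \item R2: $\sigma_1\sigma_1\leftrightarrow 1$ (two strands);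 \item V2: $\rho_1\rho_1\leftrightarrow 1$ (two strands); \item V3: $\rho_1\rho_2\rho_1\leftrightarrow\rho_2\rho_1\rho_2$; \item V4 (a strand moves through a real crossing by means of virtual crossings): $\rho_1\sigma_2\rho_1\leftrightarrow\rho_2\sigma_1\rho_2$, and its versions $\sigma_1\rho_2\rho_1\leftrightarrow\rho_2\rho_1\sigma_2$, $\rho_1\rho_2\sigma_1\leftrightarrow\sigma_2\rho_1\rho_2$; \item T1: $\gamma_2\rho_1\leftrightarrow\rho_1\gamma_1$ and $\gamma_1\rho_1\leftrightarrow\rho_1\gamma_2$; \item T2: $\gamma_1\gamma_1\leftrightarrow 1$ (one strand); \item T3: $\rho_1\sigma_1\rho_1\leftrightarrow\gamma_2\gamma_1\sigma_1\gamma_1\gamma_2$. \end{itemize} Let $\widetilde{TVT}_n$ be the set of equivalence classes of diagrams on $n$ strands, with the product $bb'$ given by placing $b$ over $b'$ and rescaling the height to $[0,1]$. Let $TVT_n$ be the abstract group generated by $s_i,\rho_i$ $(1\le i\le n-1)$ and $\gamma_j$ $(1\le j\le n)$ subject to the defining relations \begin{align*} s_i^2&=1 & (1\le i\le n-1),\qquad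 & s_is_j=s_js_i & (|i-j|>1),\\ \rho_i^2&=1 & (1\le i\le n-1),\qquad & \rho_i\rho_j=\rho_j\rho_i & (|i-j|>1),\\ \rho_i\rho_{i+1}\rho_i&=\rho_{i+1}\rho_i\rho_{i+1} & (1\le i\le n-2),\qquad & s_i\rho_j=\rho_js_i & (|i-j|>1),\\ \rho_is_{i+1}\rho_i&=\rho_{i+1}s_i\rho_{i+1} & (1\le i\le n-2),\qquad & \gamma_i^2=1 & (1\le i\le n),\\ \gamma_i\gamma_j&=\gamma_j\gamma_i & (1\le i,j\le n),\qquad & \gamma_j\rho_i=\rho_i\gamma_j & (j\ne i,i+1),\\ s_i\gamma_j&=\gamma_js_i & (j\ne i,i+1),\qquad & \gamma_{i+1}\rho_i=\rho_i\gamma_i & (1\le i\le n-1),\\ \rho_is_i\rho_i&=\gamma_{i+1}\gamma_is_i\gamma_i\gamma_{i+1} & (1\le i\le n-1).\qquad & & \end{align*} \textbf{Theorem.} For each $n\ge 1$, the product of diagrams makes $\widetilde{TVT}_n$ a group, and $TVT_n\cong\widetilde{TVT}_n$. More precisely, there is an isomorphism that sends $s_i$, $\rho_i$ and $\gamma_j$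 to the classes of the diagrams whose only crossing or bar is, respectively, a real crossing of the strands in positions $i,i+1$, a virtual crossing of the strands in positions $i,i+1$, and a bar on the strand in position $j$. -/

import Mathlib

open Set
open scoped ContDiff

namespace TwistedVirtualTwin

/-! ### The abstract group -/

/-- The symbols `s_i`, `ρ_i` (`1 ≤ i ≤ n - 1`) and `γ_j` (`1 ≤ j ≤ n`), with indices counted
from `0`. -/
inductive Gen (n : ℕ) : Type
  | s (i : ℕ) (h : i + 1 < n) : Gen n
  | rho (i : ℕ) (h : i + 1 < n) : Gen n
  | gamma (j : ℕ) (h : j < n) : Gen n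

section Presentation

/-- The letter `s_i` in the free group. -/
abbrev fs {n : ℕ} (i : ℕ) (h : i + 1 < n) : FreeGroup (Gen n) := FreeGroup.of (Gen.s i h)

/-- The letter `ρ_i` in the free group. -/
abbrev fr {n : ℕ} (i : ℕ) (h : i + 1 < n) : FreeGroup (Gen n) := FreeGroup.of (Gen.rho i h)

/-- The letter `γ_j` in the free group. -/
abbrev fg {n : ℕ} (j : ℕ) (h : j < n) : FreeGroup (Gen n) := FreeGroup.of (Gen.gamma j h)

/-- `Rel n u v` says that `u = v` is one of the defining relations of the twisted virtual twin
group on `n` strands. -/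
inductive Rel (n : ℕ) : FreeGroup (Gen n) → FreeGroup (Gen n) → Prop
  | s_sq (i : ℕ) (hi : i + 1 < n) : Rel n (fs i hi ^ 2) 1
  | s_s (i j : ℕ) (hi : i + 1 < n) (hj : j + 1 < n) (hij : i + 1 < j ∨ j + 1 < i) :
      Rel n (fs i hi * fs j hj) (fs j hj * fs i hi)
  | r_sq (i : ℕ) (hi : i + 1 < n) : Rel n (fr i hi ^ 2) 1
  | r_r (i j : ℕ) (hi : i + 1 < n) (hj : j + 1 < n) (hij : i + 1 < j ∨ j + 1 < i) :
      Rel n (fr i hi * fr j hj) (fr j hj * fr i hi)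
  | r_r_r (i : ℕ) (hi : i + 1 < n) (hi' : i + 1 + 1 < n) :
      Rel n (fr i hi * fr (i + 1) hi' * fr i hi) (fr (i + 1) hi' * fr i hi * fr (i + 1) hi')
  | s_r (i j : ℕ) (hi : i + 1 < n) (hj : j + 1 < n) (hij : i + 1 < j ∨ j + 1 < i) :
      Rel n (fs i hi * fr j hj) (fr j hj * fs i hi)
  | r_s_r (i : ℕ) (hi : i + 1 < n) (hi' : i + 1 + 1 < n) :
      Rel n (fr i hi * fs (i + 1) hi' * fr i hi) (fr (i + 1) hi' * fs i hi * fr (i + 1) hi')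
  | g_sq (i : ℕ) (hi : i < n) : Rel n (fg i hi ^ 2) 1
  | g_g (i j : ℕ) (hi : i < n) (hj : j < n) : Rel n (fg i hi * fg j hj) (fg j hj * fg i hi)
  | g_r (i j : ℕ) (hi : i + 1 < n) (hj : j < n) (h1 : j ≠ i) (h2 : j ≠ i + 1) :
      Rel n (fg j hj * fr i hi) (fr i hi * fg j hj)
  | s_g (i j : ℕ) (hi : i + 1 < n) (hj : j < n) (h1 : j ≠ i) (h2 : j ≠ i + 1) :
      Rel n (fs i hi * fg j hj) (fg j hj * fs i hi)
  | g_r_g (i : ℕ) (h0 : i < n) (hi : i + 1 < n) :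
      Rel n (fg (i + 1) hi * fr i hi) (fr i hi * fg i h0)
  | twist (i : ℕ) (h0 : i < n) (hi : i + 1 < n) :
      Rel n (fr i hi * fs i hi * fr i hi)
        (fg (i + 1) hi * fg i h0 * fs i hi * fg i h0 * fg (i + 1) hi)

/-- The abstract group `TVT_n`. -/
abbrev TVT (n : ℕ) : Type :=
  PresentedGroup {r : FreeGroup (Gen n) | ∃ u v, Rel n u v ∧ r = u * v⁻¹}

end Presentation

/-! ### Diagrams

A strand is monotonic in the second coordinate, so it is the graph `x = f y` of a function of the
height `y ∈ [0, 1]`.  The values of `f` outside `[0, 1]` play no role. -/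

/-- `f` is continuous on `[0, 1]`, and `[0, 1]` has a finite subdivision such that `f` is smooth on
each closed piece.  Smooth functions and polygonal ones are of this kind, and the class is closed
under stacking. -/
def PiecewiseSmooth (f : ℝ → ℝ) : Prop :=
  ContinuousOn f (Icc 0 1) ∧
    ∃ S : Finset ℝ, ∀ u v : ℝ, 0 ≤ u → u < v → v ≤ 1 → (∀ y ∈ S, y ∉ Ioo u v) →
      ContDiffOn ℝ ∞ f (Icc u v)

/-- The strand `{(f y, y) : y ∈ [0, 1]}`. -/
def graphOf (f : ℝ → ℝ) : Set (ℝ × ℝ) := {P | P.2 ∈ Icc (0 : ℝ) 1 ∧ P.1 = f P.2}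

/-- The points that lie on two different strands. -/
def crossingSet {n : ℕ} (pos : Fin n → ℝ → ℝ) : Set (ℝ × ℝ) :=
  {P | ∃ i j, i ≠ j ∧ P ∈ graphOf (pos i) ∧ P ∈ graphOf (pos j)}

/-- `f` and `g` cross transversally at height `y`: the difference `f - g` has one-sided derivatives
at `y`, which are nonzero and of the same sign.  Where `f` and `g` are differentiable this says that
their slopes differ; at a corner it says in addition that the curves change sides. -/
def CrossTransversally (f g : ℝ → ℝ) (y : ℝ) : Prop :=
  ∃ l r : ℝ, HasDerivWithinAt (fun u => f u - g u) l (Iic y) y ∧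
    HasDerivWithinAt (fun u => f u - g u) r (Ici y) y ∧ 0 < l * r

/-- A twisted virtual twin diagram on `n` strands.  The strand with index `i` starts at the top
point `(i + 1, 1)` and ends at the bottom point `(perm i + 1, 0)`.  The crossings in `real` are the
real ones, all the others are virtual. -/
structure Diagram (n : ℕ) where
  pos : Fin n → ℝ → ℝ
  perm : Equiv.Perm (Fin n)
  piecewiseSmooth : ∀ i, PiecewiseSmooth (pos i)
  top : ∀ i, pos i 1 = ((i : ℕ) : ℝ) + 1
  bottom : ∀ i, pos i 0 = ((perm i : ℕ) : ℝ) + 1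
  double : ∀ y ∈ Icc (0 : ℝ) 1, ∀ i j k, pos i y = pos j y → pos j y = pos k y →
    i = j ∨ j = k ∨ i = k
  transverse : ∀ i j, i ≠ j → ∀ y ∈ Icc (0 : ℝ) 1, pos i y = pos j y →
    CrossTransversally (pos i) (pos j) y
  real : Set (ℝ × ℝ)
  real_subset : real ⊆ crossingSet pos
  bars : Set (ℝ × ℝ)
  bars_finite : bars.Finite
  bars_strand : ∀ P ∈ bars, P.2 ∈ Ioo (0 : ℝ) 1 ∧ ∃ i, P ∈ graphOf (pos i)
  bars_crossing : ∀ P ∈ bars, P ∉ crossingSet pos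

namespace Diagram

variable {n : ℕ}

/-- The `i`-th strand, as a subset of the plane. -/
def strand (b : Diagram n) (i : Fin n) : Set (ℝ × ℝ) := graphOf (b.pos i)

/-- The union of the strands. -/
def support (b : Diagram n) : Set (ℝ × ℝ) := ⋃ i, b.strand i

/-- The virtual crossings. -/
def virtual (b : Diagram n) : Set (ℝ × ℝ) := crossingSet b.pos \ b.real

/-- The set `X(b)` of all crossings and of all points that carry a bar. -/
def events (b : Diagram n) : Set (ℝ × ℝ) := crossingSet b.pos ∪ b.bars

/-! ### Planar isotopy -/

/-- `b'` is obtained from `b` by a planar isotopy through diagrams: the union of the strands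
of `b` moves by a continuous family of embeddings `H t` into the plane that starts at the
inclusion; at each time `t` the image is a diagram `B t`, strand by strand, with the images of
the real crossings, of the virtual crossings and of the bars as its real crossings, virtual
crossings and bars; and `B 1 = b'`. -/
def Isotopic (b b' : Diagram n) : Prop :=
  ∃ (H : ℝ → ℝ × ℝ → ℝ × ℝ) (B : ℝ → Diagram n),
    ContinuousOn (fun z : ℝ × (ℝ × ℝ) => H z.1 z.2) (Icc (0 : ℝ) 1 ×ˢ b.support) ∧
    (∀ P ∈ b.support, H 0 P = P) ∧
    B 1 = b' ∧
    ∀ t ∈ Icc (0 : ℝ) 1,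
      InjOn (H t) b.support ∧
      (∀ i, H t '' b.strand i = (B t).strand i) ∧
      H t '' b.real = (B t).real ∧
      H t '' b.virtual = (B t).virtual ∧
      H t '' b.bars = (B t).bars

/-! ### Local pictures and moves -/

/-- The number of strands that at the height of `P` lie strictly between the vertical line at `a`
and the point `P`. -/
noncomputable def leftCount (b : Diagram n) (a : ℝ) (P : ℝ × ℝ) : ℕ :=
  {i : Fin n | a < b.pos i P.2 ∧ b.pos i P.2 < P.1}.ncard

/-- Counting the strands to the right of the vertical line at `a`, the point `P` is a real crossing
of the neighbouring strands `i` and `i + 1` (symbol `s_i`), a virtual crossing of them (symbol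
`ρ_i`), or a bar on the strand `j` (symbol `γ_j`). -/
def EventIs (b : Diagram n) (a : ℝ) {k : ℕ} (P : ℝ × ℝ) : Gen k → Prop
  | .s i _ => P ∈ b.real ∧ b.leftCount a P = i
  | .rho i _ => P ∈ b.virtual ∧ b.leftCount a P = i
  | .gamma j _ => P ∈ b.bars ∧ b.leftCount a P = j

/-- In the box `[a, c] × [p, q]` the diagram consists of `k` strands running from the top edge to
the bottom edge without meeting the vertical edges; the crossings and bars in the box lie in its
interior, at distinct heights, and from top to bottom they are as the word `w` prescribes. -/
def ShowsInBox (b : Diagram n) (a c p q : ℝ) {k : ℕ} (w : List (Gen k)) : Prop :=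
  (∀ i, (∀ y ∈ Icc p q, b.pos i y ∈ Ioo a c) ∨ (∀ y ∈ Icc p q, b.pos i y ∉ Icc a c)) ∧
  {i : Fin n | ∀ y ∈ Icc p q, b.pos i y ∈ Ioo a c}.ncard = k ∧
  ∃ L : List (ℝ × ℝ),
    L.Pairwise (fun P Q => Q.2 < P.2) ∧
    (∀ P, P ∈ L ↔ P ∈ b.events ∧ P ∈ Icc a c ×ˢ Icc p q) ∧
    (∀ P ∈ L, P.2 ∈ Ioo p q) ∧
    List.Forall₂ (fun P g => b.EventIs a P g) L w

/-- The two sides of the local moves, on `k` strands, read from top to bottom. -/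
inductive MovePicture : (k : ℕ) → List (Gen k) → List (Gen k) → Prop
  | R2 : MovePicture 2 [.s 0 (by decide), .s 0 (by decide)] []
  | V2 : MovePicture 2 [.rho 0 (by decide), .rho 0 (by decide)] []
  | V3 : MovePicture 3
      [.rho 0 (by decide), .rho 1 (by decide), .rho 0 (by decide)]
      [.rho 1 (by decide), .rho 0 (by decide), .rho 1 (by decide)]
  | V4_middle : MovePicture 3
      [.rho 0 (by decide), .s 1 (by decide), .rho 0 (by decide)]
      [.rho 1 (by decide), .s 0 (by decide), .rho 1 (by decide)]
  | V4_left : MovePicture 3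
      [.s 0 (by decide), .rho 1 (by decide), .rho 0 (by decide)]
      [.rho 1 (by decide), .rho 0 (by decide), .s 1 (by decide)]
  | V4_right : MovePicture 3
      [.rho 0 (by decide), .rho 1 (by decide), .s 0 (by decide)]
      [.s 1 (by decide), .rho 0 (by decide), .rho 1 (by decide)]
  | T1_left : MovePicture 2
      [.gamma 1 (by decide), .rho 0 (by decide)] [.rho 0 (by decide), .gamma 0 (by decide)]
  | T1_right : MovePicture 2
      [.gamma 0 (by decide), .rho 0 (by decide)] [.rho 0 (by decide), .gamma 1 (by decide)]
  | T2 : MovePicture 1 [.gamma 0 (by decide), .gamma 0 (by decide)] []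
  | T3 : MovePicture 2
      [.rho 0 (by decide), .s 0 (by decide), .rho 0 (by decide)]
      [.gamma 1 (by decide), .gamma 0 (by decide), .s 0 (by decide), .gamma 0 (by decide),
        .gamma 1 (by decide)]

/-- `b'` is obtained from `b` by a twisted Reidemeister twin move: inside some box `b` shows one
side of the move and `b'` shows the other, and outside the box the two diagrams coincide. -/
def LocalMove (b b' : Diagram n) : Prop :=
  ∃ (k : ℕ) (w w' : List (Gen k)), MovePicture k w w' ∧
    ∃ a c p q : ℝ, a < c ∧ 0 ≤ p ∧ p < q ∧ q ≤ 1 ∧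
      b.ShowsInBox a c p q w ∧ b'.ShowsInBox a c p q w' ∧
      (∀ i, b.strand i \ Ioo a c ×ˢ Ioo p q = b'.strand i \ Ioo a c ×ˢ Ioo p q) ∧
      b.real \ Ioo a c ×ˢ Ioo p q = b'.real \ Ioo a c ×ˢ Ioo p q ∧
      b.bars \ Ioo a c ×ˢ Ioo p q = b'.bars \ Ioo a c ×ˢ Ioo p q

/-- Equivalence of diagrams: finite sequences of planar isotopies and moves, the latter in both
directions. -/
def setoid (n : ℕ) : Setoid (Diagram n) :=
  Relation.EqvGen.setoid fun b b' => Isotopic b b' ∨ LocalMove b b'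

/-- The diagram is an elementary one: its only crossing or bar is the one that `g` names. -/
def Depicts (b : Diagram n) (g : Gen n) : Prop :=
  ∃ a c : ℝ, a < c ∧ b.ShowsInBox a c 0 1 [g]

/-! ### Stacking -/

/-- Place `f` over `g` and rescale to the height interval `[0, 1]`. -/
noncomputable def glue (f g : ℝ → ℝ) (y : ℝ) : ℝ :=
  if 1 / 2 ≤ y then f (2 * y - 1) else g (2 * y)

/-- The map of the strip onto its upper half. -/
noncomputable def upper (P : ℝ × ℝ) : ℝ × ℝ := (P.1, (P.2 + 1) / 2)

/-- The map of the strip onto its lower half. -/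
noncomputable def lower (P : ℝ × ℝ) : ℝ × ℝ := (P.1, P.2 / 2)

theorem glue_of_ge (f g : ℝ → ℝ) {y : ℝ} (hy : 1 / 2 ≤ y) : glue f g y = f (2 * y - 1) := by
  simp only [glue, if_pos hy]

theorem glue_of_lt (f g : ℝ → ℝ) {y : ℝ} (hy : y < 1 / 2) : glue f g y = g (2 * y) := by
  simp only [glue, if_neg (not_le.mpr hy)]

theorem glue_of_le {f g : ℝ → ℝ} (h : f 0 = g 1) {y : ℝ} (hy : y ≤ 1 / 2) :
    glue f g y = g (2 * y) := by
  rcases hy.lt_or_eq with hy | rfl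
  · exact glue_of_lt f g hy
  · rw [glue_of_ge f g le_rfl]
    norm_num [h]

theorem glue_continuousOn {f g : ℝ → ℝ} (hf : ContinuousOn f (Icc 0 1))
    (hg : ContinuousOn g (Icc 0 1)) (h : f 0 = g 1) : ContinuousOn (glue f g) (Icc 0 1) := by
  have h1 : ContinuousOn (glue f g) (Icc 0 (1 / 2)) := by
    refine ContinuousOn.congr (f := fun y => g (2 * y)) ?_ fun y hy => glue_of_le h hy.2
    refine hg.comp (by fun_prop) fun y hy => ?_
    constructor <;> linarith [hy.1, hy.2]
  have h2 : ContinuousOn (glue f g) (Icc (1 / 2) 1) := by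
    refine ContinuousOn.congr (f := fun y => f (2 * y - 1)) ?_ fun y hy => glue_of_ge f g hy.1
    refine hf.comp (by fun_prop) fun y hy => ?_
    constructor <;> linarith [hy.1, hy.2]
  have h3 := h1.union_of_isClosed h2 isClosed_Icc isClosed_Icc
  rwa [Icc_union_Icc_eq_Icc (by norm_num) (by norm_num)] at h3

theorem glue_piecewiseSmooth {f g : ℝ → ℝ} (hf : PiecewiseSmooth f) (hg : PiecewiseSmooth g)
    (h : f 0 = g 1) : PiecewiseSmooth (glue f g) := by
  classical
  obtain ⟨hfc, S, hS⟩ := hf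
  obtain ⟨hgc, T, hT⟩ := hg
  refine ⟨glue_continuousOn hfc hgc h,
    insert (1 / 2) (S.image (fun y => (y + 1) / 2) ∪ T.image (fun y => y / 2)), ?_⟩
  intro u v hu huv hv hd
  have hhalf : (1 / 2 : ℝ) ∉ Ioo u v := hd _ (by simp)
  by_cases hc : 1 / 2 ≤ u
  · have hs : ContDiffOn ℝ ∞ f (Icc (2 * u - 1) (2 * v - 1)) := by
      refine hS _ _ (by linarith) (by linarith) (by linarith) fun y hy hyI => ?_
      refine hd ((y + 1) / 2) ?_ ⟨by linarith [hyI.1], by linarith [hyI.2]⟩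
      exact Finset.mem_insert_of_mem
        (Finset.mem_union_left _ (Finset.mem_image_of_mem (fun y => (y + 1) / 2) hy))
    refine ContDiffOn.congr (f := fun y => f (2 * y - 1)) ?_
      fun y hy => glue_of_ge f g (hc.trans hy.1)
    refine hs.comp (by fun_prop) fun y hy => ?_
    constructor <;> linarith [hy.1, hy.2]
  · have hv2 : v ≤ 1 / 2 := by
      by_contra hcon
      exact hhalf ⟨not_le.mp hc, not_le.mp hcon⟩
    have hs : ContDiffOn ℝ ∞ g (Icc (2 * u) (2 * v)) := by
      refine hT _ _ (by linarith) (by linarith) (by linarith) fun y hy hyI => ?_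
      refine hd (y / 2) ?_ ⟨by linarith [hyI.1], by linarith [hyI.2]⟩
      exact Finset.mem_insert_of_mem
        (Finset.mem_union_right _ (Finset.mem_image_of_mem (fun y => y / 2) hy))
    refine ContDiffOn.congr (f := fun y => g (2 * y)) ?_
      fun y hy => glue_of_le h (hy.2.trans hv2)
    refine hs.comp (by fun_prop) fun y hy => ?_
    constructor <;> linarith [hy.1, hy.2]

theorem crossTransversally_affine {f₁ f₂ F₁ F₂ : ℝ → ℝ} {y c : ℝ}
    (h : CrossTransversally f₁ f₂ (2 * y + c))
    (h1 : F₁ =ᶠ[nhds y] fun u => f₁ (2 * u + c)) (h2 : F₂ =ᶠ[nhds y] fun u => f₂ (2 * u + c)) :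
    CrossTransversally F₁ F₂ y := by
  obtain ⟨l, r, hl, hr, hlr⟩ := h
  have hd (s : Set ℝ) : HasDerivWithinAt (fun u : ℝ => 2 * u + c) 2 s y := by
    simpa using (((hasDerivAt_id y).const_mul (2 : ℝ)).add_const c).hasDerivWithinAt
  have he : (fun u => F₁ u - F₂ u) =ᶠ[nhds y]
      ((fun u => f₁ u - f₂ u) ∘ fun u : ℝ => 2 * u + c) := by
    filter_upwards [h1, h2] with u hu1 hu2
    simp [hu1, hu2]
  refine ⟨l * 2, r * 2, ?_, ?_, by nlinarith⟩
  · refine HasDerivWithinAt.congr_of_eventuallyEq ?_ (he.filter_mono nhdsWithin_le_nhds) he.eq_of_nhds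
    refine HasDerivWithinAt.comp y hl (hd _) fun u hu => ?_
    simp only [mem_Iic] at hu ⊢
    linarith
  · refine HasDerivWithinAt.congr_of_eventuallyEq ?_ (he.filter_mono nhdsWithin_le_nhds) he.eq_of_nhds
    refine HasDerivWithinAt.comp y hr (hd _) fun u hu => ?_
    simp only [mem_Ici] at hu ⊢
    linarith

/-- The strands of the stacked diagram: the `i`-th strand of `b`, continued by the strand of `b'`
that starts where it ends. -/
noncomputable def stackPos (b b' : Diagram n) (i : Fin n) : ℝ → ℝ :=
  glue (b.pos i) (b'.pos (b.perm i))

theorem stack_match (b b' : Diagram n) (i : Fin n) : b.pos i 0 = b'.pos (b.perm i) 1 := by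
  rw [b.bottom, b'.top]

theorem pos_one_injective (b : Diagram n) {i j : Fin n} (h : b.pos i 1 = b.pos j 1) : i = j := by
  rw [b.top, b.top] at h
  exact Fin.ext (by exact_mod_cast add_right_cancel h)

theorem upper_mem_graphOf {b b' : Diagram n} {i : Fin n} {P : ℝ × ℝ} (h : P ∈ graphOf (b.pos i)) :
    upper P ∈ graphOf (stackPos b b' i) := by
  obtain ⟨⟨h0, h1⟩, h2⟩ := h
  refine ⟨⟨by simp only [upper]; linarith, by simp only [upper]; linarith⟩, ?_⟩
  simp only [upper, stackPos]
  rw [glue_of_ge _ _ (by linarith), h2]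
  congr 1
  ring

theorem lower_mem_graphOf {b b' : Diagram n} {i : Fin n} {P : ℝ × ℝ}
    (h : P ∈ graphOf (b'.pos (b.perm i))) : lower P ∈ graphOf (stackPos b b' i) := by
  obtain ⟨⟨h0, h1⟩, h2⟩ := h
  refine ⟨⟨by simp only [lower]; linarith, by simp only [lower]; linarith⟩, ?_⟩
  simp only [lower, stackPos]
  rw [glue_of_le (stack_match b b' i) (by linarith), h2]
  congr 1
  ring

theorem of_upper_mem_graphOf {b b' : Diagram n} {i : Fin n} {P : ℝ × ℝ} (hP : 0 ≤ P.2)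
    (h : upper P ∈ graphOf (stackPos b b' i)) : P ∈ graphOf (b.pos i) := by
  obtain ⟨⟨h0, h1⟩, h2⟩ := h
  simp only [upper, stackPos] at h0 h1 h2
  rw [glue_of_ge _ _ (by linarith)] at h2
  refine ⟨⟨hP, by linarith⟩, h2.trans ?_⟩
  congr 1
  ring

theorem of_lower_mem_graphOf {b b' : Diagram n} {i : Fin n} {P : ℝ × ℝ} (hP : P.2 ≤ 1)
    (h : lower P ∈ graphOf (stackPos b b' i)) : P ∈ graphOf (b'.pos (b.perm i)) := by
  obtain ⟨⟨h0, h1⟩, h2⟩ := h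
  simp only [lower, stackPos] at h0 h1 h2
  rw [glue_of_le (stack_match b b' i) (by linarith)] at h2
  refine ⟨⟨by linarith, hP⟩, h2.trans ?_⟩
  congr 1
  ring

/-- The product of diagrams: `b` is placed over `b'`, and the height is rescaled to `[0, 1]`. -/
noncomputable def stack (b b' : Diagram n) : Diagram n where
  pos := stackPos b b'
  perm := b.perm.trans b'.perm
  piecewiseSmooth i :=
    glue_piecewiseSmooth (b.piecewiseSmooth i) (b'.piecewiseSmooth _) (stack_match b b' i)
  top i := by
    rw [stackPos, glue_of_ge _ _ (by norm_num)]
    norm_num [b.top]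
  bottom i := by
    rw [stackPos, glue_of_lt _ _ (by norm_num)]
    norm_num [b'.bottom]
  double y hy i j k hij hjk := by
    simp only [stackPos] at hij hjk
    by_cases hc : 1 / 2 ≤ y
    · rw [glue_of_ge _ _ hc, glue_of_ge _ _ hc] at hij hjk
      exact b.double _ ⟨by linarith, by linarith [hy.2]⟩ i j k hij hjk
    · push Not at hc
      rw [glue_of_lt _ _ hc, glue_of_lt _ _ hc] at hij hjk
      simpa using b'.double _ ⟨by linarith [hy.1], by linarith⟩ _ _ _ hij hjk
  transverse i j hij y hy h := by
    simp only [stackPos] at h ⊢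
    rcases lt_trichotomy y (1 / 2) with hc | hc | hc
    · rw [glue_of_lt _ _ hc, glue_of_lt _ _ hc] at h
      have ht := b'.transverse (b.perm i) (b.perm j) (by simpa using hij) _
        ⟨by linarith [hy.1], by linarith⟩ h
      refine crossTransversally_affine (c := 0) (by simpa using ht) ?_ ?_ <;>
      · filter_upwards [Iio_mem_nhds hc] with u hu
        rw [glue_of_lt _ _ hu, add_zero]
    · subst hc
      rw [glue_of_le (stack_match b b' i) le_rfl, glue_of_le (stack_match b b' j) le_rfl] at h
      norm_num at h
      exact absurd (b.perm.injective (b'.pos_one_injective h)) hij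
    · rw [glue_of_ge _ _ hc.le, glue_of_ge _ _ hc.le] at h
      have ht := b.transverse i j hij _ ⟨by linarith, by linarith [hy.2]⟩ h
      refine crossTransversally_affine (c := -1) (by simpa [sub_eq_add_neg] using ht) ?_ ?_ <;>
      · filter_upwards [Ioi_mem_nhds hc] with u hu
        rw [glue_of_ge _ _ (le_of_lt hu), sub_eq_add_neg]
  real := upper '' b.real ∪ lower '' b'.real
  real_subset := by
    rintro _ (⟨P, hP, rfl⟩ | ⟨P, hP, rfl⟩)
    · obtain ⟨i, j, hij, hi, hj⟩ := b.real_subset hP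
      exact ⟨i, j, hij, upper_mem_graphOf hi, upper_mem_graphOf hj⟩
    · obtain ⟨i, j, hij, hi, hj⟩ := b'.real_subset hP
      refine ⟨b.perm.symm i, b.perm.symm j, by simpa using hij, lower_mem_graphOf ?_,
        lower_mem_graphOf ?_⟩ <;> simpa
  bars := upper '' b.bars ∪ lower '' b'.bars
  bars_finite := (b.bars_finite.image _).union (b'.bars_finite.image _)
  bars_strand := by
    rintro _ (⟨P, hP, rfl⟩ | ⟨P, hP, rfl⟩)
    · obtain ⟨hy, i, hi⟩ := b.bars_strand P hP
      refine ⟨⟨?_, ?_⟩, i, upper_mem_graphOf hi⟩ <;> simp only [upper] <;> linarith [hy.1, hy.2]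
    · obtain ⟨hy, i, hi⟩ := b'.bars_strand P hP
      refine ⟨⟨?_, ?_⟩, b.perm.symm i, lower_mem_graphOf (by simpa)⟩ <;> simp only [lower] <;>
        linarith [hy.1, hy.2]
  bars_crossing := by
    rintro _ (⟨P, hP, rfl⟩ | ⟨P, hP, rfl⟩) ⟨i, j, hij, hi, hj⟩
    · have hy := (b.bars_strand P hP).1
      exact b.bars_crossing P hP
        ⟨i, j, hij, of_upper_mem_graphOf hy.1.le hi, of_upper_mem_graphOf hy.1.le hj⟩
    · have hy := (b'.bars_strand P hP).1
      exact b'.bars_crossing P hP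
        ⟨b.perm i, b.perm j, by simpa using hij, of_lower_mem_graphOf hy.2.le hi,
          of_lower_mem_graphOf hy.2.le hj⟩

end Diagram

/-- The set of twisted virtual twins on `n` strands, i.e. of equivalence classes of diagrams. -/
def Twin (n : ℕ) : Type := Quotient (Diagram.setoid n)

/-- The twisted virtual twin that a diagram represents. -/
def Twin.mk {n : ℕ} (b : Diagram n) : Twin n := Quotient.mk (Diagram.setoid n) b

end TwistedVirtualTwin

set_option autoImplicit false

namespace TwistedVirtualTwin

open Filter Topology

/-! ### Real functions -/

/-! A diagram is read from top to bottom. Each crossing or bar contributes the letter given by its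
kind and by the number of strands to its left, and the product of these letters is the value of the
diagram in `TVT n`. Only the order of events that share a strand matters, since events without a
common strand occupy disjoint positions and have commuting letters (`foldl_eq_of_perm`,
`Ev.step_comm`). The letters can be found combinatorially, by updating a permutation of positions,
or geometrically, by counting strands; `IsReading.foldl_prefix` shows that both ways agree.

The value is invariant and multiplicative. An isotopy through monotone strands keeps the order of
heights along each strand, and the combinatorial reading sees nothing else (`value_eq_of_isotopic`).
A local move replaces a consecutive piece of a suitable reading by a piece with the same product
(`value_eq_of_localMove`). Reading a stack means reading the upper diagram and then the lower one
(`value_stack`).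

Conversely, each generator is sent to an elementary diagram with straight strands. Relations on
neighbouring strands are local moves in a vertical column of full height
(`Twin.prod_eq_of_movePicture`). Far commutation is not a move, yet it needs no explicit isotopy: in
`g g' g` the column of `g` shows the same generator twice, so R2, V2 or T2 deletes both copies and
`g g' g = g'` (`Twin.of_mul_of_comm`).

The resulting homomorphism is onto (`mk_mem_generated`). A diagram is straightened and cut at
heights without events until every slice has at most one event height. Such a slice is isotopic to
one with straight strands (`samePattern_level`), and the same cancelling trick splits off its events
one at a time (`mk_level_mem`). The only isotopies built by hand are straight-line ones between
diagrams whose strands are ordered alike at every height (`SamePattern.isotopic`) and changes of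
height (`isotopic_reparam`).

So the twins are products of involutions and form a group. An elementary diagram reads its own
generator, hence the value inverts the homomorphism; the same holds for every diagram that depicts
the generator. -/

theorem eventually_pos_right {f : ℝ → ℝ} {r y : ℝ} (h : HasDerivWithinAt f r (Ici y) y)
    (h0 : f y = 0) (hr : 0 < r) : ∀ᶠ u in 𝓝[>] y, 0 < f u := by
  have h1 := (hasDerivWithinAt_iff_tendsto_slope.mp h).eventually (lt_mem_nhds hr)
  rw [Ici_sdiff_left] at h1
  filter_upwards [h1, self_mem_nhdsWithin] with u hu hy
  rw [slope_def_field, h0, sub_zero] at hu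
  have hy' : 0 < u - y := sub_pos.mpr hy
  by_contra hc
  exact absurd hu (not_lt.mpr (div_nonpos_of_nonpos_of_nonneg (not_lt.mp hc) hy'.le))

theorem eventually_neg_left {f : ℝ → ℝ} {l y : ℝ} (h : HasDerivWithinAt f l (Iic y) y)
    (h0 : f y = 0) (hl : 0 < l) : ∀ᶠ u in 𝓝[<] y, f u < 0 := by
  have h1 := (hasDerivWithinAt_iff_tendsto_slope.mp h).eventually (lt_mem_nhds hl)
  rw [Iic_sdiff_right] at h1
  filter_upwards [h1, self_mem_nhdsWithin] with u hu hy
  rw [slope_def_field, h0, sub_zero] at hu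
  have hy' : u - y < 0 := sub_neg.mpr hy
  by_contra hc
  exact absurd hu (not_lt.mpr (div_nonpos_of_nonneg_of_nonpos (not_lt.mp hc) hy'.le))

theorem CrossTransversally.symm {f g : ℝ → ℝ} {y : ℝ} (h : CrossTransversally f g y) :
    CrossTransversally g f y := by
  obtain ⟨l, r, hl, hr, hlr⟩ := h
  refine ⟨-l, -r, ?_, ?_, by nlinarith⟩
  · exact hl.neg.congr_of_eventuallyEq (.of_forall fun u => (neg_sub (f u) (g u)).symm) (by simp)
  · exact hr.neg.congr_of_eventuallyEq (.of_forall fun u => (neg_sub (f u) (g u)).symm) (by simp)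

/-- At a transverse crossing the two curves change sides. -/
theorem CrossTransversally.eventually_lt {f g : ℝ → ℝ} {y : ℝ} (h : CrossTransversally f g y)
    (he : f y = g y) :
    ((∀ᶠ u in 𝓝[<] y, f u < g u) ∧ ∀ᶠ u in 𝓝[>] y, g u < f u) ∨
      ((∀ᶠ u in 𝓝[<] y, g u < f u) ∧ ∀ᶠ u in 𝓝[>] y, f u < g u) := by
  have key : ∀ f g : ℝ → ℝ, f y = g y → ∀ l r : ℝ,
      HasDerivWithinAt (fun u => f u - g u) l (Iic y) y →
      HasDerivWithinAt (fun u => f u - g u) r (Ici y) y → 0 < l → 0 < r →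
      (∀ᶠ u in 𝓝[<] y, f u < g u) ∧ ∀ᶠ u in 𝓝[>] y, g u < f u := by
    intro f g he l r hl hr h1 h2
    refine ⟨?_, ?_⟩
    · filter_upwards [eventually_neg_left hl (by simp [he]) h1] with u hu
      linarith
    · filter_upwards [eventually_pos_right hr (by simp [he]) h2] with u hu
      linarith
  obtain ⟨l, r, hl, hr, hlr⟩ := h
  rcases lt_trichotomy 0 l with h0 | h0 | h0
  · exact Or.inl (key f g he l r hl hr h0 (pos_of_mul_pos_right hlr h0.le))
  · simp [← h0] at hlr
  · refine Or.inr (key g f he.symm (-l) (-r) ?_ ?_ (by linarith) (by nlinarith))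
    · exact hl.neg.congr_of_eventuallyEq (.of_forall fun u => (neg_sub (f u) (g u)).symm) (by simp)
    · exact hr.neg.congr_of_eventuallyEq (.of_forall fun u => (neg_sub (f u) (g u)).symm) (by simp)

theorem CrossTransversally.congr {f g F G : ℝ → ℝ} {y : ℝ} (h : CrossTransversally f g y)
    (hF : F =ᶠ[𝓝 y] f) (hG : G =ᶠ[𝓝 y] g) : CrossTransversally F G y := by
  obtain ⟨l, r, hl, hr, hlr⟩ := h
  have he : (fun u => F u - G u) =ᶠ[𝓝 y] fun u => f u - g u := by
    filter_upwards [hF, hG] with u h1 h2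
    rw [h1, h2]
  exact ⟨l, r, hl.congr_of_eventuallyEq (he.filter_mono nhdsWithin_le_nhds) he.eq_of_nhds,
    hr.congr_of_eventuallyEq (he.filter_mono nhdsWithin_le_nhds) he.eq_of_nhds, hlr⟩

/-- One-sided derivatives of `φ` suffice, because a monotone map sends each half-line at `y` into
the corresponding half-line at `φ y`. The height changes used later are only piecewise linear, so
this generality is needed. -/
theorem CrossTransversally.comp {f g φ : ℝ → ℝ} {y l r : ℝ} (h : CrossTransversally f g (φ y))
    (hφ : Monotone φ) (hl : HasDerivWithinAt φ l (Iic y) y) (hr : HasDerivWithinAt φ r (Ici y) y)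
    (hl0 : 0 < l) (hr0 : 0 < r) : CrossTransversally (f ∘ φ) (g ∘ φ) y := by
  obtain ⟨l', r', hl', hr', hlr⟩ := h
  refine ⟨l' * l, r' * r, ?_, ?_, ?_⟩
  · exact hl'.comp y hl fun u hu => hφ hu
  · exact hr'.comp y hr fun u hu => hφ hu
  · have : l' * l * (r' * r) = (l' * r') * (l * r) := by ring
    rw [this]
    positivity

/-- A convex combination of two transverse crossings of the same kind is transverse. -/
theorem CrossTransversally.convex {f g F G : ℝ → ℝ} {y t : ℝ} (h : CrossTransversally f g y)
    (H : CrossTransversally F G y) (he : f y = g y) (hE : F y = G y)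
    (hs : ∀ᶠ u in 𝓝[>] y, f u < g u ↔ F u < G u) (h0 : 0 ≤ t) (h1 : t ≤ 1) :
    CrossTransversally (fun u => (1 - t) * f u + t * F u) (fun u => (1 - t) * g u + t * G u) y := by
  obtain ⟨l, r, hl, hr, hlr⟩ := h
  obtain ⟨L, R, hL, hR, hLR⟩ := H
  -- Right derivatives of opposite signs would order the two pairs oppositely just after `y`,
  -- against `hs`.
  have hrR : 0 < r * R := by
    have hr0 : r ≠ 0 := fun h => by simp [h] at hlr
    have hR0 : R ≠ 0 := fun h => by simp [h] at hLR
    rcases hr0.lt_or_gt with h2 | h2 <;> rcases hR0.lt_or_gt with h3 | h3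
    · nlinarith
    · exfalso
      have e1 := eventually_pos_right hr.neg (by simp [he]) (by linarith : 0 < -r)
      have e2 := eventually_pos_right hR (by simp [hE]) h3
      obtain ⟨u, hu⟩ := (e1.and (e2.and hs)).exists
      simp only [Pi.neg_apply] at hu
      have := hu.2.2.mp (by linarith)
      linarith
    · exfalso
      have e1 := eventually_pos_right hr (by simp [he]) h2
      have e2 := eventually_pos_right hR.neg (by simp [hE]) (by linarith : 0 < -R)
      obtain ⟨u, hu⟩ := (e1.and (e2.and hs)).exists
      simp only [Pi.neg_apply] at hu
      have := hu.2.2.mpr (by linarith)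
      linarith
    · positivity
  have e : (fun u => (1 - t) * f u + t * F u - ((1 - t) * g u + t * G u)) =
      fun u => (1 - t) * (f u - g u) + t * (F u - G u) := by
    ext u
    ring
  refine ⟨(1 - t) * l + t * L, (1 - t) * r + t * R, ?_, ?_, ?_⟩
  · rw [e]
    exact (hl.const_mul _).add (hL.const_mul _)
  · rw [e]
    exact (hr.const_mul _).add (hR.const_mul _)
  -- All four one-sided derivatives now have the same sign, so every term of the expanded product is
  -- nonnegative and one of them is positive.
  · have hlL : 0 < l * R := by
      have : 0 < (l * R) * (r * r) := by nlinarith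
      exact pos_of_mul_pos_left this (mul_self_nonneg _)
    have hLr : 0 < L * r := by
      have : 0 < (L * r) * (R * R) := by nlinarith
      exact pos_of_mul_pos_left this (mul_self_nonneg _)
    have e2 : ((1 - t) * l + t * L) * ((1 - t) * r + t * R) =
      (1 - t) ^ 2 * (l * r) + (1 - t) * t * (l * R) + (1 - t) * t * (L * r) + t ^ 2 * (L * R) := by
      ring
    rw [e2]
    have h1' : 0 ≤ 1 - t := by linarith
    rcases h0.eq_or_lt with h2 | h2
    · subst h2
      simpa using hlr
    · have a1 : 0 ≤ (1 - t) ^ 2 * (l * r) := by positivity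
      have a2 : 0 ≤ (1 - t) * t * (l * R) := by positivity
      have a3 : 0 ≤ (1 - t) * t * (L * r) := by positivity
      have a4 : 0 < t ^ 2 * (L * R) := by positivity
      linarith

/-- The intermediate value theorem for the difference. It is applied to two strands, to a strand and
a vertical line, and to the heights of two points in the course of an isotopy. -/
theorem lt_iff_lt_of_forall_ne {f g : ℝ → ℝ} {u v : ℝ} (huv : u ≤ v) (hf : ContinuousOn f (Icc u v))
    (hg : ContinuousOn g (Icc u v)) (h : ∀ y ∈ Icc u v, f y ≠ g y) :
    f u < g u ↔ f v < g v := by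
  have key : ∀ f g : ℝ → ℝ, ContinuousOn f (Icc u v) → ContinuousOn g (Icc u v) →
      (∀ y ∈ Icc u v, f y ≠ g y) → f u < g u → f v < g v := by
    intro f g hf hg h hu
    by_contra hc
    obtain ⟨y, hy, hy'⟩ := intermediate_value_Icc huv (hf.sub hg)
      (show (0 : ℝ) ∈ Icc _ _ from ⟨by simp only [Pi.sub_apply]; linarith,
        by simp only [Pi.sub_apply]; linarith⟩)
    exact h y hy (sub_eq_zero.mp hy')
  refine ⟨key f g hf hg h, fun hv => ?_⟩
  by_contra hc
  have hne := h u ⟨le_rfl, huv⟩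
  have := key g f hg hf (fun y hy => (h y hy).symm) (lt_of_le_of_ne (not_lt.mp hc) hne.symm)
  linarith

/-! ### Piecewise smooth functions -/

theorem PiecewiseSmooth.of_contDiff {f : ℝ → ℝ} (h : ContDiff ℝ ∞ f) : PiecewiseSmooth f :=
  ⟨h.continuous.continuousOn, ∅, fun _ _ _ _ _ _ => h.contDiffOn⟩

theorem PiecewiseSmooth.add {f g : ℝ → ℝ} (hf : PiecewiseSmooth f) (hg : PiecewiseSmooth g) :
    PiecewiseSmooth fun y => f y + g y := by
  classical
  obtain ⟨hc, S, hS⟩ := hf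
  obtain ⟨hc', T, hT⟩ := hg
  refine ⟨hc.add hc', S ∪ T, fun u v hu huv hv hd => ?_⟩
  exact (hS u v hu huv hv fun y hy => hd y (Finset.mem_union_left _ hy)).add
    (hT u v hu huv hv fun y hy => hd y (Finset.mem_union_right _ hy))

theorem PiecewiseSmooth.mul {f g : ℝ → ℝ} (hf : PiecewiseSmooth f) (hg : PiecewiseSmooth g) :
    PiecewiseSmooth fun y => f y * g y := by
  classical
  obtain ⟨hc, S, hS⟩ := hf
  obtain ⟨hc', T, hT⟩ := hg
  refine ⟨hc.mul hc', S ∪ T, fun u v hu huv hv hd => ?_⟩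
  exact (hS u v hu huv hv fun y hy => hd y (Finset.mem_union_left _ hy)).mul
    (hT u v hu huv hv fun y hy => hd y (Finset.mem_union_right _ hy))

theorem PiecewiseSmooth.comp {f φ : ℝ → ℝ} (hf : PiecewiseSmooth f) (hφ : PiecewiseSmooth φ)
    (hm : StrictMono φ) (h0 : ∀ y ∈ Icc (0 : ℝ) 1, φ y ∈ Icc (0 : ℝ) 1) :
    PiecewiseSmooth fun y => f (φ y) := by
  classical
  obtain ⟨hc, S, hS⟩ := hf
  obtain ⟨hc', T, hT⟩ := hφ
  -- The breakpoints are those of `φ` and the `φ`-preimages of those of `f`; injectivity keeps them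
  -- finite in number.
  refine ⟨hc.comp hc' h0, T ∪ S.preimage φ hm.injective.injOn, fun u v hu huv hv hd => ?_⟩
  have h1 := hT u v hu huv hv fun y hy => hd y (Finset.mem_union_left _ hy)
  have hu' := h0 u ⟨hu, huv.le.trans hv⟩
  have hv' := h0 v ⟨hu.trans huv.le, hv⟩
  have hcu : ContinuousOn φ (Icc u v) := hc'.mono (Icc_subset_Icc hu hv)
  have h2 := hS (φ u) (φ v) hu'.1 (hm huv) hv'.2 fun y hy hyI => by
    obtain ⟨z, hz, rfl⟩ := intermediate_value_Icc huv.le hcu ⟨hyI.1.le, hyI.2.le⟩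
    refine hd z (Finset.mem_union_right _ (Finset.mem_preimage.mpr hy)) ⟨?_, ?_⟩
    · exact hm.lt_iff_lt.mp hyI.1
    · exact hm.lt_iff_lt.mp hyI.2
  exact h2.comp h1 fun y hy => ⟨hm.monotone hy.1, hm.monotone hy.2⟩

/-! ### Order of the strands -/

namespace Diagram

variable {n : ℕ} (b : Diagram n)

theorem continuousOn_pos (i : Fin n) : ContinuousOn (b.pos i) (Icc 0 1) := (b.piecewiseSmooth i).1

theorem pos_one_ne {i j : Fin n} (h : i ≠ j) : b.pos i 1 ≠ b.pos j 1 :=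
  fun he => h (b.pos_one_injective he)

theorem pos_zero_ne {i j : Fin n} (h : i ≠ j) : b.pos i 0 ≠ b.pos j 0 := by
  intro he
  rw [b.bottom, b.bottom] at he
  exact h (b.perm.injective (Fin.ext (by exact_mod_cast add_right_cancel he)))

theorem mem_Ioo_of_pos_eq {i j : Fin n} (h : i ≠ j) {y : ℝ} (hy : y ∈ Icc (0 : ℝ) 1)
    (he : b.pos i y = b.pos j y) : y ∈ Ioo (0 : ℝ) 1 := by
  refine ⟨lt_of_le_of_ne hy.1 ?_, lt_of_le_of_ne hy.2 ?_⟩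
  · rintro rfl
    exact b.pos_zero_ne h he
  · rintro rfl
    exact b.pos_one_ne h he

theorem pos_lt_iff_of_forall_ne {i j : Fin n} {u v : ℝ} (hu : 0 ≤ u) (huv : u ≤ v) (hv : v ≤ 1)
    (h : ∀ y ∈ Icc u v, b.pos i y ≠ b.pos j y) : b.pos i u < b.pos j u ↔ b.pos i v < b.pos j v :=
  lt_iff_lt_of_forall_ne huv ((b.continuousOn_pos i).mono (Icc_subset_Icc hu hv))
    ((b.continuousOn_pos j).mono (Icc_subset_Icc hu hv)) h

/-- Two strands that cross exactly once between the heights `u` and `v` change sides. -/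
theorem pos_lt_iff_of_cross {i j : Fin n} (hij : i ≠ j) {u y v : ℝ} (hu : 0 ≤ u) (huy : u < y)
    (hyv : y < v) (hv : v ≤ 1) (he : b.pos i y = b.pos j y)
    (h : ∀ z ∈ Icc u v, b.pos i z = b.pos j z → z = y) :
    b.pos i u < b.pos j u ↔ b.pos j v < b.pos i v := by
  have hleft : ∀ᶠ w in 𝓝[<] y, w ∈ Ioo u y := Ioo_mem_nhdsLT huy
  have hright : ∀ᶠ w in 𝓝[>] y, w ∈ Ioo y v := Ioo_mem_nhdsGT hyv
  -- Off `y` the order is constant on each side, so it may be compared arbitrarily close to `y`,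
  -- where transversality decides it.
  have key : ∀ w z, w ∈ Ioo u y → z ∈ Ioo y v →
      ((b.pos i u < b.pos j u ↔ b.pos i w < b.pos j w) ∧
        (b.pos j z < b.pos i z ↔ b.pos j v < b.pos i v)) := by
    intro w z hw hz
    refine ⟨b.pos_lt_iff_of_forall_ne hu hw.1.le (by linarith [hw.2]) fun x hx hxe => ?_,
      b.pos_lt_iff_of_forall_ne (by linarith [hz.1]) hz.2.le hv fun x hx hxe => ?_⟩
    · have := h x ⟨hx.1, by linarith [hx.2, hw.2]⟩ hxe
      linarith [hx.2, hw.2]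
    · have := h x ⟨by linarith [hx.1, hz.1], hx.2⟩ hxe.symm
      linarith [hx.1, hz.1]
  rcases (b.transverse i j hij y ⟨by linarith, by linarith⟩ he).eventually_lt he with
    ⟨h1, h2⟩ | ⟨h1, h2⟩
  · obtain ⟨w, hw, hw'⟩ := (h1.and hleft).exists
    obtain ⟨z, hz, hz'⟩ := (h2.and hright).exists
    obtain ⟨k1, k2⟩ := key w z hw' hz'
    exact iff_of_true (k1.mpr hw) (k2.mp hz)
  · obtain ⟨w, hw, hw'⟩ := (h1.and hleft).exists
    obtain ⟨z, hz, hz'⟩ := (h2.and hright).exists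
    obtain ⟨k1, k2⟩ := key w z hw' hz'
    refine iff_of_false (fun hc => ?_) (fun hc => ?_)
    · exact absurd (k1.mp hc) (not_lt.mpr hw.le)
    · exact absurd (k2.mpr hc) (not_lt.mpr hz.le)

/-- Infinitely many crossing heights would accumulate in `[0, 1]`. By continuity the strands would
meet at the limit, and transversality there makes them differ in a punctured neighbourhood. -/
theorem finite_crossing_heights {i j : Fin n} (hij : i ≠ j) :
    {y | y ∈ Icc (0 : ℝ) 1 ∧ b.pos i y = b.pos j y}.Finite := by
  by_contra hinf
  obtain ⟨y, hy, hacc⟩ := Set.Infinite.exists_accPt_of_subset_isCompact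
    (s := {y | y ∈ Icc (0 : ℝ) 1 ∧ b.pos i y = b.pos j y}) hinf (isCompact_Icc (a := (0 : ℝ)) (b := 1))
    fun y hy => hy.1
  rw [accPt_iff_frequently] at hacc
  have he : b.pos i y = b.pos j y := by
    have hcl : IsClosed {y | y ∈ Icc (0 : ℝ) 1 ∧ b.pos i y = b.pos j y} := by
      have := ((b.continuousOn_pos i).sub (b.continuousOn_pos j)).preimage_isClosed_of_isClosed
        isClosed_Icc (isClosed_singleton (x := (0 : ℝ)))
      convert this using 1
      ext z
      simp [sub_eq_zero]
    have hmem := hcl.closure_subset (mem_closure_iff_frequently.mpr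
      (hacc.mono fun z hz => hz.2))
    exact hmem.2
  refine hacc ?_
  have hne : ∀ᶠ z in 𝓝[≠] y, b.pos i z ≠ b.pos j z := by
    rw [← Iio_union_Ioi, nhdsWithin_union, eventually_sup]
    rcases (b.transverse i j hij y hy he).eventually_lt he with ⟨h1, h2⟩ | ⟨h1, h2⟩
    · exact ⟨h1.mono fun _ h => h.ne, h2.mono fun _ h => h.ne'⟩
    · exact ⟨h1.mono fun _ h => h.ne', h2.mono fun _ h => h.ne⟩
  rw [eventually_nhdsWithin_iff] at hne
  filter_upwards [hne] with z hz hc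
  exact hz hc.1 hc.2.2

/-- The heights at which a given pair of strands cross, as a finite set. -/
theorem exists_crossing_heights :
    ∃ F : Finset ℝ, ∀ i j : Fin n, i ≠ j → ∀ y ∈ Icc (0 : ℝ) 1, b.pos i y = b.pos j y → y ∈ F := by
  classical
  have hfin : (⋃ i : Fin n, ⋃ j : Fin n, ⋃ _ : i ≠ j,
      {y | y ∈ Icc (0 : ℝ) 1 ∧ b.pos i y = b.pos j y}).Finite :=
    Set.finite_iUnion fun i => Set.finite_iUnion fun j => Set.finite_iUnion fun h =>
      b.finite_crossing_heights h
  refine ⟨hfin.toFinset, fun i j h y hy he => ?_⟩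
  simp only [Finite.mem_toFinset, mem_iUnion]
  exact ⟨i, j, h, hy, he⟩

end Diagram

end TwistedVirtualTwin

namespace TwistedVirtualTwin

open Filter Topology

/-! ### Letters in the abstract group -/

/-- The three kinds of generators and of events. -/
inductive Kind
  | s
  | rho
  | gamma
  deriving DecidableEq

/-- The number of strands that take part in an event. -/
def Kind.width : Kind → ℕ
  | .s => 2
  | .rho => 2
  | .gamma => 1

/-- The kind of a generator. -/
def Gen.kind {n : ℕ} : Gen n → Kind
  | .s _ _ => .s
  | .rho _ _ => .rho
  | .gamma _ _ => .gamma

/-- The index of a generator. -/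
def Gen.idx {n : ℕ} : Gen n → ℕ
  | .s i _ => i
  | .rho i _ => i
  | .gamma j _ => j

theorem Gen.idx_lt {n : ℕ} (g : Gen n) : g.idx + g.kind.width ≤ n := by
  cases g <;> simp only [Gen.idx, Gen.kind, Kind.width] <;> omega

/-- The generator of a given kind and index. -/
def Gen.ofKind {n : ℕ} (κ : Kind) (m : ℕ) (h : m + κ.width ≤ n) : Gen n :=
  match κ, h with
  | .s, h => .s m h
  | .rho, h => .rho m h
  | .gamma, h => .gamma m h

/-- The generator of `TVT n` of a given kind and index; `1` if there is none. -/
def letter (n : ℕ) (κ : Kind) (m : ℕ) : TVT n :=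
  if h : m + κ.width ≤ n then PresentedGroup.of (Gen.ofKind κ m h) else 1

theorem letter_kind_idx {n : ℕ} (g : Gen n) : letter n g.kind g.idx = PresentedGroup.of g := by
  rw [letter, dif_pos g.idx_lt]
  cases g <;> rfl

theorem TVT.mk_eq {n : ℕ} {u v : FreeGroup (Gen n)} (h : Rel n u v) :
    (PresentedGroup.mk {r : FreeGroup (Gen n) | ∃ u v, Rel n u v ∧ r = u * v⁻¹} u : TVT n) =
      PresentedGroup.mk {r : FreeGroup (Gen n) | ∃ u v, Rel n u v ∧ r = u * v⁻¹} v :=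
  PresentedGroup.mk_eq_mk_of_mul_inv_mem ⟨u, v, h, rfl⟩

section Relations

variable {n : ℕ}

theorem letter_of_le {κ : Kind} {m : ℕ} (h : m + κ.width ≤ n) :
    letter n κ m = PresentedGroup.mk _ (FreeGroup.of (Gen.ofKind κ m h)) := by
  rw [letter, dif_pos h]
  rfl

theorem letter_sq (κ : Kind) (m : ℕ) : letter n κ m * letter n κ m = 1 := by
  by_cases h : m + κ.width ≤ n
  · rw [letter_of_le h, ← map_mul, ← sq, ← map_one (PresentedGroup.mk _)]
    cases κ
    · exact TVT.mk_eq (.s_sq m h)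
    · exact TVT.mk_eq (.r_sq m h)
    · exact TVT.mk_eq (.g_sq m h)
  · rw [letter, dif_neg h, mul_one]

/-- All six far-commutation relations in one form: letters on disjoint blocks of positions commute.
A letter out of range is `1` and causes no exception. -/
theorem letter_comm {κ κ' : Kind} {m m' : ℕ} (h : m + κ.width ≤ m' ∨ m' + κ'.width ≤ m) :
    letter n κ m * letter n κ' m' = letter n κ' m' * letter n κ m := by
  by_cases h1 : m + κ.width ≤ n
  swap
  · rw [letter, dif_neg h1, mul_one, one_mul]
  by_cases h2 : m' + κ'.width ≤ n
  swap
  · rw [letter, letter, dif_neg h2, mul_one, one_mul]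
  rw [letter_of_le h1, letter_of_le h2, ← map_mul, ← map_mul]
  cases κ <;> cases κ' <;> simp only [Kind.width] at h h1 h2
  · exact TVT.mk_eq (.s_s m m' h1 h2 (by omega))
  · exact TVT.mk_eq (.s_r m m' h1 h2 (by omega))
  · exact TVT.mk_eq (.s_g m m' h1 h2 (by omega) (by omega))
  · exact (TVT.mk_eq (.s_r m' m h2 h1 (by omega))).symm
  · exact TVT.mk_eq (.r_r m m' h1 h2 (by omega))
  · exact (TVT.mk_eq (.g_r m m' h1 h2 (by omega) (by omega))).symm
  · exact (TVT.mk_eq (.s_g m' m h2 h1 (by omega) (by omega))).symm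
  · exact TVT.mk_eq (.g_r m' m h2 h1 (by omega) (by omega))
  · exact TVT.mk_eq (.g_g m m' h1 h2)

theorem letter_r_r_r {m : ℕ} (h : m + 3 ≤ n) :
    letter n .rho m * letter n .rho (m + 1) * letter n .rho m =
      letter n .rho (m + 1) * letter n .rho m * letter n .rho (m + 1) := by
  have h1 : m + Kind.rho.width ≤ n := by simp only [Kind.width]; omega
  have h2 : m + 1 + Kind.rho.width ≤ n := by simp only [Kind.width]; omega
  rw [letter_of_le h1, letter_of_le h2]
  simp only [← map_mul]
  exact TVT.mk_eq (.r_r_r m h1 h2)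

theorem letter_r_s_r {m : ℕ} (h : m + 3 ≤ n) :
    letter n .rho m * letter n .s (m + 1) * letter n .rho m =
      letter n .rho (m + 1) * letter n .s m * letter n .rho (m + 1) := by
  have h1 : m + Kind.rho.width ≤ n := by simp only [Kind.width]; omega
  have h2 : m + 1 + Kind.rho.width ≤ n := by simp only [Kind.width]; omega
  have h3 : m + Kind.s.width ≤ n := by simp only [Kind.width]; omega
  have h4 : m + 1 + Kind.s.width ≤ n := by simp only [Kind.width]; omega
  rw [letter_of_le h1, letter_of_le h2, letter_of_le h3, letter_of_le h4]
  simp only [← map_mul]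
  exact TVT.mk_eq (.r_s_r m h1 h2)

theorem letter_g_r {m : ℕ} (h : m + 2 ≤ n) :
    letter n .gamma (m + 1) * letter n .rho m = letter n .rho m * letter n .gamma m := by
  have h1 : m + Kind.rho.width ≤ n := h
  have h2 : m + 1 + Kind.gamma.width ≤ n := h
  have h3 : m + Kind.gamma.width ≤ n := by simp only [Kind.width]; omega
  rw [letter_of_le h1, letter_of_le h2, letter_of_le h3]
  simp only [← map_mul]
  exact TVT.mk_eq (.g_r_g m h3 h1)

theorem letter_twist {m : ℕ} (h : m + 2 ≤ n) :
    letter n .rho m * letter n .s m * letter n .rho m =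
      letter n .gamma (m + 1) * letter n .gamma m * letter n .s m * letter n .gamma m *
        letter n .gamma (m + 1) := by
  have h1 : m + Kind.rho.width ≤ n := h
  have h2 : m + 1 + Kind.gamma.width ≤ n := h
  have h3 : m + Kind.gamma.width ≤ n := by simp only [Kind.width]; omega
  have h4 : m + Kind.s.width ≤ n := h
  rw [letter_of_le h1, letter_of_le h2, letter_of_le h3, letter_of_le h4]
  simp only [← map_mul]
  exact TVT.mk_eq (.twist m h3 h1)

/-- The letter that a generator on `k` strands gives when the strands are the ones in positions
`o, …, o + k - 1`. -/
def shiftLetter (n o : ℕ) {k : ℕ} (g : Gen k) : TVT n := letter n g.kind (o + g.idx)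

/-- The local moves hold in the abstract group. -/
theorem prod_shiftLetter_eq {k : ℕ} {w w' : List (Gen k)} (h : Diagram.MovePicture k w w') {o : ℕ}
    (ho : o + k ≤ n) : (w.map (shiftLetter n o)).prod = (w'.map (shiftLetter n o)).prod := by
  have hr (m : ℕ) (x : TVT n) : letter n .rho m * (letter n .rho m * x) = x := by
    rw [← mul_assoc, letter_sq, one_mul]
  cases h <;> simp only [List.map_cons, List.map_nil, List.prod_cons, List.prod_nil, mul_one,
    shiftLetter, Gen.kind, Gen.idx, add_zero]
  · exact letter_sq _ _
  · exact letter_sq _ _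
  · simpa only [mul_assoc] using letter_r_r_r ho
  · simpa only [mul_assoc] using letter_r_s_r ho
  -- The two other versions of V4 come from the middle one by multiplying with a `ρ` on either side
  -- and cancelling squares.
  · have h3 := congrArg (fun x => letter n .rho (o + 1) * (x * letter n .rho o)) (letter_r_s_r ho)
    simp only [mul_assoc, hr, letter_sq, mul_one] at h3
    exact h3.symm
  · have h3 := congrArg (fun x => letter n .rho o * (x * letter n .rho (o + 1))) (letter_r_s_r ho)
    simp only [mul_assoc, hr, letter_sq, mul_one] at h3
    exact h3.symm
  · exact letter_g_r ho
  -- The mirror image of T1 is T1 conjugated by the involution `ρ`.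
  · have h4 : letter n .gamma o = letter n .rho o * (letter n .gamma (o + 1) *
        letter n .rho o) := by
      rw [letter_g_r ho, hr]
    rw [h4]
    simp only [mul_assoc, letter_sq, mul_one]
  · exact letter_sq _ _
  · simpa only [mul_assoc] using letter_twist ho

end Relations

/-! ### Folding along a partially commuting list -/

theorem foldl_concat_of_forall_comm {α β : Type*} {f : β → α → β} {C : α → α → Prop}
    (hC : ∀ p q x, C p q → f (f x p) q = f (f x q) p) (p : α) (A : List α) (hA : ∀ q ∈ A, C p q)
    (x : β) : f (A.foldl f x) p = A.foldl f (f x p) := by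
  induction A generalizing x with
  | nil => rfl
  | cons q A ih =>
    simp only [List.foldl_cons]
    rw [ih (fun r hr => hA r (List.mem_cons_of_mem _ hr)), hC p q x (hA q List.mem_cons_self)]

/-- If `f` takes commuting letters in either order, then folding `f` along a list depends only on
the order of the letters that do not commute. -/
theorem foldl_eq_of_perm {α β : Type*} {f : β → α → β} {C R : α → α → Prop}
    (hC : ∀ p q x, C p q → f (f x p) q = f (f x q) p) (hs : ∀ p q, C p q → C q p)
    (hR : ∀ p q, R p q → ¬R q p) {L L' : List α} (hp : L.Perm L')
    (hL : L.Pairwise fun p q => C p q ∨ R p q) (hL' : L'.Pairwise fun p q => C p q ∨ R p q)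
    (x : β) : L.foldl f x = L'.foldl f x := by
  induction L generalizing L' x with
  | nil => rw [hp.nil_eq]
  | cons p L ih =>
    obtain ⟨A, B, rfl⟩ := List.append_of_mem (hp.subset List.mem_cons_self)
    have hp' : L.Perm (A ++ B) := (hp.trans List.perm_middle).cons_inv
    rw [List.pairwise_cons] at hL
    have hAB := List.pairwise_append.mp hL'
    -- The first letter `p` of `L` can be brought to the front of `L'`: a letter `q` before it in
    -- `L'` that does not commute with it would give both `R p q` and `R q p`.
    have hcomm : ∀ q ∈ A, C p q := by
      intro q hq
      rcases hL.1 q (hp'.symm.subset (List.mem_append_left _ hq)) with h | h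
      · exact h
      · rcases hAB.2.2 q hq p List.mem_cons_self with h' | h'
        · exact hs _ _ h'
        · exact absurd h' (hR _ _ h)
    have hAB' : (A ++ B).Pairwise fun p q => C p q ∨ R p q :=
      List.pairwise_append.mpr ⟨hAB.1, (List.pairwise_cons.mp hAB.2.1).2,
        fun a ha b hb => hAB.2.2 a ha b (List.mem_cons_of_mem _ hb)⟩
    rw [List.foldl_cons, ih hp' hL.2 hAB', List.foldl_append, List.foldl_append, List.foldl_cons,
      foldl_concat_of_forall_comm hC p A hcomm]

/-! ### Events -/

/-- A crossing of the strands `a` and `b`, or a bar on the strand `a = b`, at the height `y`. -/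
@[ext]
structure Ev (n : ℕ) where
  kind : Kind
  a : Fin n
  b : Fin n
  y : ℝ

namespace Ev

variable {n : ℕ}

/-- Two events without a common strand. -/
def Disj (e f : Ev n) : Prop := e.a ≠ f.a ∧ e.a ≠ f.b ∧ e.b ≠ f.a ∧ e.b ≠ f.b

theorem Disj.symm {e f : Ev n} (h : e.Disj f) : f.Disj e :=
  ⟨h.1.symm, h.2.2.1.symm, h.2.1.symm, h.2.2.2.symm⟩

/-- The letter of an event on strands whose positions are given by `σ`. -/
def letterAt (e : Ev n) (σ : Equiv.Perm (Fin n)) : TVT n :=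
  if e.kind = .gamma then letter n .gamma (σ e.a)
  -- Strands are named by their starting points, so either one may currently be on the left. The
  -- default `1` is never used along a reading; it only makes the commutation lemmas unconditional.
  else if (σ e.a : ℕ) + 1 = σ e.b ∨ (σ e.b : ℕ) + 1 = σ e.a then
    letter n e.kind (min (σ e.a : ℕ) (σ e.b)) else 1

/-- Record the letter of an event and exchange the positions of its strands. -/
def step (x : TVT n × Equiv.Perm (Fin n)) (e : Ev n) : TVT n × Equiv.Perm (Fin n) :=
  (x.1 * e.letterAt x.2, x.2 * Equiv.swap e.a e.b)

theorem letterAt_mul_swap {e f : Ev n} (h : e.Disj f) (σ : Equiv.Perm (Fin n)) :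
    f.letterAt (σ * Equiv.swap e.a e.b) = f.letterAt σ := by
  obtain ⟨h1, h2, h3, h4⟩ := h
  simp only [letterAt, Equiv.Perm.mul_apply, Equiv.swap_apply_of_ne_of_ne h1.symm h3.symm,
    Equiv.swap_apply_of_ne_of_ne h2.symm h4.symm]

/-- Two pairs of neighbouring positions without a common member are disjoint blocks, as
`letter_comm` requires; the default value `1` commutes with everything. -/
theorem letterAt_comm {e f : Ev n} (h : e.Disj f) (σ : Equiv.Perm (Fin n)) :
    e.letterAt σ * f.letterAt σ = f.letterAt σ * e.letterAt σ := by
  obtain ⟨h1, h2, h3, h4⟩ := h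
  have i1 : (σ e.a : ℕ) ≠ σ f.a := fun h => h1 (σ.injective (Fin.ext h))
  have i2 : (σ e.a : ℕ) ≠ σ f.b := fun h => h2 (σ.injective (Fin.ext h))
  have i3 : (σ e.b : ℕ) ≠ σ f.a := fun h => h3 (σ.injective (Fin.ext h))
  have i4 : (σ e.b : ℕ) ≠ σ f.b := fun h => h4 (σ.injective (Fin.ext h))
  have hw : ∀ κ : Kind, κ.width ≤ 2 := by intro κ; cases κ <;> simp [Kind.width]
  unfold letterAt
  have he := hw e.kind
  have hf := hw f.kind
  have hg : Kind.gamma.width = 1 := rfl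
  split_ifs
  all_goals first
    | simp only [mul_one, one_mul]
    | (refine letter_comm ?_; omega)

/-- The transposition of one event moves no strand of the other, so neither the letters nor the
final permutation depend on the order. -/
theorem step_comm {e f : Ev n} (h : e.Disj f) (x : TVT n × Equiv.Perm (Fin n)) :
    step (step x e) f = step (step x f) e := by
  obtain ⟨g, σ⟩ := x
  simp only [step, letterAt_mul_swap h, letterAt_mul_swap h.symm, mul_assoc, letterAt_comm h]
  congr 2
  refine Equiv.Perm.Disjoint.commute fun x => ?_
  obtain ⟨h1, h2, h3, h4⟩ := h
  by_cases hx : x = e.a ∨ x = e.b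
  · right
    rcases hx with rfl | rfl
    · exact Equiv.swap_apply_of_ne_of_ne h1 h2
    · exact Equiv.swap_apply_of_ne_of_ne h3 h4
  · left
    push Not at hx
    exact Equiv.swap_apply_of_ne_of_ne hx.1 hx.2

end Ev

end TwistedVirtualTwin

/-! ### Events of a diagram, readings, and the value of a diagram. -/

namespace TwistedVirtualTwin

open Filter Topology

namespace Diagram

variable {n : ℕ} (b : Diagram n)

/-- The point at height `y` of the strand `i`. -/
def pt (i : Fin n) (y : ℝ) : ℝ × ℝ := (b.pos i y, y)

@[simp] theorem pt_snd (i : Fin n) (y : ℝ) : (b.pt i y).2 = y := rfl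

@[simp] theorem pt_fst (i : Fin n) (y : ℝ) : (b.pt i y).1 = b.pos i y := rfl

theorem pt_mem_graphOf {i : Fin n} {y : ℝ} (hy : y ∈ Icc (0 : ℝ) 1) : b.pt i y ∈ graphOf (b.pos i) :=
  ⟨hy, rfl⟩

theorem eq_pt_of_mem {i : Fin n} {P : ℝ × ℝ} (h : P ∈ graphOf (b.pos i)) : P = b.pt i P.2 :=
  Prod.ext h.2 rfl

theorem pt_mem_crossingSet {i j : Fin n} (hij : i ≠ j) {y : ℝ} (hy : y ∈ Icc (0 : ℝ) 1)
    (h : b.pos i y = b.pos j y) : b.pt i y ∈ crossingSet b.pos :=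
  ⟨i, j, hij, b.pt_mem_graphOf hy, hy, h⟩

/-- The event `e` takes place in the diagram `b`. -/
def Valid (e : Ev n) : Prop :=
  e.y ∈ Icc (0 : ℝ) 1 ∧
    match e.kind with
    -- The condition `e.a < e.b` picks one of the two ways of naming the strands, so that each
    -- crossing is the place of exactly one event.
    | .s => e.a < e.b ∧ b.pos e.a e.y = b.pos e.b e.y ∧ b.pt e.a e.y ∈ b.real
    | .rho => e.a < e.b ∧ b.pos e.a e.y = b.pos e.b e.y ∧ b.pt e.a e.y ∉ b.real
    | .gamma => e.a = e.b ∧ b.pt e.a e.y ∈ b.bars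

variable {b}

theorem Valid.pos_eq {e : Ev n} (h : b.Valid e) : b.pos e.a e.y = b.pos e.b e.y := by
  obtain ⟨κ, x, z, y⟩ := e
  obtain ⟨-, h⟩ := h
  cases κ
  · exact h.2.1
  · exact h.2.1
  · exact congrArg (fun i => b.pos i y) h.1

theorem Valid.lt {e : Ev n} (h : b.Valid e) (hk : e.kind ≠ .gamma) : e.a < e.b := by
  obtain ⟨κ, x, z, y⟩ := e
  obtain ⟨-, h⟩ := h
  cases κ
  · exact h.1
  · exact h.1
  · exact absurd rfl hk

theorem Valid.bar {e : Ev n} (h : b.Valid e) (hk : e.kind = .gamma) :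
    e.a = e.b ∧ b.pt e.a e.y ∈ b.bars := by
  obtain ⟨κ, x, z, y⟩ := e
  obtain ⟨-, h⟩ := h
  subst hk
  exact h

theorem Valid.real_iff {e : Ev n} (h : b.Valid e) (hk : e.kind ≠ .gamma) :
    b.pt e.a e.y ∈ b.real ↔ e.kind = .s := by
  obtain ⟨κ, x, z, y⟩ := e
  obtain ⟨-, h⟩ := h
  cases κ
  · exact iff_of_true h.2.2 rfl
  · exact iff_of_false h.2.2 (by simp)
  · exact absurd rfl hk

theorem bar_not_cross {i j : Fin n} {y : ℝ} (hy : y ∈ Icc (0 : ℝ) 1) (h : b.pt i y ∈ b.bars)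
    (he : b.pos i y = b.pos j y) : i = j := by
  by_contra hij
  exact b.bars_crossing _ h (b.pt_mem_crossingSet hij hy he)

/-- The strands through the place of an event are the strands of the event. -/
theorem Valid.strand_mem {e : Ev n} (h : b.Valid e) {c : Fin n}
    (hc : b.pos c e.y = b.pos e.a e.y) : c = e.a ∨ c = e.b := by
  by_cases hk : e.kind = .gamma
  · left
    exact (bar_not_cross h.1 (h.bar hk).2 hc.symm).symm
  · rcases b.double _ h.1 c e.a e.b hc h.pos_eq with h1 | h1 | h1
    · exact Or.inl h1
    · exact absurd h1 (h.lt hk).ne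
    · exact Or.inr h1

/-- At each point there is at most one event. -/
theorem Valid.eq_of_pt {e f : Ev n} (he : b.Valid e) (hf : b.Valid f) (hy : e.y = f.y)
    (hx : b.pos e.a e.y = b.pos f.a f.y) : e = f := by
  have h1 := he.strand_mem (c := f.a) (by rw [hx, hy])
  have h2 := he.strand_mem (c := f.b) (by rw [hx, hy, hf.pos_eq])
  have h3 := hf.strand_mem (c := e.a) (by rw [← hx, hy])
  have h4 := hf.strand_mem (c := e.b) (by rw [← hx, ← hy, he.pos_eq])
  have hpt : b.pt e.a e.y = b.pt f.a f.y := Prod.ext hx hy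
  by_cases hk : e.kind = .gamma <;> by_cases hk' : f.kind = .gamma
  · have e1 := (he.bar hk).1
    have f1 := (hf.bar hk').1
    rcases h1 with h1 | h1 <;> exact Ev.ext (hk.trans hk'.symm) (by rw [h1]; try exact e1)
      (by rw [← f1, h1]; try exact e1.symm) hy
  · have e1 := (he.bar hk).1
    rw [← e1, or_self] at h1 h2
    exact absurd (h1.trans h2.symm) (hf.lt hk').ne
  · have f1 := (hf.bar hk').1
    rw [← f1, or_self] at h3 h4
    exact absurd (h3.trans h4.symm) (he.lt hk).ne
  · have hkk : e.kind = f.kind := by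
      have e1 := he.real_iff hk
      have f1 := hf.real_iff hk'
      rw [hpt] at e1
      have := e1.symm.trans f1
      cases h5 : e.kind <;> cases h6 : f.kind <;> simp_all
    have hl := he.lt hk
    have hl' := hf.lt hk'
    rcases h3 with h3 | h3
    · rcases h4 with h4 | h4
      · exact absurd (h3.trans h4.symm) hl.ne
      · exact Ev.ext hkk h3 h4 hy
    · rcases h4 with h4 | h4
      · rw [h3, h4] at hl
        exact absurd hl' hl.asymm
      · exact absurd (h3.trans h4.symm) hl.ne

/-- A common strand at a common height would put both events at the same point. -/
theorem Valid.eq_or_disj {e f : Ev n} (he : b.Valid e) (hf : b.Valid f) (hy : e.y = f.y) :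
    e = f ∨ e.Disj f := by
  by_contra hc
  rw [not_or] at hc
  have hx : b.pos e.a e.y ≠ b.pos f.a f.y := fun hx => hc.1 (he.eq_of_pt hf hy hx)
  refine hc.2 ⟨fun h => hx ?_, fun h => hx ?_, fun h => hx ?_, fun h => hx ?_⟩
  · rw [h, hy]
  · rw [h, hy, hf.pos_eq]
  · rw [he.pos_eq, h, hy]
  · rw [he.pos_eq, h, hy, hf.pos_eq]

/-- The event `e` is a crossing of the strands `i` and `j`. -/
def Crosses (e : Ev n) (i j : Fin n) : Prop :=
  e.kind ≠ .gamma ∧ ((e.a = i ∧ e.b = j) ∨ (e.a = j ∧ e.b = i))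

theorem Crosses.symm {e : Ev n} {i j : Fin n} (h : Crosses e i j) : Crosses e j i := ⟨h.1, h.2.symm⟩

theorem Crosses.not_disj {e f : Ev n} {i j c : Fin n} (h : Crosses f i j) (hi : i = c ∨ j = c)
    (hc : c = e.a ∨ c = e.b) : ¬f.Disj e := by
  rintro ⟨d1, d2, d3, d4⟩
  rcases h.2 with ⟨h1, h2⟩ | ⟨h1, h2⟩ <;> rcases hi with rfl | rfl <;> rcases hc with hc | hc
  · exact d1 (h1.trans hc)
  · exact d2 (h1.trans hc)
  · exact d3 (h2.trans hc)
  · exact d4 (h2.trans hc)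
  · exact d3 (h2.trans hc)
  · exact d4 (h2.trans hc)
  · exact d1 (h1.trans hc)
  · exact d2 (h1.trans hc)

theorem exists_crossing_event {i j : Fin n} (hij : i ≠ j) {y : ℝ} (hy : y ∈ Icc (0 : ℝ) 1)
    (h : b.pos i y = b.pos j y) : ∃ e, b.Valid e ∧ Crosses e i j ∧ e.y = y := by
  have key : ∀ i j : Fin n, i < j → b.pos i y = b.pos j y →
      ∃ e, b.Valid e ∧ Crosses e i j ∧ e.y = y := by
    intro i j hij h
    by_cases hr : b.pt i y ∈ b.real
    · exact ⟨⟨.s, i, j, y⟩, ⟨hy, hij, h, hr⟩, ⟨by simp, Or.inl ⟨rfl, rfl⟩⟩, rfl⟩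
    · exact ⟨⟨.rho, i, j, y⟩, ⟨hy, hij, h, hr⟩, ⟨by simp, Or.inl ⟨rfl, rfl⟩⟩, rfl⟩
  rcases hij.lt_or_gt with h1 | h1
  · exact key i j h1 h
  · obtain ⟨e, h2, h3, h4⟩ := key j i h1 h.symm
    exact ⟨e, h2, h3.symm, h4⟩

/-- Every point of `events b` is the place of an event. -/
theorem exists_valid_of_mem_events {P : ℝ × ℝ} (hP : P ∈ b.events) :
    ∃ e, b.Valid e ∧ b.pt e.a e.y = P := by
  rcases hP with ⟨i, j, hij, hi, hj⟩ | hP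
  · obtain ⟨e, he, hc, hy⟩ := exists_crossing_event (b := b) hij hi.1 (hi.2.symm.trans hj.2)
    refine ⟨e, he, Prod.ext ?_ hy⟩
    rcases hc.2 with h | h
    · simp only [pt_fst, hy, h.1, hi.2]
    · simp only [pt_fst, hy, h.1, hj.2]
  · obtain ⟨hy, i, hi⟩ := b.bars_strand P hP
    have := b.eq_pt_of_mem hi
    exact ⟨⟨.gamma, i, i, P.2⟩, ⟨⟨hy.1.le, hy.2.le⟩, rfl, this ▸ hP⟩, this.symm⟩

theorem Valid.mem_events {e : Ev n} (he : b.Valid e) : b.pt e.a e.y ∈ b.events := by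
  by_cases hk : e.kind = .gamma
  · exact Or.inr (he.bar hk).2
  · exact Or.inl (b.pt_mem_crossingSet (he.lt hk).ne he.1 he.pos_eq)

theorem Valid.mem_Ioo {e : Ev n} (he : b.Valid e) : e.y ∈ Ioo (0 : ℝ) 1 := by
  by_cases hk : e.kind = .gamma
  · exact (b.bars_strand _ (he.bar hk).2).1
  · exact b.mem_Ioo_of_pos_eq (he.lt hk).ne he.1 he.pos_eq

/-- A valid event is determined by its strands and its height, and its height is that of one of
finitely many crossings or bars. -/
theorem finite_valid (b : Diagram n) : {e | b.Valid e}.Finite := by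
  classical
  obtain ⟨F, hF⟩ := b.exists_crossing_heights
  set G : Set ℝ := ↑F ∪ Prod.snd '' b.bars with hG
  have hGf : G.Finite := F.finite_toSet.union (b.bars_finite.image _)
  have hfin : ((univ : Set (Fin n)) ×ˢ ((univ : Set (Fin n)) ×ˢ G)).Finite :=
    finite_univ.prod (finite_univ.prod hGf)
  refine Set.Finite.of_finite_image (f := fun e : Ev n => (e.a, e.b, e.y)) (hfin.subset ?_) ?_
  · rintro _ ⟨e, he, rfl⟩
    refine ⟨mem_univ _, mem_univ _, ?_⟩
    by_cases hk : e.kind = .gamma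
    · exact Or.inr ⟨_, (Valid.bar he hk).2, rfl⟩
    · exact Or.inl (hF _ _ (Valid.lt he hk).ne _ he.1 (Valid.pos_eq he))
  · intro e he f hf hef
    simp only [Prod.mk.injEq] at hef
    exact Valid.eq_of_pt he hf hef.2.2 (by rw [hef.1, hef.2.2])

/-- `L` lists the events of `b` so that any two events with a common strand are in the order of
their heights, from top to bottom. -/
structure IsReading (b : Diagram n) (L : List (Ev n)) : Prop where
  nodup : L.Nodup
  mem_iff : ∀ e, e ∈ L ↔ b.Valid e
  pairwise : L.Pairwise fun e f => e.Disj f ∨ f.y < e.y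

/-- Sorting by height works, because distinct events at equal height have no common strand. -/
theorem exists_isReading (b : Diagram n) : ∃ L, b.IsReading L := by
  classical
  set S := b.finite_valid.toFinset with hS
  set L := S.toList.insertionSort (fun e f : Ev n => f.y ≤ e.y) with hL
  have hp : L.Perm S.toList := List.perm_insertionSort _ _
  have hmem : ∀ e, e ∈ L ↔ b.Valid e := by
    intro e
    rw [hp.mem_iff, Finset.mem_toList, hS, Finite.mem_toFinset, mem_ofPred_eq]
  have hnd : L.Nodup := hp.nodup_iff.mpr S.nodup_toList
  have : Std.Total (fun e f : Ev n => f.y ≤ e.y) := ⟨fun e f => le_total _ _⟩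
  have : IsTrans (Ev n) (fun e f : Ev n => f.y ≤ e.y) := ⟨fun e f g h1 h2 => le_trans h2 h1⟩
  have hsort : L.Pairwise (fun e f : Ev n => f.y ≤ e.y) := List.pairwise_insertionSort _ _
  refine ⟨L, hnd, hmem, ?_⟩
  refine (hsort.and hnd).imp_of_mem fun {e f} he hf h => ?_
  rcases h.1.lt_or_eq with h1 | h1
  · exact Or.inr h1
  · refine Or.inl ((Valid.eq_or_disj ((hmem e).mp he) ((hmem f).mp hf) h1.symm).resolve_left h.2)

/-- Two readings are permutations of one list and agree on the order of all pairs that share a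
strand; the other pairs commute under `Ev.step`. -/
theorem IsReading.foldl_eq {L L' : List (Ev n)} (h : b.IsReading L) (h' : b.IsReading L')
    (x : TVT n × Equiv.Perm (Fin n)) : L.foldl Ev.step x = L'.foldl Ev.step x := by
  refine foldl_eq_of_perm (C := Ev.Disj) (R := fun e f => f.y < e.y)
    (fun p q x hpq => Ev.step_comm hpq x) (fun p q h => h.symm) (fun p q h => h.not_gt)
    ((List.perm_ext_iff_of_nodup h.nodup h'.nodup).mpr fun e => ?_) h.pairwise h'.pairwise x
  rw [h.mem_iff, h'.mem_iff]

/-- The element of the abstract group that a diagram reads. -/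
noncomputable def value (b : Diagram n) : TVT n :=
  (b.exists_isReading.choose.foldl Ev.step (1, 1)).1

theorem IsReading.value_eq {L : List (Ev n)} (h : b.IsReading L) :
    b.value = (L.foldl Ev.step (1, 1)).1 := by
  rw [value, b.exists_isReading.choose_spec.foldl_eq h]

/-- The number of strands to the left of the abscissa `x` at the height `y`. -/
noncomputable def index (b : Diagram n) (x y : ℝ) : ℕ := {c | b.pos c y < x}.ncard

/-- The letter that the event `e` shows in the diagram `b`. -/
noncomputable def shown (b : Diagram n) (e : Ev n) : TVT n :=
  letter n e.kind (b.index (b.pos e.a e.y) e.y)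

theorem ncard_perm_lt (σ : Equiv.Perm (Fin n)) (i : Fin n) : {c | σ c < σ i}.ncard = (σ i : ℕ) := by
  have : {c | σ c < σ i} = σ ⁻¹' (Iio (σ i)) := rfl
  rw [this, Set.ncard_preimage_of_injective_subset_range σ.injective (by simp)]
  rw [← Finset.coe_Iio, Set.ncard_coe_finset, Fin.card_Iio]

/-- Two strands that cross at some height without any other strand in between have neighbouring
positions just above. -/
theorem Valid.letterAt_eq {e : Ev n} (he : b.Valid e) {σ : Equiv.Perm (Fin n)}
    (hσ : ∀ c i, c ≠ e.a → c ≠ e.b → (i = e.a ∨ i = e.b) →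
      (σ c < σ i ↔ b.pos c e.y < b.pos i e.y)) :
    e.letterAt σ = b.shown e ∧
      (e.kind ≠ .gamma → (σ e.a : ℕ) + 1 = σ e.b ∨ (σ e.b : ℕ) + 1 = σ e.a) := by
  have hxb := he.pos_eq
  unfold Ev.letterAt shown index
  by_cases hk : e.kind = .gamma
  · have hab := (he.bar hk).1
    rw [if_pos hk, hk]
    refine ⟨?_, fun h => absurd rfl h⟩
    congr 1
    rw [← ncard_perm_lt σ e.a]
    congr 1
    ext c
    simp only [mem_ofPred_eq]
    by_cases hc : c = e.a
    · simp [hc]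
    · exact hσ c e.a hc (hab ▸ hc) (Or.inl rfl)
  · have hne := (he.lt hk).ne
    -- `S` consists of the strands strictly to the left of the crossing. Whichever strand of the
    -- crossing is on the left has position `S.ncard`, and the other one has position `S.ncard + 1`.
    set S := {c | b.pos c e.y < b.pos e.a e.y} with hS
    have haS : e.a ∉ S := by simp [hS]
    have hbS : e.b ∉ S := by simp [hS, hxb]
    have hA : ∀ c, c ≠ e.a → c ≠ e.b → ((σ c < σ e.a ↔ c ∈ S) ∧ (σ c < σ e.b ↔ c ∈ S)) := by
      intro c h1 h2
      refine ⟨hσ c _ h1 h2 (Or.inl rfl), ?_⟩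
      rw [hσ c _ h1 h2 (Or.inr rfl), hS, mem_ofPred_eq, hxb]
    rw [if_neg hk]
    rcases lt_trichotomy (σ e.a) (σ e.b) with h1 | h1 | h1
    · have c1 : (σ e.a : ℕ) = S.ncard := by
        rw [← ncard_perm_lt σ e.a]
        congr 1
        ext c
        rw [mem_ofPred_eq]
        by_cases ha : c = e.a
        · subst ha; simp [haS]
        by_cases hb : c = e.b
        · subst hb; simp [hbS, h1.le]
        · exact (hA c ha hb).1
      have c2 : (σ e.b : ℕ) = S.ncard + 1 := by
        rw [← ncard_perm_lt σ e.b, ← Set.ncard_insert_of_notMem haS]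
        congr 1
        ext c
        rw [mem_ofPred_eq, mem_insert_iff]
        by_cases ha : c = e.a
        · subst ha; simp [h1]
        by_cases hb : c = e.b
        · subst hb; simp [hbS, hne.symm]
        · simp [(hA c ha hb).2, ha]
      rw [if_pos (Or.inl (by omega)), c1, c2]
      refine ⟨?_, fun _ => Or.inl rfl⟩
      congr 1
      omega
    · exact absurd (σ.injective h1) hne
    · have c1 : (σ e.b : ℕ) = S.ncard := by
        rw [← ncard_perm_lt σ e.b]
        congr 1
        ext c
        rw [mem_ofPred_eq]
        by_cases hb : c = e.b
        · subst hb; simp [hbS]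
        by_cases ha : c = e.a
        · subst ha; simp [haS, h1.le]
        · exact (hA c ha hb).2
      have c2 : (σ e.a : ℕ) = S.ncard + 1 := by
        rw [← ncard_perm_lt σ e.a, ← Set.ncard_insert_of_notMem hbS]
        congr 1
        ext c
        rw [mem_ofPred_eq, mem_insert_iff]
        by_cases hb : c = e.b
        · subst hb; simp [h1]
        by_cases ha : c = e.a
        · subst ha; simp [haS, hne]
        · simp [(hA c ha hb).1, hb]
      rw [if_pos (Or.inr (by omega)), c1, c2]
      refine ⟨?_, fun _ => Or.inr rfl⟩
      congr 1
      omega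

/-- The invariant of the reading: after the prefix `L₁` the permutation orders `i` and `j` as the
diagram does at any height below their crossings in `L₁` and above those in `L₂`. This height has to
depend on the pair, since a reading need not be sorted by height. The invariant makes the
combinatorial letter of the next event equal to the geometric one. -/
theorem IsReading.foldl_prefix (L₁ : List (Ev n)) : ∀ L₂, b.IsReading (L₁ ++ L₂) →
    (L₁.foldl Ev.step (1, 1)).1 = (L₁.map b.shown).prod ∧
    ∀ i j, i ≠ j → ∀ y ∈ Icc (0 : ℝ) 1, b.pos i y ≠ b.pos j y →
      (∀ e ∈ L₁, Crosses e i j → y < e.y) → (∀ e ∈ L₂, Crosses e i j → e.y < y) →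
      ((L₁.foldl Ev.step (1, 1)).2 i < (L₁.foldl Ev.step (1, 1)).2 j ↔
        b.pos i y < b.pos j y) := by
  induction L₁ using List.reverseRecOn with
  | nil =>
    intro L₂ hL
    refine ⟨rfl, fun i j hij y hy hne _ h2 => ?_⟩
    -- Nothing is read yet, so all crossings of the pair are below `y` and the order at `y` is still
    -- that of the top.
    rw [b.pos_lt_iff_of_forall_ne hy.1 hy.2 le_rfl, b.top, b.top]
    · simp
    · intro z hz he
      obtain ⟨e, he1, he2, he3⟩ := exists_crossing_event (b := b) hij ⟨hy.1.trans hz.1, hz.2⟩ he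
      have := h2 e ((hL.mem_iff e).mpr he1) he2
      linarith [hz.1]
  | append_singleton L₁ e ih =>
    intro L₂ hL
    rw [List.append_assoc, List.singleton_append] at hL
    obtain ⟨ih1, ih2⟩ := ih _ hL
    have hpw := List.pairwise_append.mp hL.pairwise
    have he : b.Valid e := (hL.mem_iff e).mp (by simp)
    have habove : ∀ f ∈ L₁, ¬f.Disj e → e.y < f.y := fun f hf hd =>
      (hpw.2.2 f hf e List.mem_cons_self).resolve_left hd
    have hbelow : ∀ f ∈ L₂, ¬e.Disj f → f.y < e.y := fun f hf hd =>
      ((List.pairwise_cons.mp hpw.2.1).1 f hf).resolve_left hd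
    set x := L₁.foldl Ev.step (1, 1) with hx
    -- A crossing of `c` and `i` shares the strand `i` with `e`, hence is above `e` if it is in `L₁`
    -- and below if it is in `L₂`. So the induction hypothesis applies at the height of `e` itself.
    have hσ : ∀ c i, c ≠ e.a → c ≠ e.b → (i = e.a ∨ i = e.b) →
        (x.2 c < x.2 i ↔ b.pos c e.y < b.pos i e.y) := by
      intro c i h1 h2 hi
      have hpi : b.pos i e.y = b.pos e.a e.y := by
        rcases hi with rfl | rfl
        · rfl
        · exact he.pos_eq.symm
      refine ih2 c i ?_ e.y he.1 ?_ ?_ ?_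
      · rcases hi with rfl | rfl <;> assumption
      · intro hc
        rcases he.strand_mem (hc.trans hpi) with h | h
        · exact h1 h
        · exact h2 h
      · intro f hf hc
        exact habove f hf (hc.not_disj (Or.inr rfl) hi)
      · intro f hf hc
        rcases List.mem_cons.mp hf with rfl | hf
        · rcases hc.2 with ⟨k1, k2⟩ | ⟨k1, k2⟩
          · exact absurd k1.symm h1
          · exact absurd k2.symm h2
        · exact hbelow f hf fun hd => hc.not_disj (Or.inr rfl) hi hd.symm
    obtain ⟨hlet, hadj⟩ := he.letterAt_eq hσ
    simp only [List.foldl_append, List.foldl_cons, List.foldl_nil, List.map_append, List.map_cons,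
      List.map_nil, List.prod_append, List.prod_cons, List.prod_nil, mul_one]
    rw [← hx]
    refine ⟨by simp only [Ev.step, ih1, hlet], ?_⟩
    intro i j hij y hy hne h1 h2
    simp only [Ev.step]
    have h1' : ∀ f ∈ L₁, Crosses f i j → y < f.y := fun f hf => h1 f (by simp [hf])
    by_cases hc : Crosses e i j
    · have hye := h1 e (by simp) hc
      have hab := he.lt hc.1
      have heI := b.mem_Ioo_of_pos_eq hab.ne he.1 he.pos_eq
      -- A height `v` slightly above `e`, but under every event of `L₁` that is higher than `e`.
      -- Between `y` and `v` the two strands meet only at `e`, and the induction hypothesis holds at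
      -- `v`.
      have hev : ∀ᶠ v in 𝓝[>] e.y, ∀ f ∈ {f | f ∈ L₁}, e.y < f.y → v < f.y := by
        rw [eventually_all_finite L₁.finite_toSet]
        intro f _
        by_cases hf : e.y < f.y
        · filter_upwards [Ioo_mem_nhdsGT hf] with v hv _
          exact hv.2
        · exact Eventually.of_forall fun v h => absurd h hf
      obtain ⟨v, hv1, hv2⟩ := (hev.and (Ioo_mem_nhdsGT heI.2)).exists
      have hmain : x.2 e.b < x.2 e.a ↔ b.pos e.a y < b.pos e.b y := by
        have hd : ∀ f : Ev n, Crosses f e.a e.b → ¬f.Disj e ∧ ¬e.Disj f := by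
          intro f hf
          have := hf.not_disj (e := e) (Or.inl rfl) (Or.inl rfl)
          exact ⟨this, fun h => this h.symm⟩
        have hcij : ∀ f : Ev n, Crosses f e.a e.b → Crosses f i j := by
          intro f hf
          rcases hc.2 with ⟨rfl, rfl⟩ | ⟨rfl, rfl⟩
          · exact hf
          · exact hf.symm
        have hz : ∀ z ∈ Icc y v, b.pos e.a z = b.pos e.b z → z = e.y := by
          intro z hz hze
          obtain ⟨f, f1, f2, f3⟩ := exists_crossing_event (b := b) hab.ne
            ⟨hy.1.trans hz.1, hz.2.trans hv2.2.le⟩ hze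
          rcases List.mem_append.mp ((hL.mem_iff f).mpr f1) with hf | hf
          · have := hv1 f hf (habove f hf (hd f f2).1)
            linarith [hz.2]
          · rcases List.mem_cons.mp hf with rfl | hf
            · exact f3.symm
            · have := h2 f hf (hcij f f2)
              linarith [hz.1]
        rw [b.pos_lt_iff_of_cross hab.ne hy.1 hye hv2.1 hv2.2.le he.pos_eq hz]
        refine ih2 e.b e.a hab.ne' v ⟨by linarith [heI.1, hv2.1], hv2.2.le⟩ (fun hve => ?_) ?_ ?_
        · have := hz v ⟨by linarith [hv2.1], le_rfl⟩ hve.symm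
          linarith [hv2.1]
        · intro f hf hfc
          exact hv1 f hf (habove f hf (hd f hfc.symm).1)
        · intro f hf hfc
          rcases List.mem_cons.mp hf with rfl | hf
          · exact hv2.1
          · exact (hbelow f hf (hd f hfc.symm).2).trans hv2.1
      rcases hc.2 with ⟨rfl, rfl⟩ | ⟨rfl, rfl⟩
      · simpa using hmain
      · simp only [Equiv.Perm.mul_apply, Equiv.swap_apply_left, Equiv.swap_apply_right]
        have hn : x.2 e.b ≠ x.2 e.a := fun h => hab.ne' (x.2.injective h)
        rw [← not_iff_not, not_lt, not_lt, le_iff_lt_or_eq, le_iff_lt_or_eq, hmain]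
        simp [hn, hne.symm]
    · have hord := ih2 i j hij y hy hne h1' (fun f hf hfc => by
        rcases List.mem_cons.mp hf with rfl | hf
        · exact absurd hfc hc
        · exact h2 f hf hfc)
      rw [← hord]
      by_cases hk : e.kind = .gamma
      · simp [(he.bar hk).1]
      have hadj := hadj hk
      have hinj : ∀ c d : Fin n, c ≠ d → (x.2 c : ℕ) ≠ x.2 d := fun c d hcd h =>
        hcd (x.2.injective (Fin.ext h))
      have hsw : ∀ c, Equiv.swap e.a e.b c = if c = e.a then e.b else if c = e.b then e.a else c :=
        fun c => Equiv.swap_apply_def _ _ _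
      simp only [Equiv.Perm.mul_apply, hsw]
      have hcc : ¬((e.a = i ∧ e.b = j) ∨ (e.a = j ∧ e.b = i)) := fun h => hc ⟨hk, h⟩
      -- Exchanging two neighbouring positions does not alter how either compares with a third one.
      have key : ∀ p q : Fin n, (p : ℕ) + 1 = q ∨ (q : ℕ) + 1 = p → ∀ r : Fin n,
          (p : ℕ) ≠ r → (q : ℕ) ≠ r → ((p < r ↔ q < r) ∧ (r < p ↔ r < q)) := by
        intro p q hpq r h1 h2
        simp only [Fin.lt_def]
        omega
      by_cases i1 : i = e.a
      · subst i1
        have j1 : j ≠ e.b := fun h => hcc (Or.inl ⟨rfl, h.symm⟩)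
        rw [if_pos rfl, if_neg hij.symm, if_neg j1]
        exact (key _ _ hadj _ (hinj _ _ hij) (hinj _ _ j1.symm)).1.symm
      by_cases i2 : i = e.b
      · subst i2
        have j1 : j ≠ e.a := fun h => hcc (Or.inr ⟨h.symm, rfl⟩)
        rw [if_neg i1, if_pos rfl, if_neg j1, if_neg hij.symm]
        exact (key _ _ hadj _ (hinj _ _ j1.symm) (hinj _ _ hij)).1
      rw [if_neg i1, if_neg i2]
      by_cases j1 : j = e.a
      · subst j1
        rw [if_pos rfl]
        exact (key _ _ hadj _ (hinj _ _ hij.symm) (hinj _ _ (Ne.symm i2))).2.symm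
      by_cases j2 : j = e.b
      · subst j2
        rw [if_neg j1, if_pos rfl]
        exact (key _ _ hadj _ (hinj _ _ (Ne.symm i1)) (hinj _ _ hij.symm)).2
      rw [if_neg j1, if_neg j2]

/-- The value of a diagram is the product of the letters that it shows. -/
theorem IsReading.value_eq_prod {L : List (Ev n)} (h : b.IsReading L) :
    b.value = (L.map b.shown).prod := by
  rw [h.value_eq]
  exact (IsReading.foldl_prefix L [] (by rwa [List.append_nil])).1

end Diagram

end TwistedVirtualTwin

namespace TwistedVirtualTwin

open Filter Topology

namespace Diagram

variable {n : ℕ} {b b' : Diagram n}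

/-! ### Isotopic diagrams have the same value -/

theorem pt_mem_support {i : Fin n} {y : ℝ} (hy : y ∈ Icc (0 : ℝ) 1) : b.pt i y ∈ b.support :=
  mem_iUnion.mpr ⟨i, b.pt_mem_graphOf hy⟩

theorem strand_subset_support (i : Fin n) : b.strand i ⊆ b.support := subset_iUnion _ i

theorem real_subset_support : b.real ⊆ b.support := fun _ hP => by
  obtain ⟨i, _, _, hi, _⟩ := b.real_subset hP
  exact mem_iUnion.mpr ⟨i, hi⟩

theorem bars_subset_support : b.bars ⊆ b.support := fun _ hP => by
  obtain ⟨_, i, hi⟩ := b.bars_strand _ hP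
  exact mem_iUnion.mpr ⟨i, hi⟩

/-- Along an isotopy, the points of a strand keep the order of their heights. -/
theorem isotopy_height_lt {H : ℝ → ℝ × ℝ → ℝ × ℝ} {B : ℝ → Diagram n}
    (hc : ContinuousOn (fun z : ℝ × (ℝ × ℝ) => H z.1 z.2) (Icc (0 : ℝ) 1 ×ˢ b.support))
    (h0 : ∀ P ∈ b.support, H 0 P = P)
    (hH : ∀ t ∈ Icc (0 : ℝ) 1, InjOn (H t) b.support ∧ ∀ i, H t '' b.strand i = (B t).strand i)
    {i : Fin n} {P Q : ℝ × ℝ} (hP : P ∈ b.strand i) (hQ : Q ∈ b.strand i) (h : P.2 < Q.2)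
    {t : ℝ} (ht : t ∈ Icc (0 : ℝ) 1) : (H t P).2 < (H t Q).2 := by
  have hcont : ∀ R ∈ b.strand i, ContinuousOn (fun s => (H s R).2) (Icc 0 t) := by
    intro R hR
    have h1 : ContinuousOn (fun s : ℝ => (s, R)) (Icc 0 t) := by fun_prop
    exact continuous_snd.comp_continuousOn (hc.comp h1 fun s hs =>
      ⟨⟨hs.1, hs.2.trans ht.2⟩, strand_subset_support i hR⟩)
  have := lt_iff_lt_of_forall_ne (f := fun s => (H s P).2) (g := fun s => (H s Q).2) ht.1
    (hcont P hP) (hcont Q hQ) ?_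
  · refine this.mp ?_
    simpa only [h0 P (strand_subset_support i hP), h0 Q (strand_subset_support i hQ)] using h
  -- Points of one graph at the same height coincide, which contradicts injectivity at time `s`.
  · intro s hs he
    obtain ⟨h2, h3⟩ := hH s ⟨hs.1, hs.2.trans ht.2⟩
    have hP' : H s P ∈ (B s).strand i := h3 i ▸ mem_image_of_mem _ hP
    have hQ' : H s Q ∈ (B s).strand i := h3 i ▸ mem_image_of_mem _ hQ
    have : H s P = H s Q := by
      refine Prod.ext ?_ he
      rw [hP'.2, hQ'.2]
      exact congrArg _ he
    have := h2 (strand_subset_support i hP) (strand_subset_support i hQ) this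
    exact h.ne (congrArg Prod.snd this)

theorem mem_image_iff_of_injOn {α β : Type*} {f : α → β} {s t : Set α} (hf : InjOn f s) (ht : t ⊆ s) {x : α}
    (hx : x ∈ s) : f x ∈ f '' t ↔ x ∈ t :=
  ⟨fun ⟨_, hy, he⟩ => hf (ht hy) hx he ▸ hy, fun h => mem_image_of_mem f h⟩

/-- The end of the isotopy carries a reading of `b` to a reading of `b'`, because events that share
a strand keep the order of their heights along it. Since `Ev.step` ignores heights, the two folds
are literally the same. -/
theorem value_eq_of_isotopic (h : Isotopic b b') : b.value = b'.value := by
  obtain ⟨H, B, hc, h0, rfl, hH⟩ := h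
  obtain ⟨L, hL⟩ := b.exists_isReading
  obtain ⟨hinj, hs, hr, -, hb⟩ := hH 1 ⟨zero_le_one, le_rfl⟩
  set b' := B 1
  let T : Ev n → Ev n := fun e => { e with y := (H 1 (b.pt e.a e.y)).2 }
  have hTs : ∀ i y, y ∈ Icc (0 : ℝ) 1 → b'.pt i (H 1 (b.pt i y)).2 = H 1 (b.pt i y) := by
    intro i y hy
    have : H 1 (b.pt i y) ∈ b'.strand i := hs i ▸ mem_image_of_mem _ (b.pt_mem_graphOf hy)
    exact (b'.eq_pt_of_mem this).symm
  have hTy : ∀ i y, y ∈ Icc (0 : ℝ) 1 → (H 1 (b.pt i y)).2 ∈ Icc (0 : ℝ) 1 := by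
    intro i y hy
    have : H 1 (b.pt i y) ∈ b'.strand i := hs i ▸ mem_image_of_mem _ (b.pt_mem_graphOf hy)
    exact this.1
  have hpe : ∀ i j y, b.pos i y = b.pos j y → b.pt i y = b.pt j y := fun i j y h =>
    Prod.ext h rfl
  have hreal : ∀ i y, y ∈ Icc (0 : ℝ) 1 →
      (b'.pt i (H 1 (b.pt i y)).2 ∈ b'.real ↔ b.pt i y ∈ b.real) := by
    intro i y hy
    rw [hTs i y hy, ← hr, mem_image_iff_of_injOn hinj real_subset_support (pt_mem_support hy)]
  have hbar : ∀ i y, y ∈ Icc (0 : ℝ) 1 →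
      (b'.pt i (H 1 (b.pt i y)).2 ∈ b'.bars ↔ b.pt i y ∈ b.bars) := by
    intro i y hy
    rw [hTs i y hy, ← hb, mem_image_iff_of_injOn hinj bars_subset_support (pt_mem_support hy)]
  have hpos : ∀ i j y, y ∈ Icc (0 : ℝ) 1 →
      (b'.pos i (H 1 (b.pt i y)).2 = b'.pos j (H 1 (b.pt i y)).2 ↔ b.pos i y = b.pos j y) := by
    intro i j y hy
    constructor
    · intro h
      have h1 : H 1 (b.pt i y) ∈ b'.strand j := by
        refine ⟨hTy i y hy, ?_⟩
        rw [← h]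
        exact (congrArg Prod.fst (hTs i y hy)).symm
      rw [← hs, mem_image_iff_of_injOn hinj (strand_subset_support j) (pt_mem_support hy)] at h1
      exact h1.2
    · intro h
      have h1 := congrArg Prod.fst (hTs i y hy)
      have h2 := congrArg Prod.fst (hTs j y hy)
      rw [← hpe i j y h] at h2
      exact h1.trans h2.symm
  have hvalid : ∀ e, e.y ∈ Icc (0 : ℝ) 1 → (b'.Valid (T e) ↔ b.Valid e) := by
    intro e hy
    obtain ⟨κ, x, z, y⟩ := e
    cases κ <;> simp only [Valid, T, hpos _ _ _ hy, hreal _ _ hy, hbar _ _ hy, hTy _ _ hy, hy, true_and]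
  have hsurj : ∀ e', b'.Valid e' → ∃ e, e.y ∈ Icc (0 : ℝ) 1 ∧ T e = e' := by
    intro e' he'
    have : b'.pt e'.a e'.y ∈ b'.strand e'.a := b'.pt_mem_graphOf he'.1
    rw [← hs] at this
    obtain ⟨P, hP, hPe⟩ := this
    refine ⟨{ e' with y := P.2 }, hP.1, Ev.ext rfl rfl rfl ?_⟩
    simp only [T]
    rw [← b.eq_pt_of_mem hP, hPe]
    rfl
  have hread : b'.IsReading (L.map T) := by
    refine ⟨?_, ?_, ?_⟩
    · refine hL.nodup.map_on fun e he f hf hef => ?_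
      have he := (hL.mem_iff e).mp he
      have hf := (hL.mem_iff f).mp hf
      simp only [T, Ev.mk.injEq] at hef
      obtain ⟨h1, h2, h3, h4⟩ := hef
      have : b.pt e.a e.y = b.pt f.a f.y := by
        refine hinj (pt_mem_support he.1) (pt_mem_support hf.1) ?_
        rw [← hTs _ _ he.1, ← hTs _ _ hf.1, h4, h2]
      exact Ev.ext h1 h2 h3 (congrArg Prod.snd this)
    · intro e'
      rw [List.mem_map]
      constructor
      · rintro ⟨e, he, rfl⟩
        have he := (hL.mem_iff e).mp he
        exact (hvalid e he.1).mpr he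
      · intro he'
        obtain ⟨e, hy, rfl⟩ := hsurj e' he'
        exact ⟨e, (hL.mem_iff e).mpr ((hvalid e hy).mp he'), rfl⟩
    · rw [List.pairwise_map]
      refine hL.pairwise.imp_of_mem fun {e f} he hf h => ?_
      have he := (hL.mem_iff e).mp he
      have hf := (hL.mem_iff f).mp hf
      by_cases hd : e.Disj f
      · exact Or.inl hd
      have hlt := h.resolve_left hd
      right
      -- Events that are not disjoint both lie on one strand `i`, and heights can be compared along
      -- it.
      have hcommon : ∃ i, b.pt e.a e.y = b.pt i e.y ∧ b.pt f.a f.y = b.pt i f.y := by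
        by_contra hcon
        push Not at hcon
        refine hd ⟨fun h => ?_, fun h => ?_, fun h => ?_, fun h => ?_⟩
        · exact hcon e.a rfl (by rw [h])
        · exact hcon e.a rfl (by rw [h]; exact hpe _ _ _ hf.pos_eq)
        · exact hcon e.b (hpe _ _ _ he.pos_eq) (by rw [h])
        · exact hcon e.b (hpe _ _ _ he.pos_eq) (by rw [h]; exact hpe _ _ _ hf.pos_eq)
      obtain ⟨i, h1, h2⟩ := hcommon
      simp only [T]
      rw [h1, h2]
      exact isotopy_height_lt hc h0 (fun t ht => ⟨(hH t ht).1, (hH t ht).2.1⟩)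
        (b.pt_mem_graphOf hf.1) (b.pt_mem_graphOf he.1) hlt ⟨zero_le_one, le_rfl⟩
  rw [hL.value_eq, hread.value_eq, List.foldl_map]
  rfl

/-! ### The value of a stacked diagram -/

theorem stack_pos_upper (b b' : Diagram n) (i : Fin n) {y : ℝ} (hy : 0 ≤ y) :
    (b.stack b').pos i ((y + 1) / 2) = b.pos i y := by
  change glue _ _ _ = _
  rw [glue_of_ge _ _ (by linarith)]
  congr 1
  ring

theorem stack_pos_lower (b b' : Diagram n) (i : Fin n) {y : ℝ} (hy : y ≤ 1) :
    (b.stack b').pos i (y / 2) = b'.pos (b.perm i) y := by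
  change glue _ _ _ = _
  rw [glue_of_le (stack_match b b' i) (by linarith)]
  congr 1
  ring

theorem upper_mem_image {P : ℝ × ℝ} {s : Set (ℝ × ℝ)} : upper P ∈ upper '' s ↔ P ∈ s := by
  refine Function.Injective.mem_set_image fun P Q h => ?_
  simp only [upper, Prod.mk.injEq] at h
  exact Prod.ext h.1 (by linarith [h.2])

theorem lower_mem_image {P : ℝ × ℝ} {s : Set (ℝ × ℝ)} : lower P ∈ lower '' s ↔ P ∈ s := by
  refine Function.Injective.mem_set_image fun P Q h => ?_
  simp only [lower, Prod.mk.injEq] at h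
  exact Prod.ext h.1 (by linarith [h.2])

theorem crossingSet_height {P : ℝ × ℝ} (h : P ∈ crossingSet b.pos) : P.2 ∈ Ioo (0 : ℝ) 1 := by
  obtain ⟨i, j, hij, hi, hj⟩ := h
  exact b.mem_Ioo_of_pos_eq hij hi.1 (hi.2.symm.trans hj.2)

theorem upper_mem_stack_real {P : ℝ × ℝ} (h : 0 ≤ P.2) :
    upper P ∈ (b.stack b').real ↔ P ∈ b.real := by
  change upper P ∈ upper '' b.real ∪ lower '' b'.real ↔ _
  rw [mem_union, upper_mem_image, or_iff_left_iff_imp]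
  rintro ⟨Q, hQ, he⟩
  have := (crossingSet_height (b'.real_subset hQ)).2
  simp only [upper, lower, Prod.mk.injEq] at he
  linarith [he.2]

theorem upper_mem_stack_bars {P : ℝ × ℝ} (h : 0 ≤ P.2) :
    upper P ∈ (b.stack b').bars ↔ P ∈ b.bars := by
  change upper P ∈ upper '' b.bars ∪ lower '' b'.bars ↔ _
  rw [mem_union, upper_mem_image, or_iff_left_iff_imp]
  rintro ⟨Q, hQ, he⟩
  have := (b'.bars_strand _ hQ).1.2
  simp only [upper, lower, Prod.mk.injEq] at he
  linarith [he.2]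

theorem lower_mem_stack_real {P : ℝ × ℝ} (h : P.2 ≤ 1) :
    lower P ∈ (b.stack b').real ↔ P ∈ b'.real := by
  change lower P ∈ upper '' b.real ∪ lower '' b'.real ↔ _
  rw [mem_union, lower_mem_image, or_iff_right_iff_imp]
  rintro ⟨Q, hQ, he⟩
  have := (crossingSet_height (b.real_subset hQ)).1
  simp only [upper, lower, Prod.mk.injEq] at he
  linarith [he.2]

theorem lower_mem_stack_bars {P : ℝ × ℝ} (h : P.2 ≤ 1) :
    lower P ∈ (b.stack b').bars ↔ P ∈ b'.bars := by
  change lower P ∈ upper '' b.bars ∪ lower '' b'.bars ↔ _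
  rw [mem_union, lower_mem_image, or_iff_right_iff_imp]
  rintro ⟨Q, hQ, he⟩
  have := (b.bars_strand _ hQ).1.1
  simp only [upper, lower, Prod.mk.injEq] at he
  linarith [he.2]

theorem stack_index_upper (x : ℝ) {y : ℝ} (hy : 0 ≤ y) :
    (b.stack b').index x ((y + 1) / 2) = b.index x y := by
  simp only [index, stack_pos_upper b b' _ hy]

theorem stack_index_lower (x : ℝ) {y : ℝ} (hy : y ≤ 1) :
    (b.stack b').index x (y / 2) = b'.index x y := by
  simp only [index, stack_pos_lower b b' _ hy]
  exact Set.ncard_preimage_of_injective_subset_range (s := {c | b'.pos c y < x}) b.perm.injective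
    (by simp)

/-- An event of the upper diagram in a stack. -/
noncomputable def upperEv (e : Ev n) : Ev n := { e with y := (e.y + 1) / 2 }

/-- An event of the lower diagram in a stack. -/
noncomputable def lowerEv (σ : Equiv.Perm (Fin n)) (e : Ev n) : Ev n :=
  -- The stack names strands by their starting points at the very top; renaming by `σ.symm` may
  -- reverse the pair, and `min`, `max` restore the order that `Valid` asks for.
  ⟨e.kind, min (σ.symm e.a) (σ.symm e.b), max (σ.symm e.a) (σ.symm e.b), e.y / 2⟩

theorem valid_upperEv {e : Ev n} (hy : e.y ∈ Icc (0 : ℝ) 1) :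
    (b.stack b').Valid (upperEv e) ↔ b.Valid e := by
  obtain ⟨κ, x, z, y⟩ := e
  obtain ⟨h0, h1⟩ := hy
  simp only at h0 h1
  have hpt : ∀ i, (b.stack b').pt i ((y + 1) / 2) = upper (b.pt i y) := fun i =>
    Prod.ext (stack_pos_upper b b' i h0) rfl
  have hi : (0 ≤ (y + 1) / 2 ∧ (y + 1) / 2 ≤ 1) ↔ (0 ≤ y ∧ y ≤ 1) := by
    constructor <;> intro h <;> constructor <;> linarith [h.1, h.2]
  cases κ <;> simp only [Valid, upperEv, hpt, mem_Icc, hi, stack_pos_upper b b' _ h0,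
    upper_mem_stack_real (P := b.pt _ y) h0, upper_mem_stack_bars (P := b.pt _ y) h0]

theorem min_max_cases (i j : Fin n) :
    (min i j = i ∧ max i j = j) ∨ (min i j = j ∧ max i j = i) := by
  rcases le_total i j with h | h
  · exact Or.inl ⟨min_eq_left h, max_eq_right h⟩
  · exact Or.inr ⟨min_eq_right h, max_eq_left h⟩

theorem valid_lowerEv {e : Ev n} (he : b'.Valid e) : (b.stack b').Valid (lowerEv b.perm e) := by
  obtain ⟨κ, x, z, y⟩ := e
  have h1 := he.pos_eq
  have hy := he.1
  simp only at h1 hy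
  have hpt : ∀ i, (b.stack b').pt i (y / 2) = lower (b'.pt (b.perm i) y) := fun i =>
    Prod.ext (stack_pos_lower b b' i hy.2) rfl
  have hpe : b'.pt x y = b'.pt z y := Prod.ext h1 rfl
  refine ⟨⟨by simp only [lowerEv]; linarith [hy.1], by simp only [lowerEv]; linarith [hy.2]⟩, ?_⟩
  obtain ⟨-, he⟩ := he
  have hm : b'.pos (b.perm (min (b.perm.symm x) (b.perm.symm z))) y = b'.pos x y ∧
      b'.pos (b.perm (max (b.perm.symm x) (b.perm.symm z))) y = b'.pos x y := by
    rcases min_max_cases (b.perm.symm x) (b.perm.symm z) with ⟨h3, h4⟩ | ⟨h3, h4⟩ <;>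
      rw [h3, h4] <;> simp [h1]
  have hm' : b'.pt (b.perm (min (b.perm.symm x) (b.perm.symm z))) y = b'.pt x y := Prod.ext hm.1 rfl
  have hlt : x < z → min (b.perm.symm x) (b.perm.symm z) < max (b.perm.symm x) (b.perm.symm z) := by
    intro h
    rw [min_lt_max]
    exact fun h2 => h.ne (b.perm.symm.injective h2)
  cases κ
  · simp only [lowerEv, hpt, stack_pos_lower b b' _ hy.2, hm, hm',
      lower_mem_stack_real (P := b'.pt _ y) hy.2]
    exact ⟨hlt he.1, trivial, he.2.2⟩
  · simp only [lowerEv, hpt, stack_pos_lower b b' _ hy.2, hm, hm',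
      lower_mem_stack_real (P := b'.pt _ y) hy.2]
    exact ⟨hlt he.1, trivial, he.2.2⟩
  · simp only [lowerEv, hpt, hm', lower_mem_stack_bars (P := b'.pt _ y) hy.2]
    refine ⟨?_, he.2⟩
    have := he.1
    simp only at this
    simp [this]

theorem pos_lowerEv {e : Ev n} (he : b'.Valid e) :
    (b.stack b').pos (lowerEv b.perm e).a (lowerEv b.perm e).y = b'.pos e.a e.y := by
  simp only [lowerEv, stack_pos_lower b b' _ he.1.2]
  rcases min_max_cases (b.perm.symm e.a) (b.perm.symm e.b) with ⟨h3, h4⟩ | ⟨h3, h4⟩ <;>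
    rw [h3] <;> simp [he.pos_eq]

theorem exists_of_valid_stack {e : Ev n} (he : (b.stack b').Valid e) :
    (∃ f, b.Valid f ∧ upperEv f = e) ∨ ∃ f, b'.Valid f ∧ lowerEv b.perm f = e := by
  have hs := he.mem_events
  have hy := he.1
  by_cases hc : 1 / 2 ≤ e.y
  · left
    refine ⟨{ e with y := 2 * e.y - 1 }, ?_, ?_⟩
    · rw [← valid_upperEv (b' := b')]
      · convert he using 1
        exact Ev.ext rfl rfl rfl (by simp only [upperEv]; ring)
      · constructor <;> simp only <;> linarith [hy.2]
    · exact Ev.ext rfl rfl rfl (by simp only [upperEv]; ring)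
  · right
    push Not at hc
    have hy2 : 2 * e.y ≤ 1 := by linarith
    have hpos : ∀ i, (b.stack b').pos i e.y = b'.pos (b.perm i) (2 * e.y) := by
      intro i
      rw [← stack_pos_lower b b' i hy2]
      congr 1
      ring
    have hpt : (b.stack b').pt e.a e.y = lower (b'.pt (b.perm e.a) (2 * e.y)) :=
      Prod.ext (hpos _) (by simp [lower])
    have hmem : b'.pt (b.perm e.a) (2 * e.y) ∈ b'.events := by
      have hI : 2 * e.y ∈ Icc (0 : ℝ) 1 := ⟨by linarith [hy.1], hy2⟩
      rcases hs with h | h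
      · left
        by_cases hk : e.kind = .gamma
        · exact absurd h ((b.stack b').bars_crossing _ (he.bar hk).2)
        · refine b'.pt_mem_crossingSet (j := b.perm e.b) ?_ hI ?_
          · simpa using (he.lt hk).ne
          · rw [← hpos, ← hpos, he.pos_eq]
      · right
        rw [hpt] at h
        rwa [lower_mem_stack_bars (P := b'.pt _ _) hy2] at h
    obtain ⟨f, hf, hfp⟩ := exists_valid_of_mem_events hmem
    refine ⟨f, hf, Valid.eq_of_pt (valid_lowerEv hf) he ?_ ?_⟩
    · have := congrArg Prod.snd hfp
      simp only [pt_snd] at this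
      simp [lowerEv, this]
    · rw [pos_lowerEv hf, hpos]
      exact congrArg Prod.fst hfp

/-- A reading of the upper diagram followed by one of the lower diagram reads the stack. The letters
are compared in their geometric form, which does not depend on the names of the strands. -/
theorem value_stack (b b' : Diagram n) : (b.stack b').value = b.value * b'.value := by
  obtain ⟨L, hL⟩ := b.exists_isReading
  obtain ⟨L', hL'⟩ := b'.exists_isReading
  have hread : (b.stack b').IsReading (L.map upperEv ++ L'.map (lowerEv b.perm)) := by
    have hVu : ∀ e ∈ L, b.Valid e := fun e he => (hL.mem_iff e).mp he
    have hVl : ∀ e ∈ L', b'.Valid e := fun e he => (hL'.mem_iff e).mp he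
    refine ⟨?_, ?_, ?_⟩
    · refine List.nodup_append.mpr ⟨?_, ?_, ?_⟩
      · refine hL.nodup.map fun e f h => ?_
        simp only [upperEv, Ev.mk.injEq] at h
        exact Ev.ext h.1 h.2.1 h.2.2.1 (by linarith [h.2.2.2])
      · refine hL'.nodup.map_on fun e he f hf h => ?_
        have hp := pos_lowerEv (b := b) (hVl e he)
        rw [h, pos_lowerEv (hVl f hf)] at hp
        refine Valid.eq_of_pt (hVl e he) (hVl f hf) ?_ hp.symm
        have := congrArg Ev.y h
        simp only [lowerEv] at this
        linarith
      · intro e he f hf hef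
        obtain ⟨e, he', rfl⟩ := List.mem_map.mp he
        obtain ⟨f, hf', rfl⟩ := List.mem_map.mp hf
        have := congrArg Ev.y hef
        simp only [upperEv, lowerEv] at this
        linarith [(hVu e he').mem_Ioo.1, (hVl f hf').mem_Ioo.2]
    · intro e
      rw [List.mem_append, List.mem_map, List.mem_map]
      constructor
      · rintro (⟨f, hf, rfl⟩ | ⟨f, hf, rfl⟩)
        · exact (valid_upperEv (hVu f hf).1).mpr (hVu f hf)
        · exact valid_lowerEv (hVl f hf)
      · intro he
        rcases exists_of_valid_stack he with ⟨f, hf, rfl⟩ | ⟨f, hf, rfl⟩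
        · exact Or.inl ⟨f, (hL.mem_iff f).mpr hf, rfl⟩
        · exact Or.inr ⟨f, (hL'.mem_iff f).mpr hf, rfl⟩
    · refine List.pairwise_append.mpr ⟨?_, ?_, ?_⟩
      · rw [List.pairwise_map]
        refine hL.pairwise.imp fun {e f} h => h.imp (fun h => h) fun h => ?_
        simp only [upperEv]
        linarith
      · rw [List.pairwise_map]
        refine hL'.pairwise.imp fun {e f} h => h.imp (fun h => ?_) fun h => ?_
        · obtain ⟨h1, h2, h3, h4⟩ := h
          simp only [Ev.Disj, lowerEv]
          rcases min_max_cases (b.perm.symm e.a) (b.perm.symm e.b) with ⟨e1, e2⟩ | ⟨e1, e2⟩ <;>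
          rcases min_max_cases (b.perm.symm f.a) (b.perm.symm f.b) with ⟨f1, f2⟩ | ⟨f1, f2⟩ <;>
            rw [e1, e2, f1, f2] <;> simp [h1, h2, h3, h4]
        · simp only [lowerEv]
          linarith
      · intro e he f hf
        obtain ⟨e, he', rfl⟩ := List.mem_map.mp he
        obtain ⟨f, hf', rfl⟩ := List.mem_map.mp hf
        right
        simp only [upperEv, lowerEv]
        linarith [(hVu e he').mem_Ioo.1, (hVl f hf').mem_Ioo.2]
  rw [hread.value_eq_prod, hL.value_eq_prod, hL'.value_eq_prod, List.map_append, List.prod_append,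
    List.map_map, List.map_map]
  congr 2
  · refine List.map_congr_left fun e he => ?_
    have hv := (hL.mem_iff e).mp he
    simp only [Function.comp, shown, upperEv, stack_pos_upper b b' _ hv.1.1,
      stack_index_upper _ hv.1.1]
  · refine List.map_congr_left fun e he => ?_
    have hv := (hL'.mem_iff e).mp he
    have : (lowerEv b.perm e).y = e.y / 2 := rfl
    simp only [Function.comp, shown, pos_lowerEv hv]
    rw [this, stack_index_lower _ hv.1.2]
    rfl

end Diagram

end TwistedVirtualTwin

namespace TwistedVirtualTwin

open Filter Topology

namespace Diagram

variable {n : ℕ} {b b' : Diagram n}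

/-! ### Boxes -/

theorem exists_map_eq {α β : Type*} {f : α → β} {Q : α → Prop} {L : List β}
    (h : ∀ P ∈ L, ∃ e, Q e ∧ f e = P) : ∃ E : List α, E.map f = L ∧ ∀ e ∈ E, Q e := by
  induction L with
  | nil => exact ⟨[], rfl, by simp⟩
  | cons P L ih =>
    obtain ⟨E, rfl, hE⟩ := ih fun Q hQ => h Q (List.mem_cons_of_mem _ hQ)
    obtain ⟨e, he, rfl⟩ := h P List.mem_cons_self
    refine ⟨e :: E, rfl, fun f hf => ?_⟩
    rcases List.mem_cons.mp hf with rfl | hf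
    · exact he
    · exact hE f hf

theorem Valid.kind_eq {e : Ev n} (he : b.Valid e) {a : ℝ} {k : ℕ} {g : Gen k}
    (h : b.EventIs a (b.pt e.a e.y) g) : e.kind = g.kind ∧ b.leftCount a (b.pt e.a e.y) = g.idx := by
  have hcross : b.pt e.a e.y ∈ crossingSet b.pos → e.kind ≠ .gamma := fun h hk =>
    b.bars_crossing _ (he.bar hk).2 h
  cases g with
  | s i hi =>
    have hk := hcross (b.real_subset h.1)
    exact ⟨(he.real_iff hk).mp h.1, h.2⟩
  | rho i hi =>
    have hk := hcross h.1.1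
    refine ⟨?_, h.2⟩
    have h3 : e.kind ≠ .s := fun h2 => h.1.2 ((he.real_iff hk).mpr h2)
    cases h4 : e.kind <;> simp_all [Gen.kind]
  | gamma j hj =>
    refine ⟨?_, h.2⟩
    by_contra hk
    exact b.bars_crossing _ h.1 (b.pt_mem_crossingSet (he.lt hk).ne he.1 he.pos_eq)

theorem pos_lt_iff_of_box {a c p q : ℝ} (hp : 0 ≤ p) (hq : q ≤ 1) {i : Fin n}
    (h : (∀ y ∈ Icc p q, b.pos i y ∈ Ioo a c) ∨ (∀ y ∈ Icc p q, b.pos i y ∉ Icc a c)) (hac : a < c)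
    {y : ℝ} (hy : y ∈ Icc p q) : b.pos i y < a ↔ b.pos i q < a := by
  rcases h with h | h
  · exact iff_of_false (not_lt.mpr (h y hy).1.le) (not_lt.mpr (h q ⟨hy.1.trans hy.2, le_rfl⟩).1.le)
  · refine lt_iff_lt_of_forall_ne (g := fun _ => a) hy.2
      ((b.continuousOn_pos i).mono (Icc_subset_Icc (hp.trans hy.1) hq)) continuousOn_const
      fun z hz he => h z ⟨hy.1.trans hz.1, hz.2⟩ ?_
    exact ⟨he.ge, he.trans_le hac.le⟩

/-- The number of strands to the left of the box. -/
noncomputable def offset (b : Diagram n) (a q : ℝ) : ℕ := {i | b.pos i q < a}.ncard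

/-- No strand meets the left edge of the box, so the number of strands to the left of the box is
constant in height. It is the shift between positions in the box and positions in the diagram. -/
theorem index_eq_of_box {a c p q : ℝ} (hp : 0 ≤ p) (hq : q ≤ 1) (hac : a < c)
    (h : ∀ i, (∀ y ∈ Icc p q, b.pos i y ∈ Ioo a c) ∨ (∀ y ∈ Icc p q, b.pos i y ∉ Icc a c))
    {x y : ℝ} (hy : y ∈ Icc p q) (hx : a < x) :
    b.index x y = b.offset a q + b.leftCount a (x, y) := by
  unfold index offset leftCount
  rw [← Set.ncard_union_eq ?_ (toFinite _) (toFinite _)]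
  · congr 1
    ext i
    simp only [mem_union, mem_ofPred_eq, ← pos_lt_iff_of_box hp hq (h i) hac hy]
    have hne : b.pos i y ≠ a := by
      intro he
      rcases h i with h | h
      · exact (h y hy).1.ne' he
      · exact h y hy ⟨he.ge, he.trans_le hac.le⟩
    constructor
    · intro h1
      rcases hne.lt_or_gt with h2 | h2
      · exact Or.inl h2
      · exact Or.inr ⟨h2, h1⟩
    · rintro (h1 | h1)
      · exact h1.trans hx
      · exact h1.2
  · refine Set.disjoint_left.mpr fun i h1 h2 => ?_
    simp only [mem_ofPred_eq, ← pos_lt_iff_of_box hp hq (h i) hac hy] at h1 h2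
    exact h1.asymm h2.1

theorem offset_add_le {a c p q : ℝ} (hpq : p ≤ q) {k : ℕ}
    (hk : {i : Fin n | ∀ y ∈ Icc p q, b.pos i y ∈ Ioo a c}.ncard = k) :
    b.offset a q + k ≤ n := by
  rw [offset, ← hk, ← Set.ncard_union_eq ?_ (toFinite _) (toFinite _)]
  · exact (Set.ncard_le_card _).trans (by simp)
  · refine Set.disjoint_left.mpr fun i h1 h2 => ?_
    exact absurd h1 (not_lt.mpr (h2 q ⟨hpq, le_rfl⟩).1.le)

/-- The events in a box, from top to bottom. -/
theorem ShowsInBox.exists_events {a c p q : ℝ} (hp : 0 ≤ p) (hq : q ≤ 1) (hac : a < c) {k : ℕ}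
    {w : List (Gen k)} (h : b.ShowsInBox a c p q w) :
    ∃ E : List (Ev n), (∀ e, e ∈ E ↔ b.Valid e ∧ b.pt e.a e.y ∈ Icc a c ×ˢ Icc p q) ∧
      E.Pairwise (fun e f => f.y < e.y) ∧ (∀ e ∈ E, e.y ∈ Ioo p q) ∧
      E.map b.shown = w.map (shiftLetter n (b.offset a q)) := by
  obtain ⟨hs, -, L, hL1, hL2, hL3, hL4⟩ := h
  obtain ⟨E, rfl, hE⟩ := exists_map_eq (f := fun e : Ev n => b.pt e.a e.y) (Q := b.Valid)
    fun P hP => exists_valid_of_mem_events ((hL2 P).mp hP).1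
  rw [List.pairwise_map] at hL1
  have hmem : ∀ e, e ∈ E ↔ b.Valid e ∧ b.pt e.a e.y ∈ Icc a c ×ˢ Icc p q := by
    intro e
    constructor
    · intro he
      exact ⟨hE e he, ((hL2 _).mp (List.mem_map_of_mem he)).2⟩
    · rintro ⟨he, hbox⟩
      obtain ⟨f, hf, hfe⟩ := List.mem_map.mp ((hL2 _).mpr ⟨he.mem_events, hbox⟩)
      have : f = e := (hE f hf).eq_of_pt he (congrArg Prod.snd hfe) (congrArg Prod.fst hfe)
      exact this ▸ hf
  refine ⟨E, hmem, hL1, fun e he => hL3 _ (List.mem_map_of_mem he), ?_⟩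
  rw [List.forall₂_map_left_iff] at hL4
  have hbox : ∀ e ∈ E, b.pt e.a e.y ∈ Icc a c ×ˢ Icc p q := fun e he => ((hmem e).mp he).2
  clear hmem hL1 hL2 hL3
  induction hL4 with
  | nil => rfl
  | @cons e g E w h1 _ ih =>
    rw [List.map_cons, List.map_cons, ih (fun f hf => hE f (List.mem_cons_of_mem _ hf))
      fun f hf => hbox f (List.mem_cons_of_mem _ hf)]
    congr 1
    obtain ⟨h2, h3⟩ := (hE e List.mem_cons_self).kind_eq h1
    obtain ⟨h4, h5⟩ := hbox e List.mem_cons_self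
    have hx : a < b.pos e.a e.y := by
      rcases hs e.a with h | h
      · exact (h _ h5).1
      · exact absurd h4 (h _ h5)
    rw [shown, shiftLetter, index_eq_of_box hp hq hac hs (y := e.y) h5 hx, h2, ← h3]
    rfl

/-- The box contains all `n` strands, so its offset is `0` and its only event makes up a complete
reading. -/
theorem value_eq_of_depicts {g : Gen n} (h : b.Depicts g) : b.value = PresentedGroup.of g := by
  obtain ⟨a, c, hac, h⟩ := h
  obtain ⟨E, h1, h2, h3, h4⟩ := h.exists_events le_rfl le_rfl hac
  have hall : ∀ i, ∀ y ∈ Icc (0 : ℝ) 1, b.pos i y ∈ Ioo a c := by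
    have := h.2.1
    have huniv : {i : Fin n | ∀ y ∈ Icc (0 : ℝ) 1, b.pos i y ∈ Ioo a c} = univ := by
      refine Set.eq_of_subset_of_ncard_le (subset_univ _) ?_
      rw [this, Set.ncard_univ]
      simp
    intro i
    have hi : i ∈ {i : Fin n | ∀ y ∈ Icc (0 : ℝ) 1, b.pos i y ∈ Ioo a c} := huniv ▸ mem_univ i
    exact hi
  have hread : b.IsReading E := by
    refine ⟨h2.imp fun {e f} h he => ?_, fun e => ?_, h2.imp Or.inr⟩
    · subst he
      exact lt_irrefl _ h
    · rw [h1]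
      refine and_iff_left_of_imp fun he => ⟨?_, he.1⟩
      exact Ioo_subset_Icc_self (hall e.a e.y he.1)
  have ho : b.offset a 1 = 0 := by
    have := offset_add_le zero_le_one h.2.1
    omega
  rw [hread.value_eq_prod, h4, ho]
  simp [shiftLetter, letter_kind_idx]

/-! ### Diagrams related by a local move have the same value -/

theorem mem_diff_iff {s s' t : Set (ℝ × ℝ)} (h : s \ t = s' \ t) {P : ℝ × ℝ} (hP : P ∉ t) :
    P ∈ s ↔ P ∈ s' := by
  have := Set.ext_iff.mp h P
  simpa [hP] using this

/-- The same indices are read off outside a box, when two diagrams coincide there. -/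
theorem index_congr_of_box {a c p q : ℝ} (hp : 0 ≤ p) (hpq : p < q) (hq : q ≤ 1)
    (hs : ∀ i, (∀ y ∈ Icc p q, b.pos i y ∈ Ioo a c) ∨ (∀ y ∈ Icc p q, b.pos i y ∉ Icc a c))
    (hs' : ∀ i, (∀ y ∈ Icc p q, b'.pos i y ∈ Ioo a c) ∨ (∀ y ∈ Icc p q, b'.pos i y ∉ Icc a c))
    (hst : ∀ i y, y ∈ Icc (0 : ℝ) 1 → (b.pos i y, y) ∉ Ioo a c ×ˢ Ioo p q →
      b'.pos i y = b.pos i y) {x y : ℝ} (hy : y ∈ Icc (0 : ℝ) 1)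
    (hx : (x, y) ∉ Icc a c ×ˢ Icc p q) : b'.index x y = b.index x y := by
  unfold index
  congr 1
  ext i
  simp only [mem_ofPred_eq]
  by_cases hb : (b.pos i y, y) ∈ Ioo a c ×ˢ Ioo p q
  · have hyI : y ∈ Icc p q := Ioo_subset_Icc_self hb.2
    have hqI : q ∈ Icc p q := ⟨hpq.le, le_rfl⟩
    have hin : ∀ z ∈ Icc p q, b.pos i z ∈ Ioo a c :=
      (hs i).resolve_right fun h => h y hyI (Ioo_subset_Icc_self hb.1)
    have hqe : b'.pos i q = b.pos i q := hst i q ⟨by linarith, hq⟩ fun h => lt_irrefl _ h.2.2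
    have hin' : ∀ z ∈ Icc p q, b'.pos i z ∈ Ioo a c :=
      (hs' i).resolve_right fun h => h q hqI (hqe ▸ Ioo_subset_Icc_self (hin q hqI))
    have h1 := hin y hyI
    have h2 := hin' y hyI
    have hx' : x < a ∨ c < x := by
      by_contra hc
      push Not at hc
      exact hx ⟨hc, hyI⟩
    rcases hx' with hx' | hx'
    · exact iff_of_false (by linarith [h2.1]) (by linarith [h1.1])
    · exact iff_of_true (by linarith [h2.2]) (by linarith [h1.2])
  · rw [hst i y hy hb]

/-- The events in the box can be read consecutively, in the order: events outside the box at heights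
above it (`A`), events in it (`E`), events beside it (`S`), events below it (`C`). The parts `A`,
`S`, `C` and their letters are common to both diagrams, and the products over the box agree by
`prod_shiftLetter_eq`. -/
theorem value_eq_of_localMove (h : LocalMove b b') : b.value = b'.value := by
  obtain ⟨k, w, w', hw, a, c, p, q, hac, hp, hpq, hq, hb, hb', hst, hre, hba⟩ := h
  obtain ⟨E, hE1, hE2, hE3, hE4⟩ := hb.exists_events hp hq hac
  obtain ⟨E', hE1', hE2', hE3', hE4'⟩ := hb'.exists_events hp hq hac
  set box := Ioo a c ×ˢ Ioo p q with hbox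
  have hst1 : ∀ i y, y ∈ Icc (0 : ℝ) 1 → b.pt i y ∉ box → b'.pos i y = b.pos i y := by
    intro i y hy hP
    have := (mem_diff_iff (hst i) hP).mp (b.pt_mem_graphOf hy)
    exact this.2.symm
  have hst2 : ∀ i y, y ∈ Icc (0 : ℝ) 1 → b'.pt i y ∉ box → b.pos i y = b'.pos i y := by
    intro i y hy hP
    have := (mem_diff_iff (hst i) hP).mpr (b'.pt_mem_graphOf hy)
    exact this.2.symm
  have hqI : q ∈ Icc p q := ⟨hpq.le, le_rfl⟩
  have hoff : b'.offset a q = b.offset a q := by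
    unfold offset
    congr 1
    ext i
    simp only [mem_ofPred_eq]
    rw [hst1 i q ⟨by linarith, hq⟩ fun h => lt_irrefl _ h.2.2]
  -- an event outside the closed box occurs in both diagrams
  have htrans : ∀ b b' : Diagram n, (∀ i y, y ∈ Icc (0 : ℝ) 1 → b.pt i y ∉ box →
      b'.pos i y = b.pos i y) → b.real \ box = b'.real \ box → b.bars \ box = b'.bars \ box →
      ∀ e, b.Valid e → b.pt e.a e.y ∉ Icc a c ×ˢ Icc p q →
        b'.Valid e ∧ b'.pt e.a e.y ∉ Icc a c ×ˢ Icc p q := by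
    intro b b' hst hre hba e he hno
    have hnb : b.pt e.a e.y ∉ box := fun h =>
      hno ⟨Ioo_subset_Icc_self h.1, Ioo_subset_Icc_self h.2⟩
    have hpe : b.pt e.b e.y = b.pt e.a e.y := Prod.ext he.pos_eq.symm rfl
    have ha := hst e.a e.y he.1 hnb
    have hb := hst e.b e.y he.1 (hpe ▸ hnb)
    have hpt : b'.pt e.a e.y = b.pt e.a e.y := Prod.ext ha rfl
    refine ⟨?_, hpt ▸ hno⟩
    obtain ⟨κ, x, z, y⟩ := e
    simp only at ha hb hpt hnb
    obtain ⟨hy, he⟩ := he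
    refine ⟨hy, ?_⟩
    cases κ <;> simp only [ha, hb, hpt, ← mem_diff_iff hre hnb, ← mem_diff_iff hba hnb] <;> exact he
  obtain ⟨L, hL⟩ := b.exists_isReading
  classical
  let out : Ev n → Prop := fun e => b.pt e.a e.y ∉ Icc a c ×ˢ Icc p q
  set M := L.filter out with hM
  have hMmem : ∀ e, e ∈ M ↔ b.Valid e ∧ b.pt e.a e.y ∉ Icc a c ×ˢ Icc p q := by
    intro e
    rw [hM, List.mem_filter, decide_eq_true_eq, hL.mem_iff]
  have hMmem' : ∀ e, e ∈ M ↔ b'.Valid e ∧ b'.pt e.a e.y ∉ Icc a c ×ˢ Icc p q := by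
    intro e
    rw [hMmem]
    exact ⟨fun h => htrans b b' hst1 hre hba e h.1 h.2,
      fun h => htrans b' b hst2 hre.symm hba.symm e h.1 h.2⟩
  set A := M.filter fun e => q ≤ e.y with hA
  set S := M.filter fun e => p < e.y ∧ e.y < q with hS
  set C := M.filter fun e => e.y ≤ p with hC
  have hsub : ∀ P : Ev n → Bool, (M.filter P).Nodup ∧
      (M.filter P).Pairwise fun e f => e.Disj f ∨ f.y < e.y := fun P =>
    ⟨(hL.nodup.filter _).filter _, (hL.pairwise.filter _).filter _⟩
  have hread : ∀ b : Diagram n, (∀ i, (∀ y ∈ Icc p q, b.pos i y ∈ Ioo a c) ∨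
      (∀ y ∈ Icc p q, b.pos i y ∉ Icc a c)) →
      (∀ e, e ∈ M ↔ b.Valid e ∧ b.pt e.a e.y ∉ Icc a c ×ˢ Icc p q) → ∀ E : List (Ev n),
      (∀ e, e ∈ E ↔ b.Valid e ∧ b.pt e.a e.y ∈ Icc a c ×ˢ Icc p q) →
      E.Pairwise (fun e f => f.y < e.y) → (∀ e ∈ E, e.y ∈ Ioo p q) →
      b.IsReading (A ++ (E ++ (S ++ C))) := by
    intro b hs hMm E hE1 hE2 hE3
    have hAm : ∀ e ∈ A, e ∈ M ∧ q ≤ e.y := fun e he => by simpa [hA] using he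
    have hSm : ∀ e ∈ S, e ∈ M ∧ p < e.y ∧ e.y < q := fun e he => by simpa [hS] using he
    have hCm : ∀ e ∈ C, e ∈ M ∧ e.y ≤ p := fun e he => by simpa [hC] using he
    -- Between the heights `p` and `q` a strand is either always in the box or never, so no strand
    -- carries both an event in the box and one beside it.
    have hES : ∀ e ∈ E, ∀ f ∈ S, e.Disj f := by
      intro e he f hf
      obtain ⟨h1, h2⟩ := (hE1 e).mp he
      obtain ⟨h3, h4⟩ := (hMm f).mp (hSm f hf).1
      have hfy : f.y ∈ Icc p q := Ioo_subset_Icc_self (hSm f hf).2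
      have hin : ∀ i, b.pos i e.y = b.pos e.a e.y → b.pos i f.y = b.pos f.a f.y → False := by
        intro i hi hi'
        rcases hs i with h | h
        · exact h4 ⟨by rw [pt_fst, ← hi']; exact Ioo_subset_Icc_self (h _ hfy), hfy⟩
        · exact h e.y h2.2 (by rw [hi]; exact h2.1)
      refine ⟨fun h => ?_, fun h => ?_, fun h => ?_, fun h => ?_⟩
      · exact hin e.a rfl (by rw [h])
      · exact hin e.a rfl (by rw [h, h3.pos_eq])
      · exact hin e.b h1.pos_eq.symm (by rw [h])
      · exact hin e.b h1.pos_eq.symm (by rw [h, h3.pos_eq])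
    have hpw : (A ++ (E ++ (S ++ C))).Pairwise fun e f => e.Disj f ∨ f.y < e.y := by
      refine List.pairwise_append.mpr ⟨(hsub _).2, List.pairwise_append.mpr ⟨hE2.imp Or.inr,
        List.pairwise_append.mpr ⟨(hsub _).2, (hsub _).2, ?_⟩, ?_⟩, ?_⟩
      · intro e he f hf
        exact Or.inr ((hCm f hf).2.trans_lt (hSm e he).2.1)
      · intro e he f hf
        rcases List.mem_append.mp hf with hf | hf
        · exact Or.inl (hES e he f hf)
        · exact Or.inr ((hCm f hf).2.trans_lt (hE3 e he).1)
      · intro e he f hf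
        right
        have h1 := (hAm e he).2
        rcases List.mem_append.mp hf with hf | hf
        · exact (hE3 f hf).2.trans_le h1
        · rcases List.mem_append.mp hf with hf | hf
          · exact (hSm f hf).2.2.trans_le h1
          · exact (((hCm f hf).2).trans_lt hpq).trans_le h1
    refine ⟨?_, ?_, hpw⟩
    · refine hpw.imp fun {e f} h hef => ?_
      subst hef
      rcases h with h | h
      · exact h.1 rfl
      · exact lt_irrefl _ h
    · intro e
      simp only [List.mem_append, hE1, hA, hS, hC, List.mem_filter, hMm, decide_eq_true_eq]
      constructor
      · rintro (h | h | h | h)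
        · exact h.1.1
        · exact h.1
        · exact h.1.1
        · exact h.1.1
      · intro he
        by_cases hin : b.pt e.a e.y ∈ Icc a c ×ˢ Icc p q
        · exact Or.inr (Or.inl ⟨he, hin⟩)
        · rcases le_or_gt q e.y with h | h
          · exact Or.inl ⟨⟨he, hin⟩, h⟩
          · rcases le_or_gt e.y p with h2 | h2
            · exact Or.inr (Or.inr (Or.inr ⟨⟨he, hin⟩, h2⟩))
            · exact Or.inr (Or.inr (Or.inl ⟨⟨he, hin⟩, h2, h⟩))
  have hsh : ∀ e ∈ M, b.shown e = b'.shown e := by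
    intro e he
    obtain ⟨h1, h2⟩ := (hMmem e).mp he
    have hnb : b.pt e.a e.y ∉ box := fun h =>
      h2 ⟨Ioo_subset_Icc_self h.1, Ioo_subset_Icc_self h.2⟩
    unfold shown
    rw [hst1 e.a e.y h1.1 hnb,
      index_congr_of_box hp hpq hq hb.1 hb'.1 hst1 h1.1 h2]
  have hmap : ∀ P : Ev n → Bool, (M.filter P).map b.shown = (M.filter P).map b'.shown := fun P =>
    List.map_congr_left fun e he => hsh e (List.mem_of_mem_filter he)
  rw [(hread b hb.1 hMmem E hE1 hE2 hE3).value_eq_prod,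
    (hread b' hb'.1 hMmem' E' hE1' hE2' hE3').value_eq_prod]
  simp only [List.map_append, List.prod_append, hE4, hE4', hoff, hA, hS, hC, hmap]
  rw [prod_shiftLetter_eq hw (offset_add_le hpq.le hb.2.1)]

theorem value_eq_of_equiv (h : (Diagram.setoid n).r b b') : b.value = b'.value := by
  induction h with
  | rel x y h =>
    rcases h with h | h
    · exact value_eq_of_isotopic h
    · exact value_eq_of_localMove h
  | refl => rfl
  | symm _ _ _ ih => exact ih.symm
  | trans _ _ _ _ _ ih1 ih2 => exact ih1.trans ih2

end Diagram

/-- The element of the abstract group that a twisted virtual twin reads. -/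
noncomputable def Twin.value {n : ℕ} : Twin n → TVT n :=
  Quotient.lift Diagram.value fun _ _ h => Diagram.value_eq_of_equiv h

end TwistedVirtualTwin

namespace TwistedVirtualTwin

open Filter Topology

namespace Diagram

variable {n : ℕ} {b b' : Diagram n}

/-! ### Constructing diagrams -/

/-- The strands `pos'`, whose crossings at the height `y` are those of the strands of `b` at the
height `φ y`, reindexed by `e`. -/
structure IsTransport (b : Diagram n) (e : Equiv.Perm (Fin n)) (φ : ℝ → ℝ) (pos' : Fin n → ℝ → ℝ)
    (π : Equiv.Perm (Fin n)) : Prop where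
  piecewiseSmooth : ∀ i, PiecewiseSmooth (pos' i)
  top : ∀ i, pos' i 1 = ((i : ℕ) : ℝ) + 1
  bottom : ∀ i, pos' i 0 = ((π i : ℕ) : ℝ) + 1
  maps : ∀ y ∈ Icc (0 : ℝ) 1, φ y ∈ Icc (0 : ℝ) 1
  inj : Function.Injective φ
  eq_iff : ∀ y ∈ Icc (0 : ℝ) 1, ∀ i j,
    pos' i y = pos' j y ↔ b.pos (e i) (φ y) = b.pos (e j) (φ y)
  transverse : ∀ i j, i ≠ j → ∀ y ∈ Icc (0 : ℝ) 1, pos' i y = pos' j y →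
    CrossTransversally (pos' i) (pos' j) y
  bars_zero : ∀ i, b.pt i (φ 0) ∉ b.bars
  bars_one : ∀ i, b.pt i (φ 1) ∉ b.bars

/-- The diagram with the strands `pos'` and with the labels and bars of `b`. -/
def transport (b : Diagram n) (e : Equiv.Perm (Fin n)) (φ : ℝ → ℝ) (pos' : Fin n → ℝ → ℝ)
    (π : Equiv.Perm (Fin n)) (h : IsTransport b e φ pos' π) : Diagram n where
  pos := pos'
  perm := π
  piecewiseSmooth := h.piecewiseSmooth
  top := h.top
  bottom := h.bottom
  double y hy i j k hij hjk := by
    have := b.double (φ y) (h.maps y hy) (e i) (e j) (e k) ((h.eq_iff y hy i j).mp hij)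
      ((h.eq_iff y hy j k).mp hjk)
    simpa using this
  transverse := h.transverse
  real := {P | P ∈ crossingSet pos' ∧ ∃ i, P ∈ graphOf (pos' i) ∧ b.pt (e i) (φ P.2) ∈ b.real}
  real_subset := fun _ hP => hP.1
  bars := {P | ∃ i, P ∈ graphOf (pos' i) ∧ b.pt (e i) (φ P.2) ∈ b.bars}
  bars_finite := by
    have hfin : ((univ : Set (Fin n)) ×ˢ (φ ⁻¹' (Prod.snd '' b.bars))).Finite :=
      finite_univ.prod ((b.bars_finite.image _).preimage h.inj.injOn)
    refine (hfin.image fun z => (pos' z.1 z.2, z.2)).subset ?_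
    rintro P ⟨i, hi, hb⟩
    exact ⟨(i, P.2), ⟨mem_univ _, _, hb, rfl⟩, Prod.ext hi.2.symm rfl⟩
  bars_strand := by
    rintro P ⟨i, hi, hb⟩
    refine ⟨⟨lt_of_le_of_ne hi.1.1 ?_, lt_of_le_of_ne hi.1.2 ?_⟩, i, hi⟩
    · intro h0
      rw [← h0] at hb
      exact h.bars_zero _ hb
    · intro h0
      rw [h0] at hb
      exact h.bars_one _ hb
  bars_crossing := by
    rintro P ⟨i, hi, hb⟩ ⟨j, k, hjk, hj, hk⟩
    have h1 := (h.eq_iff _ hi.1 i j).mp (hi.2.symm.trans hj.2)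
    have h2 := (h.eq_iff _ hi.1 i k).mp (hi.2.symm.trans hk.2)
    have h3 := bar_not_cross (h.maps _ hi.1) hb h1
    have h4 := bar_not_cross (h.maps _ hi.1) hb h2
    exact hjk (e.injective (h3.symm.trans h4))

section Transport

variable {e : Equiv.Perm (Fin n)} {φ : ℝ → ℝ} {pos' : Fin n → ℝ → ℝ} {π : Equiv.Perm (Fin n)}

theorem transport_real_iff (h : IsTransport b e φ pos' π) {i : Fin n} {y : ℝ}
    (hy : y ∈ Icc (0 : ℝ) 1) :
    (b.transport e φ pos' π h).pt i y ∈ (b.transport e φ pos' π h).real ↔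
      b.pt (e i) (φ y) ∈ b.real := by
  constructor
  · rintro ⟨-, j, hj, hb⟩
    have := (h.eq_iff y hy i j).mp hj.2
    have he : b.pt (e i) (φ y) = b.pt (e j) (φ y) := Prod.ext this rfl
    exact he ▸ hb
  · intro hb
    refine ⟨?_, i, ⟨hy, rfl⟩, hb⟩
    obtain ⟨k, l, hkl, hk, hl⟩ := b.real_subset hb
    have key : ∀ k : Fin n, b.pt (e i) (φ y) ∈ graphOf (b.pos k) → e i ≠ k →
        (pos' i y, y) ∈ crossingSet pos' := by
      intro k hk hne
      refine ⟨i, e.symm k, fun h => hne (by simp [h]), ⟨hy, rfl⟩, hy, ?_⟩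
      rw [h.eq_iff y hy, e.apply_symm_apply]
      exact hk.2
    by_cases hne : e i = k
    · exact key l hl (hne ▸ hkl)
    · exact key k hk hne

theorem transport_bars_iff (h : IsTransport b e φ pos' π) {i : Fin n} {y : ℝ}
    (hy : y ∈ Icc (0 : ℝ) 1) :
    (b.transport e φ pos' π h).pt i y ∈ (b.transport e φ pos' π h).bars ↔
      b.pt (e i) (φ y) ∈ b.bars := by
  constructor
  · rintro ⟨j, hj, hb⟩
    have := (h.eq_iff y hy i j).mp hj.2
    have he : b.pt (e i) (φ y) = b.pt (e j) (φ y) := Prod.ext this rfl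
    exact he ▸ hb
  · intro hb
    exact ⟨i, ⟨hy, rfl⟩, hb⟩

end Transport

theorem pt_zero_notMem_bars (i : Fin n) : b.pt i 0 ∉ b.bars := fun h =>
  lt_irrefl _ (b.bars_strand _ h).1.1

theorem pt_one_notMem_bars (i : Fin n) : b.pt i 1 ∉ b.bars := fun h =>
  lt_irrefl _ (b.bars_strand _ h).1.2

/-! ### Isotopies -/

theorem isClosed_strand (i : Fin n) : IsClosed (b.strand i) := by
  have h : b.strand i = (fun y => (b.pos i y, y)) '' Icc (0 : ℝ) 1 := by
    ext P
    constructor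
    · intro hP
      exact ⟨P.2, hP.1, Prod.ext hP.2.symm rfl⟩
    · rintro ⟨y, hy, rfl⟩
      exact ⟨hy, rfl⟩
  rw [h]
  exact (isCompact_Icc.image_of_continuousOn
    ((b.continuousOn_pos i).prodMk continuousOn_id)).isClosed

/-- A continuous family of diagrams, with a continuous matching of their heights that preserves
crossings, labels and bars, is an isotopy. -/
theorem isotopic_of_family (Y : ℝ → ℝ → ℝ) (B : ℝ → Diagram n) (hB1 : B 1 = b')
    (hY0 : ∀ s ∈ Icc (0 : ℝ) 1, Y 0 s = s)
    (hB0 : ∀ i, ∀ s ∈ Icc (0 : ℝ) 1, (B 0).pos i s = b.pos i s)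
    (hYc : ContinuousOn (fun z : ℝ × ℝ => Y z.1 z.2) (Icc (0 : ℝ) 1 ×ˢ Icc (0 : ℝ) 1))
    (hXc : ∀ i, ContinuousOn (fun z : ℝ × ℝ => (B z.1).pos i (Y z.1 z.2))
      (Icc (0 : ℝ) 1 ×ˢ Icc (0 : ℝ) 1))
    (hYb : ∀ t ∈ Icc (0 : ℝ) 1, BijOn (Y t) (Icc 0 1) (Icc 0 1))
    (heq : ∀ t ∈ Icc (0 : ℝ) 1, ∀ s ∈ Icc (0 : ℝ) 1, ∀ i j,
      (B t).pos i (Y t s) = (B t).pos j (Y t s) ↔ b.pos i s = b.pos j s)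
    (hreal : ∀ t ∈ Icc (0 : ℝ) 1, ∀ s ∈ Icc (0 : ℝ) 1, ∀ i,
      (B t).pt i (Y t s) ∈ (B t).real ↔ b.pt i s ∈ b.real)
    (hbars : ∀ t ∈ Icc (0 : ℝ) 1, ∀ s ∈ Icc (0 : ℝ) 1, ∀ i,
      (B t).pt i (Y t s) ∈ (B t).bars ↔ b.pt i s ∈ b.bars) : Isotopic b b' := by
  classical
  -- A crossing lies on two strands, but by `heq` their images under the family coincide, so the
  -- choice of a strand is harmless. The value off the support plays no role.
  let H : ℝ → ℝ × ℝ → ℝ × ℝ := fun t P =>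
    if h : ∃ i, P ∈ b.strand i then (B t).pt h.choose (Y t P.2) else P
  have hH : ∀ t ∈ Icc (0 : ℝ) 1, ∀ i, ∀ s ∈ Icc (0 : ℝ) 1, H t (b.pt i s) = (B t).pt i (Y t s) := by
    intro t ht i s hs
    have h : ∃ j, b.pt i s ∈ b.strand j := ⟨i, b.pt_mem_graphOf hs⟩
    simp only [H, dif_pos h]
    refine Prod.ext ?_ rfl
    rw [pt_fst, pt_fst, pt_snd, heq t ht s hs]
    exact h.choose_spec.2.symm
  have himg : ∀ t ∈ Icc (0 : ℝ) 1, ∀ S S' : Set (ℝ × ℝ), S ⊆ b.support → S' ⊆ (B t).support →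
      (∀ i, ∀ s ∈ Icc (0 : ℝ) 1, (B t).pt i (Y t s) ∈ S' ↔ b.pt i s ∈ S) → H t '' S = S' := by
    intro t ht S S' hS hS' hiff
    ext P
    constructor
    · rintro ⟨Q, hQ, rfl⟩
      obtain ⟨i, hi⟩ := mem_iUnion.mp (hS hQ)
      rw [b.eq_pt_of_mem hi] at hQ ⊢
      rw [hH t ht i _ hi.1]
      exact (hiff i _ hi.1).mpr hQ
    · intro hP
      obtain ⟨i, hi⟩ := mem_iUnion.mp (hS' hP)
      obtain ⟨s, hs, hse⟩ := (hYb t ht).surjOn hi.1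
      have hPe : P = (B t).pt i (Y t s) := by rw [hse]; exact (B t).eq_pt_of_mem hi
      refine ⟨b.pt i s, (hiff i s hs).mp (hPe ▸ hP), ?_⟩
      rw [hH t ht i s hs, hPe]
  have hcs : ∀ b : Diagram n, crossingSet b.pos ⊆ b.support := by
    rintro b P ⟨i, j, -, hi, -⟩
    exact mem_iUnion.mpr ⟨i, hi⟩
  have hvirt : ∀ t ∈ Icc (0 : ℝ) 1, ∀ i, ∀ s ∈ Icc (0 : ℝ) 1,
      ((B t).pt i (Y t s) ∈ (B t).virtual ↔ b.pt i s ∈ b.virtual) := by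
    intro t ht i s hs
    have hYs := (hYb t ht).mapsTo hs
    refine and_congr ?_ (not_congr (hreal t ht s hs i))
    constructor
    · rintro ⟨j, k, hjk, hj, hk⟩
      exact ⟨j, k, hjk, ⟨hs, (heq t ht s hs i j).mp hj.2⟩, ⟨hs, (heq t ht s hs i k).mp hk.2⟩⟩
    · rintro ⟨j, k, hjk, hj, hk⟩
      exact ⟨j, k, hjk, ⟨hYs, (heq t ht s hs i j).mpr hj.2⟩, ⟨hYs, (heq t ht s hs i k).mpr hk.2⟩⟩
  refine ⟨H, B, ?_, ?_, hB1, fun t ht => ⟨?_, fun i => ?_, ?_, ?_, ?_⟩⟩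
  -- Continuity is checked on each strand separately; these are finitely many closed pieces.
  · have hU : Icc (0 : ℝ) 1 ×ˢ b.support = ⋃ i, Icc (0 : ℝ) 1 ×ˢ b.strand i := by
      rw [support, prod_iUnion]
    rw [hU]
    refine (locallyFinite_of_finite _).continuousOn_iUnion
      (fun i => isClosed_Icc.prod (isClosed_strand i)) fun i => ?_
    have hm : MapsTo (fun z : ℝ × (ℝ × ℝ) => (z.1, z.2.2)) (Icc (0 : ℝ) 1 ×ˢ b.strand i)
        (Icc (0 : ℝ) 1 ×ˢ Icc (0 : ℝ) 1) := fun z hz => ⟨hz.1, hz.2.1⟩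
    have hc : ContinuousOn (fun z : ℝ × (ℝ × ℝ) => (z.1, z.2.2))
        (Icc (0 : ℝ) 1 ×ˢ b.strand i) := by fun_prop
    refine (((hXc i).comp hc hm).prodMk (hYc.comp hc hm)).congr fun z hz => ?_
    have := hH z.1 hz.1 i z.2.2 hz.2.1
    rw [← b.eq_pt_of_mem hz.2] at this
    exact this
  · intro P hP
    obtain ⟨i, hi⟩ := mem_iUnion.mp hP
    rw [b.eq_pt_of_mem hi, hH 0 ⟨le_rfl, zero_le_one⟩ i _ hi.1, hY0 _ hi.1]
    exact Prod.ext (hB0 i _ hi.1) rfl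
  · intro P hP Q hQ he
    obtain ⟨i, hi⟩ := mem_iUnion.mp hP
    obtain ⟨j, hj⟩ := mem_iUnion.mp hQ
    rw [b.eq_pt_of_mem hi, b.eq_pt_of_mem hj, hH t ht i _ hi.1, hH t ht j _ hj.1] at he
    have h2 : P.2 = Q.2 := (hYb t ht).injOn hi.1 hj.1 (congrArg Prod.snd he)
    have h1 := congrArg Prod.fst he
    simp only [pt_fst] at h1
    rw [h2, heq t ht _ hj.1] at h1
    rw [b.eq_pt_of_mem hi, b.eq_pt_of_mem hj, h2]
    exact Prod.ext h1 rfl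
  · refine himg t ht _ _ (strand_subset_support i) (strand_subset_support i) fun j s hs => ?_
    constructor
    · intro h
      exact ⟨hs, (heq t ht s hs j i).mp h.2⟩
    · intro h
      exact ⟨(hYb t ht).mapsTo hs, (heq t ht s hs j i).mpr h.2⟩
  · exact himg t ht _ _ real_subset_support real_subset_support fun i s hs => hreal t ht s hs i
  · exact himg t ht _ _ (sdiff_subset.trans (hcs b)) (sdiff_subset.trans (hcs _)) (hvirt t ht)
  · exact himg t ht _ _ bars_subset_support bars_subset_support fun i s hs => hbars t ht s hs i

/-- At each height the strands are in the same order, and the same strands carry real crossings and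
bars. -/
structure SamePattern (b b' : Diagram n) : Prop where
  lt_iff : ∀ y ∈ Icc (0 : ℝ) 1, ∀ i j, b.pos i y < b.pos j y ↔ b'.pos i y < b'.pos j y
  real_iff : ∀ y ∈ Icc (0 : ℝ) 1, ∀ i, b.pt i y ∈ b.real ↔ b'.pt i y ∈ b'.real
  bars_iff : ∀ y ∈ Icc (0 : ℝ) 1, ∀ i, b.pt i y ∈ b.bars ↔ b'.pt i y ∈ b'.bars

theorem eq_iff_of_lt_iff {x y x' y' : ℝ} (h : x < y ↔ x' < y') (h' : y < x ↔ y' < x') :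
    x = y ↔ x' = y' := by
  rw [eq_iff_le_not_lt, eq_iff_le_not_lt, ← not_lt, ← not_lt, h, h']

theorem SamePattern.eq_iff (h : SamePattern b b') {y : ℝ} (hy : y ∈ Icc (0 : ℝ) 1) (i j : Fin n) :
    b.pos i y = b.pos j y ↔ b'.pos i y = b'.pos j y :=
  eq_iff_of_lt_iff (h.lt_iff y hy i j) (h.lt_iff y hy j i)

theorem perm_eq_of_lt_iff {σ τ : Equiv.Perm (Fin n)} (h : ∀ i j, σ i < σ j ↔ τ i < τ j) :
    σ = τ := by
  ext i
  rw [← ncard_perm_lt σ i, ← ncard_perm_lt τ i]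
  simp only [h]

theorem pos_zero_lt_iff (i j : Fin n) : b.pos i 0 < b.pos j 0 ↔ b.perm i < b.perm j := by
  rw [b.bottom, b.bottom]
  simp

theorem SamePattern.perm_eq (h : SamePattern b b') : b.perm = b'.perm := by
  refine perm_eq_of_lt_iff fun i j => ?_
  rw [← pos_zero_lt_iff, ← pos_zero_lt_iff, h.lt_iff 0 ⟨le_rfl, zero_le_one⟩]

theorem convex_lt_iff {x y x' y' t : ℝ} (h : x < y ↔ x' < y') (h' : y < x ↔ y' < x')
    (h0 : 0 ≤ t) (h1 : t ≤ 1) : (1 - t) * x + t * x' < (1 - t) * y + t * y' ↔ x < y := by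
  rcases h0.eq_or_lt with rfl | h0
  · simp
  rcases lt_trichotomy x y with h2 | h2 | h2
  · refine iff_of_true ?_ h2
    have := h.mp h2
    nlinarith
  · have := (eq_iff_of_lt_iff h h').mp h2
    simp [h2, this]
  · refine iff_of_false ?_ h2.asymm
    have := h'.mp h2
    nlinarith

theorem SamePattern.isTransport (h : SamePattern b b') {t : ℝ} (h0 : 0 ≤ t) (h1 : t ≤ 1) :
    IsTransport b 1 id (fun i y => (1 - t) * b.pos i y + t * b'.pos i y) b.perm where
  piecewiseSmooth i :=
    ((PiecewiseSmooth.of_contDiff contDiff_const).mul (b.piecewiseSmooth i)).add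
      ((PiecewiseSmooth.of_contDiff contDiff_const).mul (b'.piecewiseSmooth i))
  top i := by
    rw [b.top, b'.top]
    ring
  bottom i := by
    rw [b.bottom, b'.bottom, h.perm_eq]
    ring
  maps y hy := hy
  inj := Function.injective_id
  eq_iff y hy i j := eq_iff_of_lt_iff
    (convex_lt_iff (h.lt_iff y hy i j) (h.lt_iff y hy j i) h0 h1)
    (convex_lt_iff (h.lt_iff y hy j i) (h.lt_iff y hy i j) h0 h1)
  transverse i j hij y hy he := by
    have he' := (eq_iff_of_lt_iff (convex_lt_iff (h.lt_iff y hy i j) (h.lt_iff y hy j i) h0 h1)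
      (convex_lt_iff (h.lt_iff y hy j i) (h.lt_iff y hy i j) h0 h1)).mp he
    have he'' := (h.eq_iff hy i j).mp he'
    have hI := b.mem_Ioo_of_pos_eq hij hy he'
    refine (b.transverse i j hij y hy he').convex (b'.transverse i j hij y hy he'') he' he'' ?_ h0 h1
    -- Crossings have interior heights, so heights slightly above stay in `[0, 1]`, where the
    -- pattern compares the orders.
    filter_upwards [Ioo_mem_nhdsGT hI.2] with u hu
    exact h.lt_iff u ⟨hy.1.trans hu.1.le, hu.2.le⟩ i j
  bars_zero i := pt_zero_notMem_bars i
  bars_one i := pt_one_notMem_bars i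

/-- Diagrams with the same pattern are isotopic, by the straight line isotopy. -/
theorem SamePattern.isotopic (h : SamePattern b b') : Isotopic b b' := by
  classical
  -- An isotopy has to end at `b'` itself, so the family takes this very diagram as its value at `t
  -- = 1`.
  let B : ℝ → Diagram n := fun t =>
    if ht : 0 ≤ t ∧ t < 1 then b.transport 1 id _ _ (h.isTransport ht.1 ht.2.le) else b'
  have hpos : ∀ t ∈ Icc (0 : ℝ) 1, ∀ i y,
      (B t).pos i y = (1 - t) * b.pos i y + t * b'.pos i y := by
    intro t ht i y
    by_cases h1 : t < 1
    · simp only [B, dif_pos (show 0 ≤ t ∧ t < 1 from ⟨ht.1, h1⟩)]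
      rfl
    · obtain rfl : t = 1 := le_antisymm ht.2 (not_lt.mp h1)
      simp [B]
  refine isotopic_of_family (fun _ s => s) B (by simp [B]) (fun s _ => rfl) (fun i s _ => ?_)
    (by fun_prop) (fun i => ?_) (fun t _ => bijOn_id _) (fun t ht s hs i j => ?_)
    (fun t ht s hs i => ?_) (fun t ht s hs i => ?_)
  · rw [hpos 0 ⟨le_rfl, zero_le_one⟩]
    ring
  · have h2 : ContinuousOn (fun z : ℝ × ℝ => (1 - z.1) * b.pos i z.2 + z.1 * b'.pos i z.2)
        (Icc (0 : ℝ) 1 ×ˢ Icc (0 : ℝ) 1) := by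
      have hm : MapsTo Prod.snd (Icc (0 : ℝ) 1 ×ˢ Icc (0 : ℝ) 1) (Icc (0 : ℝ) 1) := fun z hz => hz.2
      have e1 := (b.continuousOn_pos i).comp (continuousOn_snd (α := ℝ)) hm
      have e2 := (b'.continuousOn_pos i).comp (continuousOn_snd (α := ℝ)) hm
      exact ((continuousOn_const.sub continuousOn_fst).mul e1).add (continuousOn_fst.mul e2)
    exact h2.congr fun z hz => hpos z.1 hz.1 i z.2
  · rw [hpos t ht, hpos t ht]
    exact eq_iff_of_lt_iff (convex_lt_iff (h.lt_iff s hs i j) (h.lt_iff s hs j i) ht.1 ht.2)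
      (convex_lt_iff (h.lt_iff s hs j i) (h.lt_iff s hs i j) ht.1 ht.2)
  · by_cases h1 : t < 1
    · simp only [B, dif_pos (show 0 ≤ t ∧ t < 1 from ⟨ht.1, h1⟩)]
      exact transport_real_iff _ hs
    · simp only [B, dif_neg (show ¬(0 ≤ t ∧ t < 1) from fun h => h1 h.2)]
      exact (h.real_iff s hs i).symm
  · by_cases h1 : t < 1
    · simp only [B, dif_pos (show 0 ≤ t ∧ t < 1 from ⟨ht.1, h1⟩)]
      exact transport_bars_iff _ hs
    · simp only [B, dif_neg (show ¬(0 ≤ t ∧ t < 1) from fun h => h1 h.2)]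
      exact (h.bars_iff s hs i).symm

/-! ### Changing the heights -/

/-- The piecewise linear map of `[0, 1]` onto itself that takes `t` to `v`. -/
noncomputable def bend (t v y : ℝ) : ℝ := v / t * min y t + (1 - v) / (1 - t) * max (y - t) 0

section Bend

variable {t v : ℝ}

theorem bend_of_le (_ : t ∈ Ioo (0 : ℝ) 1) {y : ℝ} (hy : y ≤ t) : bend t v y = v / t * y := by
  rw [bend, min_eq_left hy, max_eq_right (by linarith)]
  ring

theorem bend_of_ge (ht : t ∈ Ioo (0 : ℝ) 1) {y : ℝ} (hy : t ≤ y) :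
    bend t v y = v + (1 - v) / (1 - t) * (y - t) := by
  have := ht.1.ne'
  rw [bend, min_eq_right hy, max_eq_left (by linarith), div_mul_cancel₀ _ this]

theorem bend_zero (ht : t ∈ Ioo (0 : ℝ) 1) : bend t v 0 = 0 := by
  rw [bend_of_le ht ht.1.le, mul_zero]

theorem bend_one (ht : t ∈ Ioo (0 : ℝ) 1) : bend t v 1 = 1 := by
  have : 1 - t ≠ 0 := by linarith [ht.2]
  rw [bend_of_ge ht ht.2.le, div_mul_cancel₀ _ this]
  ring

theorem bend_strictMono (ht : t ∈ Ioo (0 : ℝ) 1) (hv : v ∈ Ioo (0 : ℝ) 1) :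
    StrictMono (bend t v) := by
  have h1 : 0 < v / t := div_pos hv.1 ht.1
  have h2 : 0 < (1 - v) / (1 - t) := div_pos (by linarith [hv.2]) (by linarith [ht.2])
  have hL : StrictMonoOn (bend t v) (Iic t) := fun x hx y hy hxy => by
    rw [bend_of_le ht hx, bend_of_le ht hy]
    exact mul_lt_mul_of_pos_left hxy h1
  have hR : StrictMonoOn (bend t v) (Ici t) := fun x hx y hy hxy => by
    rw [bend_of_ge ht hx, bend_of_ge ht hy]
    have := mul_lt_mul_of_pos_left (sub_lt_sub_right hxy t) h2
    linarith
  exact hL.Iic_union_Ici hR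

theorem bend_bend (ht : t ∈ Ioo (0 : ℝ) 1) (hv : v ∈ Ioo (0 : ℝ) 1) (y : ℝ) :
    bend t v (bend v t y) = y := by
  have h1 := ht.1.ne'
  have h2 := hv.1.ne'
  have h3 : 1 - t ≠ 0 := by linarith [ht.2]
  have h4 : 1 - v ≠ 0 := by linarith [hv.2]
  have hm : bend v t v = t := by
    rw [bend_of_le hv le_rfl]
    field_simp
  rcases le_total y v with h | h
  · have : bend v t y ≤ t := ((bend_strictMono hv ht).monotone h).trans_eq hm
    rw [bend_of_le ht this, bend_of_le hv h]
    field_simp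
  · have : t ≤ bend v t y := hm.symm.le.trans ((bend_strictMono hv ht).monotone h)
    rw [bend_of_ge ht this, bend_of_ge hv h]
    field_simp
    ring

theorem bend_self (ht : t ∈ Ioo (0 : ℝ) 1) (y : ℝ) : bend t t y = y := by
  have h1 := ht.1.ne'
  have h3 : 1 - t ≠ 0 := by linarith [ht.2]
  rcases le_total y t with h | h
  · rw [bend_of_le ht h, div_self h1, one_mul]
  · rw [bend_of_ge ht h, div_self h3]
    ring

theorem bend_mem (ht : t ∈ Ioo (0 : ℝ) 1) (hv : v ∈ Ioo (0 : ℝ) 1) {y : ℝ}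
    (hy : y ∈ Icc (0 : ℝ) 1) : bend t v y ∈ Icc (0 : ℝ) 1 := by
  have hm := (bend_strictMono ht hv).monotone
  have h0 := hm hy.1
  have h1 := hm hy.2
  rw [bend_zero ht] at h0
  rw [bend_one ht] at h1
  exact ⟨h0, h1⟩

theorem bend_continuous (t v : ℝ) : Continuous (bend t v) := by
  unfold bend
  fun_prop

theorem bend_piecewiseSmooth (ht : t ∈ Ioo (0 : ℝ) 1) : PiecewiseSmooth (bend t v) := by
  refine ⟨(bend_continuous t v).continuousOn, {t}, fun x y hx hxy hy hd => ?_⟩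
  have hd := hd t (by simp)
  by_cases h : y ≤ t
  · refine ContDiffOn.congr (f := fun y => v / t * y) (by fun_prop) fun z hz => ?_
    exact bend_of_le ht (hz.2.trans h)
  · have h2 : t ≤ x := by
      by_contra h2
      exact hd ⟨not_le.mp h2, not_le.mp h⟩
    refine ContDiffOn.congr (f := fun y => v + (1 - v) / (1 - t) * (y - t)) (by fun_prop)
      fun z hz => ?_
    exact bend_of_ge ht (h2.trans hz.1)

theorem bend_hasDerivWithinAt (ht : t ∈ Ioo (0 : ℝ) 1) (hv : v ∈ Ioo (0 : ℝ) 1) (y : ℝ) :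
    ∃ l r, 0 < l ∧ 0 < r ∧ HasDerivWithinAt (bend t v) l (Iic y) y ∧
      HasDerivWithinAt (bend t v) r (Ici y) y := by
  have h1 : 0 < v / t := div_pos hv.1 ht.1
  have h2 : 0 < (1 - v) / (1 - t) := div_pos (by linarith [hv.2]) (by linarith [ht.2])
  have hL : ∀ s, HasDerivWithinAt (fun y => v / t * y) (v / t) s y := fun s => by
    simpa using ((hasDerivAt_id y).const_mul (v / t)).hasDerivWithinAt
  have hR : ∀ s, HasDerivWithinAt (fun y => v + (1 - v) / (1 - t) * (y - t))
      ((1 - v) / (1 - t)) s y := fun s => by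
    simpa using ((((hasDerivAt_id y).sub_const t).const_mul
      ((1 - v) / (1 - t))).const_add v).hasDerivWithinAt
  rcases lt_trichotomy y t with h | h | h
  · have he : bend t v =ᶠ[𝓝 y] fun y => v / t * y := by
      filter_upwards [Iio_mem_nhds h] with u hu
      exact bend_of_le ht (le_of_lt hu)
    exact ⟨_, _, h1, h1,
      (hL _).congr_of_eventuallyEq (he.filter_mono nhdsWithin_le_nhds) he.eq_of_nhds,
      (hL _).congr_of_eventuallyEq (he.filter_mono nhdsWithin_le_nhds) he.eq_of_nhds⟩
  · subst h
    exact ⟨_, _, h1, h2, (hL _).congr (fun u hu => bend_of_le ht hu) (bend_of_le ht le_rfl),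
      (hR _).congr (fun u hu => bend_of_ge ht hu) (bend_of_ge ht le_rfl)⟩
  · have he : bend t v =ᶠ[𝓝 y] fun y => v + (1 - v) / (1 - t) * (y - t) := by
      filter_upwards [Ioi_mem_nhds h] with u hu
      exact bend_of_ge ht (le_of_lt hu)
    exact ⟨_, _, h2, h2,
      (hR _).congr_of_eventuallyEq (he.filter_mono nhdsWithin_le_nhds) he.eq_of_nhds,
      (hR _).congr_of_eventuallyEq (he.filter_mono nhdsWithin_le_nhds) he.eq_of_nhds⟩

theorem isTransport_bend (b : Diagram n) (ht : t ∈ Ioo (0 : ℝ) 1) (hv : v ∈ Ioo (0 : ℝ) 1) :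
    IsTransport b 1 (bend t v) (fun i y => b.pos i (bend t v y)) b.perm where
  piecewiseSmooth i := (b.piecewiseSmooth i).comp (bend_piecewiseSmooth ht) (bend_strictMono ht hv)
    fun y hy => bend_mem ht hv hy
  top i := by rw [bend_one ht, b.top]
  bottom i := by rw [bend_zero ht, b.bottom]
  maps y hy := bend_mem ht hv hy
  inj := (bend_strictMono ht hv).injective
  eq_iff y hy i j := Iff.rfl
  transverse i j hij y hy he := by
    obtain ⟨l, r, hl, hr, h1, h2⟩ := bend_hasDerivWithinAt ht hv y
    exact (b.transverse i j hij _ (bend_mem ht hv hy) he).comp (bend_strictMono ht hv).monotone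
      h1 h2 hl hr
  bars_zero i := by
    rw [bend_zero ht]
    exact pt_zero_notMem_bars i
  bars_one i := by
    rw [bend_one ht]
    exact pt_one_notMem_bars i

/-- The diagram `b` with the height `v` moved to the height `t`. -/
noncomputable def reparam (b : Diagram n) (ht : t ∈ Ioo (0 : ℝ) 1) (hv : v ∈ Ioo (0 : ℝ) 1) :
    Diagram n :=
  b.transport 1 (bend t v) _ b.perm (b.isTransport_bend ht hv)

theorem reparam_pos (ht : t ∈ Ioo (0 : ℝ) 1) (hv : v ∈ Ioo (0 : ℝ) 1) (i : Fin n) (y : ℝ) :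
    (b.reparam ht hv).pos i y = b.pos i (bend t v y) := rfl

theorem reparam_real_iff (ht : t ∈ Ioo (0 : ℝ) 1) (hv : v ∈ Ioo (0 : ℝ) 1) {i : Fin n} {y : ℝ}
    (hy : y ∈ Icc (0 : ℝ) 1) : (b.reparam ht hv).pt i y ∈ (b.reparam ht hv).real ↔
      b.pt i (bend t v y) ∈ b.real :=
  transport_real_iff _ hy

theorem reparam_bars_iff (ht : t ∈ Ioo (0 : ℝ) 1) (hv : v ∈ Ioo (0 : ℝ) 1) {i : Fin n} {y : ℝ}
    (hy : y ∈ Icc (0 : ℝ) 1) : (b.reparam ht hv).pt i y ∈ (b.reparam ht hv).bars ↔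
      b.pt i (bend t v y) ∈ b.bars :=
  transport_bars_iff _ hy

/-- At time `s` the height `v` has moved to `(1 - s) * v + s * t`. Points slide vertically along the
inverse bend, so their abscissae never change and coincidences are preserved. -/
theorem isotopic_reparam (b : Diagram n) (ht : t ∈ Ioo (0 : ℝ) 1) (hv : v ∈ Ioo (0 : ℝ) 1) :
    Isotopic b (b.reparam ht hv) := by
  classical
  have hτ : ∀ s ∈ Icc (0 : ℝ) 1, (1 - s) * v + s * t ∈ Ioo (0 : ℝ) 1 := fun s hs => by
    have := (convex_Ioo (0 : ℝ) 1) hv ht (sub_nonneg.mpr hs.2) hs.1 (by ring)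
    simpa using this
  let B : ℝ → Diagram n := fun s =>
    if hs : s ∈ Icc (0 : ℝ) 1 then b.reparam (hτ s hs) hv else b
  have hB : ∀ s (hs : s ∈ Icc (0 : ℝ) 1), B s = b.reparam (hτ s hs) hv := fun s hs => by
    simp only [B, dif_pos hs]
  have hX : ∀ s ∈ Icc (0 : ℝ) 1, ∀ y i,
      (B s).pos i (bend v ((1 - s) * v + s * t) y) = b.pos i y := fun s hs y i => by
    rw [hB s hs, reparam_pos, bend_bend (hτ s hs) hv]
  have hmem : ∀ s ∈ Icc (0 : ℝ) 1, ∀ y ∈ Icc (0 : ℝ) 1,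
      bend v ((1 - s) * v + s * t) y ∈ Icc (0 : ℝ) 1 := fun s hs y hy =>
    bend_mem hv (hτ s hs) hy
  refine isotopic_of_family (fun s y => bend v ((1 - s) * v + s * t) y) B ?_ (fun y _ => ?_)
    (fun i y _ => ?_) ?_ (fun i => ?_) (fun s hs => ⟨hmem s hs, ?_, ?_⟩)
    (fun s hs y hy i j => ?_) (fun s hs y hy i => ?_) (fun s hs y hy i => ?_)
  · rw [hB 1 ⟨zero_le_one, le_rfl⟩]
    congr 1
    ring
  · have : (1 - 0) * v + 0 * t = v := by ring
    rw [this, bend_self hv]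
  · have h0 : (0 : ℝ) ∈ Icc (0 : ℝ) 1 := ⟨le_rfl, zero_le_one⟩
    have := hX 0 h0 y i
    rwa [show (1 - 0) * v + 0 * t = v by ring, bend_self hv] at this
  · unfold bend
    fun_prop
  · refine ((b.continuousOn_pos i).comp (continuousOn_snd (α := ℝ))
      (fun z hz => hz.2)).congr fun z hz => hX z.1 hz.1 z.2 i
  · exact (bend_strictMono hv (hτ s hs)).injective.injOn
  · intro y hy
    exact ⟨bend ((1 - s) * v + s * t) v y, bend_mem (hτ s hs) hv hy, bend_bend hv (hτ s hs) y⟩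
  · rw [hX s hs, hX s hs]
  · rw [hB s hs, reparam_real_iff _ _ (hmem s hs y hy), bend_bend (hτ s hs) hv]
  · rw [hB s hs, reparam_bars_iff _ _ (hmem s hs y hy), bend_bend (hτ s hs) hv]

end Bend

end Diagram

end TwistedVirtualTwin

namespace TwistedVirtualTwin

open Filter Topology

namespace Diagram

variable {n : ℕ} {b b' : Diagram n}

/-! ### Stacking respects isotopy -/

/-- `H` is a planar isotopy of `b` through the diagrams `B t`. -/
structure IsIsotopy (b : Diagram n) (H : ℝ → ℝ × ℝ → ℝ × ℝ) (B : ℝ → Diagram n) : Prop where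
  cont : ContinuousOn (fun z : ℝ × (ℝ × ℝ) => H z.1 z.2) (Icc (0 : ℝ) 1 ×ˢ b.support)
  start : ∀ P ∈ b.support, H 0 P = P
  inj : ∀ t ∈ Icc (0 : ℝ) 1, InjOn (H t) b.support
  strand : ∀ t ∈ Icc (0 : ℝ) 1, ∀ i, H t '' b.strand i = (B t).strand i
  real : ∀ t ∈ Icc (0 : ℝ) 1, H t '' b.real = (B t).real
  virtual : ∀ t ∈ Icc (0 : ℝ) 1, H t '' b.virtual = (B t).virtual
  bars : ∀ t ∈ Icc (0 : ℝ) 1, H t '' b.bars = (B t).bars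

theorem isotopic_iff : Isotopic b b' ↔ ∃ H B, b.IsIsotopy H B ∧ B 1 = b' := by
  constructor
  · rintro ⟨H, B, h1, h2, h3, h4⟩
    exact ⟨H, B, ⟨h1, h2, fun t ht => (h4 t ht).1, fun t ht => (h4 t ht).2.1,
      fun t ht => (h4 t ht).2.2.1, fun t ht => (h4 t ht).2.2.2.1,
      fun t ht => (h4 t ht).2.2.2.2⟩, h3⟩
  · rintro ⟨H, B, h, h3⟩
    exact ⟨H, B, h.cont, h.start, h3, fun t ht =>
      ⟨h.inj t ht, h.strand t ht, h.real t ht, h.virtual t ht, h.bars t ht⟩⟩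

theorem strand_of_mem_support {P : ℝ × ℝ} (h : P ∈ b.support) : ∃ i, P ∈ b.strand i :=
  mem_iUnion.mp h

theorem support_mem_Icc {P : ℝ × ℝ} (h : P ∈ b.support) : P.2 ∈ Icc (0 : ℝ) 1 := by
  obtain ⟨i, hi⟩ := strand_of_mem_support h
  exact hi.1

theorem zero_mem_Icc : (0 : ℝ) ∈ Icc (0 : ℝ) 1 := ⟨le_rfl, zero_le_one⟩

theorem one_mem_Icc : (1 : ℝ) ∈ Icc (0 : ℝ) 1 := ⟨zero_le_one, le_rfl⟩

section IsIsotopy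

variable {H : ℝ → ℝ × ℝ → ℝ × ℝ} {B : ℝ → Diagram n} {t : ℝ}

theorem IsIsotopy.mem_strand (h : b.IsIsotopy H B) (ht : t ∈ Icc (0 : ℝ) 1) {i : Fin n} {P : ℝ × ℝ}
    (hP : P ∈ b.strand i) : H t P ∈ (B t).strand i := by
  rw [← h.strand t ht]
  exact mem_image_of_mem _ hP

theorem IsIsotopy.mem_support (h : b.IsIsotopy H B) (ht : t ∈ Icc (0 : ℝ) 1) {P : ℝ × ℝ}
    (hP : P ∈ b.support) : H t P ∈ (B t).support := by
  obtain ⟨i, hi⟩ := strand_of_mem_support hP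
  exact strand_subset_support i (h.mem_strand ht hi)

theorem IsIsotopy.height_lt (h : b.IsIsotopy H B) (ht : t ∈ Icc (0 : ℝ) 1) {i : Fin n}
    {P Q : ℝ × ℝ} (hP : P ∈ b.strand i) (hQ : Q ∈ b.strand i) (hPQ : P.2 < Q.2) :
    (H t P).2 < (H t Q).2 :=
  isotopy_height_lt h.cont h.start (fun s hs => ⟨h.inj s hs, h.strand s hs⟩) hP hQ hPQ ht

/-- Heights along a strand keep their order and the image is the whole strand, so its lowest point
is carried to the lowest point. -/
theorem IsIsotopy.height_eq_zero_iff (h : b.IsIsotopy H B) (ht : t ∈ Icc (0 : ℝ) 1) {P : ℝ × ℝ}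
    (hP : P ∈ b.support) : (H t P).2 = 0 ↔ P.2 = 0 := by
  obtain ⟨i, hi⟩ := strand_of_mem_support hP
  have h0 := b.pt_mem_graphOf (i := i) zero_mem_Icc
  constructor
  · intro he
    by_contra hne
    have := h.height_lt ht h0 hi (lt_of_le_of_ne hi.1.1 (Ne.symm hne))
    have h2 := (h.mem_strand ht h0).1.1
    linarith
  · intro he
    have h3 := (B t).pt_mem_graphOf (i := i) zero_mem_Icc
    obtain ⟨Q, hQ, hQe⟩ : (B t).pt i 0 ∈ H t '' b.strand i := (h.strand t ht i).symm ▸ h3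
    have hQ2 : Q.2 = 0 := by
      by_contra hne
      have := h.height_lt ht hi hQ (by rw [he]; exact lt_of_le_of_ne hQ.1.1 (Ne.symm hne))
      have h2 := (h.mem_strand ht hi).1.1
      rw [hQe] at this
      simp only [pt_snd] at this
      linarith
    have : P = Q := by rw [b.eq_pt_of_mem hi, b.eq_pt_of_mem hQ, he, hQ2]
    rw [this, hQe]
    rfl

theorem IsIsotopy.height_eq_one_iff (h : b.IsIsotopy H B) (ht : t ∈ Icc (0 : ℝ) 1) {P : ℝ × ℝ}
    (hP : P ∈ b.support) : (H t P).2 = 1 ↔ P.2 = 1 := by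
  obtain ⟨i, hi⟩ := strand_of_mem_support hP
  have h0 := b.pt_mem_graphOf (i := i) one_mem_Icc
  constructor
  · intro he
    by_contra hne
    have := h.height_lt ht hi h0 (lt_of_le_of_ne hi.1.2 hne)
    have h2 := (h.mem_strand ht h0).1.2
    linarith
  · intro he
    have h3 := (B t).pt_mem_graphOf (i := i) one_mem_Icc
    obtain ⟨Q, hQ, hQe⟩ : (B t).pt i 1 ∈ H t '' b.strand i := (h.strand t ht i).symm ▸ h3
    have hQ2 : Q.2 = 1 := by
      by_contra hne
      have := h.height_lt ht hQ hi (by rw [he]; exact lt_of_le_of_ne hQ.1.2 hne)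
      have h2 := (h.mem_strand ht hi).1.2
      rw [hQe] at this
      simp only [pt_snd] at this
      linarith
    have : P = Q := by rw [b.eq_pt_of_mem hi, b.eq_pt_of_mem hQ, he, hQ2]
    rw [this, hQe]
    rfl

theorem IsIsotopy.top_fixed (h : b.IsIsotopy H B) (ht : t ∈ Icc (0 : ℝ) 1) {P : ℝ × ℝ}
    (hP : P ∈ b.support) (h1 : P.2 = 1) : H t P = P := by
  obtain ⟨i, hi⟩ := strand_of_mem_support hP
  have h2 := (h.height_eq_one_iff ht hP).mpr h1
  rw [(B t).eq_pt_of_mem (h.mem_strand ht hi), h2]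
  conv_rhs => rw [b.eq_pt_of_mem hi, h1]
  exact Prod.ext (by rw [pt_fst, pt_fst, b.top, (B t).top]) rfl

/-- The abscissa of a bottom endpoint varies continuously in a finite set, so it is constant. -/
theorem IsIsotopy.perm_eq (h : b.IsIsotopy H B) (ht : t ∈ Icc (0 : ℝ) 1) : (B t).perm = b.perm := by
  have key : ∀ i, ∀ s ∈ Icc (0 : ℝ) 1, (H s (b.pt i 0)).1 = (((B s).perm i : ℕ) : ℝ) + 1 := by
    intro i s hs
    have h0 := b.pt_mem_graphOf (i := i) zero_mem_Icc
    have h2 := (h.height_eq_zero_iff hs (strand_subset_support i h0)).mpr rfl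
    rw [(B s).eq_pt_of_mem (h.mem_strand hs h0), h2, pt_fst, (B s).bottom]
  ext i
  have hsup : b.pt i 0 ∈ b.support := pt_mem_support zero_mem_Icc
  have hc : ContinuousOn (fun s => (H s (b.pt i 0)).1) (Icc 0 1) :=
    continuous_fst.comp_continuousOn (h.cont.comp (f := fun s : ℝ => (s, b.pt i 0)) (by fun_prop)
      fun s hs => ⟨hs, hsup⟩)
  have hfin : (range fun j : Fin n => ((j : ℕ) : ℝ) + 1).Finite := finite_range _
  have he := isPreconnected_Icc.constant_of_mapsTo (T := range fun j : Fin n => ((j : ℕ) : ℝ) + 1)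
    hfin.isDiscrete hc (fun s hs => ⟨(B s).perm i, (key i s hs).symm⟩) ht zero_mem_Icc
  simp only [key i t ht, h.start _ hsup, pt_fst, b.bottom] at he
  exact_mod_cast add_right_cancel he

theorem IsIsotopy.bottom_fixed (h : b.IsIsotopy H B) (ht : t ∈ Icc (0 : ℝ) 1) {P : ℝ × ℝ}
    (hP : P ∈ b.support) (h1 : P.2 = 0) : H t P = P := by
  obtain ⟨i, hi⟩ := strand_of_mem_support hP
  have h2 := (h.height_eq_zero_iff ht hP).mpr h1
  rw [(B t).eq_pt_of_mem (h.mem_strand ht hi), h2]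
  conv_rhs => rw [b.eq_pt_of_mem hi, h1]
  exact Prod.ext (by rw [pt_fst, pt_fst, b.bottom, (B t).bottom, h.perm_eq ht]) rfl

end IsIsotopy

theorem upper_injective : Function.Injective upper := fun P Q h => by
  simp only [upper, Prod.mk.injEq] at h
  exact Prod.ext h.1 (by linarith [h.2])

theorem lower_injective : Function.Injective lower := fun P Q h => by
  simp only [lower, Prod.mk.injEq] at h
  exact Prod.ext h.1 (by linarith [h.2])

theorem exists_upper {P : ℝ × ℝ} (h : P.2 ∈ Icc (1 / 2 : ℝ) 1) :
    ∃ Q : ℝ × ℝ, Q.2 ∈ Icc (0 : ℝ) 1 ∧ upper Q = P :=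
  ⟨(P.1, 2 * P.2 - 1), ⟨by simp only; linarith [h.1], by simp only; linarith [h.2]⟩,
    Prod.ext rfl (by simp only [upper]; ring)⟩

theorem exists_lower {P : ℝ × ℝ} (h : P.2 ∈ Icc (0 : ℝ) (1 / 2)) :
    ∃ Q : ℝ × ℝ, Q.2 ∈ Icc (0 : ℝ) 1 ∧ lower Q = P :=
  ⟨(P.1, 2 * P.2), ⟨by simp only; linarith [h.1], by simp only; linarith [h.2]⟩,
    Prod.ext rfl (by simp only [lower]; ring)⟩

theorem upper_mem_stack_strand {P : ℝ × ℝ} (h : 0 ≤ P.2) (i : Fin n) :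
    upper P ∈ (b.stack b').strand i ↔ P ∈ b.strand i :=
  ⟨of_upper_mem_graphOf h, upper_mem_graphOf⟩

theorem lower_mem_stack_strand {P : ℝ × ℝ} (h : P.2 ≤ 1) (i : Fin n) :
    lower P ∈ (b.stack b').strand i ↔ P ∈ b'.strand (b.perm i) :=
  ⟨of_lower_mem_graphOf h, lower_mem_graphOf⟩

theorem stack_strand (b b' : Diagram n) (i : Fin n) :
    (b.stack b').strand i = upper '' b.strand i ∪ lower '' b'.strand (b.perm i) := by
  ext P
  constructor
  · intro hP
    rcases le_total (1 / 2) P.2 with h | h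
    · obtain ⟨Q, hQ, rfl⟩ := exists_upper ⟨h, hP.1.2⟩
      exact Or.inl ⟨Q, (upper_mem_stack_strand hQ.1 i).mp hP, rfl⟩
    · obtain ⟨Q, hQ, rfl⟩ := exists_lower ⟨hP.1.1, h⟩
      exact Or.inr ⟨Q, (lower_mem_stack_strand hQ.2 i).mp hP, rfl⟩
  · rintro (⟨Q, hQ, rfl⟩ | ⟨Q, hQ, rfl⟩)
    · exact upper_mem_graphOf hQ
    · exact lower_mem_graphOf hQ

theorem stack_support (b b' : Diagram n) :
    (b.stack b').support = upper '' b.support ∪ lower '' b'.support := by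
  ext P
  simp only [support, mem_iUnion, stack_strand, mem_union, image_iUnion]
  constructor
  · rintro ⟨i, h | h⟩
    · exact Or.inl ⟨i, h⟩
    · exact Or.inr ⟨_, h⟩
  · rintro (⟨i, h⟩ | ⟨i, h⟩)
    · exact ⟨i, Or.inl h⟩
    · exact ⟨b.perm.symm i, Or.inr (by simpa using h)⟩

theorem stack_crossingSet (b b' : Diagram n) :
    crossingSet (b.stack b').pos = upper '' crossingSet b.pos ∪ lower '' crossingSet b'.pos := by
  ext P
  constructor
  · rintro ⟨i, j, hij, hi, hj⟩
    rcases le_total (1 / 2) P.2 with h | h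
    · obtain ⟨Q, hQ, rfl⟩ := exists_upper ⟨h, hi.1.2⟩
      exact Or.inl ⟨Q, ⟨i, j, hij, (upper_mem_stack_strand hQ.1 i).mp hi,
        (upper_mem_stack_strand hQ.1 j).mp hj⟩, rfl⟩
    · obtain ⟨Q, hQ, rfl⟩ := exists_lower ⟨hi.1.1, h⟩
      exact Or.inr ⟨Q, ⟨b.perm i, b.perm j, by simpa using hij,
        (lower_mem_stack_strand hQ.2 i).mp hi, (lower_mem_stack_strand hQ.2 j).mp hj⟩, rfl⟩
  · rintro (⟨Q, ⟨i, j, hij, hi, hj⟩, rfl⟩ | ⟨Q, ⟨i, j, hij, hi, hj⟩, rfl⟩)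
    · exact ⟨i, j, hij, upper_mem_graphOf hi, upper_mem_graphOf hj⟩
    · exact ⟨b.perm.symm i, b.perm.symm j, by simpa using hij,
        lower_mem_graphOf (by simpa using hi), lower_mem_graphOf (by simpa using hj)⟩

theorem stack_real (b b' : Diagram n) : (b.stack b').real = upper '' b.real ∪ lower '' b'.real := rfl

theorem stack_bars (b b' : Diagram n) : (b.stack b').bars = upper '' b.bars ∪ lower '' b'.bars := rfl

theorem upper_mem_stack_crossingSet {P : ℝ × ℝ} (h : 0 ≤ P.2) :
    upper P ∈ crossingSet (b.stack b').pos ↔ P ∈ crossingSet b.pos := by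
  rw [stack_crossingSet, mem_union, upper_mem_image, or_iff_left_iff_imp]
  rintro ⟨Q, hQ, he⟩
  have := (crossingSet_height hQ).2
  simp only [upper, lower, Prod.mk.injEq] at he
  linarith [he.2]

theorem lower_mem_stack_crossingSet {P : ℝ × ℝ} (h : P.2 ≤ 1) :
    lower P ∈ crossingSet (b.stack b').pos ↔ P ∈ crossingSet b'.pos := by
  rw [stack_crossingSet, mem_union, lower_mem_image, or_iff_right_iff_imp]
  rintro ⟨Q, hQ, he⟩
  have := (crossingSet_height hQ).1
  simp only [upper, lower, Prod.mk.injEq] at he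
  linarith [he.2]

theorem stack_virtual (b b' : Diagram n) :
    (b.stack b').virtual = upper '' b.virtual ∪ lower '' b'.virtual := by
  ext P
  constructor
  · rintro ⟨h1, h2⟩
    rw [stack_crossingSet] at h1
    rcases h1 with ⟨Q, hQ, rfl⟩ | ⟨Q, hQ, rfl⟩
    · refine Or.inl ⟨Q, ⟨hQ, fun h => h2 ?_⟩, rfl⟩
      exact (upper_mem_stack_real (crossingSet_height hQ).1.le).mpr h
    · refine Or.inr ⟨Q, ⟨hQ, fun h => h2 ?_⟩, rfl⟩
      exact (lower_mem_stack_real (crossingSet_height hQ).2.le).mpr h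
  · rintro (⟨Q, hQ, rfl⟩ | ⟨Q, hQ, rfl⟩)
    · have h0 := (crossingSet_height hQ.1).1.le
      exact ⟨(upper_mem_stack_crossingSet h0).mpr hQ.1, fun h => hQ.2 ((upper_mem_stack_real h0).mp h)⟩
    · have h0 := (crossingSet_height hQ.1).2.le
      exact ⟨(lower_mem_stack_crossingSet h0).mpr hQ.1, fun h => hQ.2 ((lower_mem_stack_real h0).mp h)⟩

theorem isClosed_support (b : Diagram n) : IsClosed b.support :=
  isClosed_iUnion_of_finite fun i => isClosed_strand i

/-- The two isotopies run simultaneously in the two halves. They fit together because endpoints of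
strands do not move at any time. -/
theorem Isotopic.stack {d d' : Diagram n} (h : Isotopic b b') (h' : Isotopic d d') :
    Isotopic (b.stack d) (b'.stack d') := by
  classical
  rw [isotopic_iff] at h h' ⊢
  obtain ⟨H₁, B₁, h₁, rfl⟩ := h
  obtain ⟨H₂, B₂, h₂, rfl⟩ := h'
  let H : ℝ → ℝ × ℝ → ℝ × ℝ := fun t P =>
    if 1 / 2 ≤ P.2 then upper (H₁ t (P.1, 2 * P.2 - 1)) else lower (H₂ t (P.1, 2 * P.2))
  have hup : ∀ t P, 0 ≤ P.2 → H t (upper P) = upper (H₁ t P) := by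
    intro t P hP
    simp only [H]
    rw [if_pos (by simp only [upper]; linarith)]
    congr 2
    exact Prod.ext rfl (by simp only [upper]; ring)
  have hlo : ∀ t ∈ Icc (0 : ℝ) 1, ∀ P ∈ d.support, H t (lower P) = lower (H₂ t P) := by
    intro t ht P hP
    rcases (support_mem_Icc hP).2.lt_or_eq with h1 | h1
    · simp only [H]
      rw [if_neg (by simp only [lower]; linarith)]
      congr 2
      exact Prod.ext rfl (by simp only [lower]; ring)
    -- On the seam `H` uses the upper isotopy; both isotopies fix the seam, so the formula for the
    -- lower half holds there too.
    · obtain ⟨j, hj⟩ := strand_of_mem_support hP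
      have he : lower P = upper (b.pt (b.perm.symm j) 0) := by
        rw [d.eq_pt_of_mem hj, h1]
        refine Prod.ext ?_ (by norm_num [lower, upper])
        simp [lower, upper, b.bottom, d.top]
      rw [h₂.top_fixed ht hP h1, he, hup t _ le_rfl,
        h₁.bottom_fixed ht (pt_mem_support zero_mem_Icc) rfl]
  have himg : ∀ t ∈ Icc (0 : ℝ) 1, ∀ S T : Set (ℝ × ℝ), S ⊆ b.support → T ⊆ d.support →
      H t '' (upper '' S ∪ lower '' T) = upper '' (H₁ t '' S) ∪ lower '' (H₂ t '' T) := by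
    intro t ht S T hS hT
    rw [image_union, image_image, image_image, image_image, image_image]
    congr 1
    · exact image_congr fun P hP => hup t P (support_mem_Icc (hS hP)).1
    · exact image_congr fun P hP => hlo t ht P (hT hP)
  have hcs : ∀ b : Diagram n, b.virtual ⊆ b.support := by
    rintro b P ⟨⟨i, j, -, hi, -⟩, -⟩
    exact mem_iUnion.mpr ⟨i, hi⟩
  refine ⟨H, fun t => (B₁ t).stack (B₂ t), ⟨?_, ?_, ?_, ?_, ?_, ?_, ?_⟩, rfl⟩
  · have hcl : IsClosed (Icc (0 : ℝ) 1 ×ˢ (b.stack d).support) :=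
      isClosed_Icc.prod (isClosed_support _)
    have hU : Icc (0 : ℝ) 1 ×ˢ (b.stack d).support =
        (Icc (0 : ℝ) 1 ×ˢ (b.stack d).support ∩ {z | 1 / 2 ≤ z.2.2}) ∪
          (Icc (0 : ℝ) 1 ×ˢ (b.stack d).support ∩ {z | z.2.2 ≤ 1 / 2}) := by
      rw [← inter_union_distrib_left, eq_comm, inter_eq_left]
      intro z _
      exact le_total (1 / 2) z.2.2
    rw [hU]
    refine ContinuousOn.union_of_isClosed ?_ ?_
      (hcl.inter (isClosed_le continuous_const (by fun_prop)))
      (hcl.inter (isClosed_le (by fun_prop) continuous_const))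
    · have hc : ContinuousOn (fun z : ℝ × (ℝ × ℝ) => upper (H₁ z.1 (z.2.1, 2 * z.2.2 - 1)))
          (Icc (0 : ℝ) 1 ×ˢ (b.stack d).support ∩ {z | 1 / 2 ≤ z.2.2}) := by
        have hu : Continuous upper := by unfold upper; fun_prop
        refine hu.comp_continuousOn (h₁.cont.comp
          (f := fun z : ℝ × (ℝ × ℝ) => (z.1, (z.2.1, 2 * z.2.2 - 1))) (by fun_prop) fun z hz => ?_)
        refine ⟨hz.1.1, ?_⟩
        obtain ⟨i, hi⟩ := strand_of_mem_support hz.1.2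
        refine strand_subset_support i ?_
        rw [← upper_mem_stack_strand (b' := d) (by have := hz.2; simp only [mem_ofPred_eq] at this ⊢; linarith)]
        convert hi using 1
        exact Prod.ext rfl (by simp only [upper]; ring)
      refine hc.congr fun z hz => ?_
      simp only [H]
      exact if_pos hz.2
    · have hc : ContinuousOn (fun z : ℝ × (ℝ × ℝ) => lower (H₂ z.1 (z.2.1, 2 * z.2.2)))
          (Icc (0 : ℝ) 1 ×ˢ (b.stack d).support ∩ {z | z.2.2 ≤ 1 / 2}) := by
        have hu : Continuous lower := by unfold lower; fun_prop
        refine hu.comp_continuousOn (h₂.cont.comp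
          (f := fun z : ℝ × (ℝ × ℝ) => (z.1, (z.2.1, 2 * z.2.2))) (by fun_prop) fun z hz => ?_)
        refine ⟨hz.1.1, ?_⟩
        obtain ⟨i, hi⟩ := strand_of_mem_support hz.1.2
        refine strand_subset_support (b.perm i) ?_
        rw [← lower_mem_stack_strand (b := b) (by have := hz.2; simp only [mem_ofPred_eq] at this ⊢; linarith)]
        convert hi using 1
        exact Prod.ext rfl (by simp only [lower]; ring)
      refine hc.congr fun z hz => ?_
      obtain ⟨Q, hQ, hQe⟩ := exists_lower ⟨(support_mem_Icc hz.1.2).1, hz.2⟩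
      have hQs : Q ∈ d.support := by
        obtain ⟨i, hi⟩ := strand_of_mem_support hz.1.2
        rw [← hQe, lower_mem_stack_strand hQ.2] at hi
        exact strand_subset_support _ hi
      have hQ' : (z.2.1, 2 * z.2.2) = Q := by
        rw [← hQe]
        exact Prod.ext rfl (by simp only [lower]; ring)
      simp only [hQ']
      rw [← hQe]
      exact hlo z.1 hz.1.1 Q hQs
  · intro P hP
    rw [stack_support] at hP
    rcases hP with ⟨Q, hQ, rfl⟩ | ⟨Q, hQ, rfl⟩
    · rw [hup 0 Q (support_mem_Icc hQ).1, h₁.start Q hQ]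
    · rw [hlo 0 zero_mem_Icc Q hQ, h₂.start Q hQ]
  · intro t ht P hP Q hQ he
    rw [stack_support] at hP hQ
    -- Images from different halves can only coincide on the seam, where both isotopies are the
    -- identity.
    have mixed : ∀ P ∈ b.support, ∀ Q ∈ d.support, upper (H₁ t P) = lower (H₂ t Q) →
        upper P = lower Q := by
      intro P hP Q hQ he
      have h1 := (support_mem_Icc (h₁.mem_support ht hP)).1
      have h2 := (support_mem_Icc (h₂.mem_support ht hQ)).2
      have h3 := congrArg Prod.snd he
      simp only [upper, lower] at h3
      have hP0 := (h₁.height_eq_zero_iff ht hP).mp (by linarith)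
      have hQ1 := (h₂.height_eq_one_iff ht hQ).mp (by linarith)
      rwa [h₁.bottom_fixed ht hP hP0, h₂.top_fixed ht hQ hQ1] at he
    rcases hP with ⟨P, hP, rfl⟩ | ⟨P, hP, rfl⟩ <;> rcases hQ with ⟨Q, hQ, rfl⟩ | ⟨Q, hQ, rfl⟩
    · rw [hup t P (support_mem_Icc hP).1, hup t Q (support_mem_Icc hQ).1] at he
      rw [h₁.inj t ht hP hQ (upper_injective he)]
    · rw [hup t P (support_mem_Icc hP).1, hlo t ht Q hQ] at he
      exact mixed P hP Q hQ he
    · rw [hlo t ht P hP, hup t Q (support_mem_Icc hQ).1] at he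
      exact (mixed Q hQ P hP he.symm).symm
    · rw [hlo t ht P hP, hlo t ht Q hQ] at he
      rw [h₂.inj t ht hP hQ (lower_injective he)]
  · intro t ht i
    rw [stack_strand, stack_strand, himg t ht _ _ (strand_subset_support _)
      (strand_subset_support _), h₁.strand t ht, h₂.strand t ht, h₁.perm_eq ht]
  · intro t ht
    rw [stack_real, stack_real, himg t ht _ _ real_subset_support real_subset_support,
      h₁.real t ht, h₂.real t ht]
  · intro t ht
    rw [stack_virtual, stack_virtual, himg t ht _ _ (hcs b) (hcs d),
      h₁.virtual t ht, h₂.virtual t ht]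
  · intro t ht
    rw [stack_bars, stack_bars, himg t ht _ _ bars_subset_support bars_subset_support,
      h₁.bars t ht, h₂.bars t ht]

theorem Isotopic.refl (b : Diagram n) : Isotopic b b :=
  SamePattern.isotopic ⟨fun _ _ _ _ => Iff.rfl, fun _ _ _ => Iff.rfl, fun _ _ _ => Iff.rfl⟩

/-! ### Stacking respects local moves -/

theorem upper_mem_stack_virtual {P : ℝ × ℝ} (h : 0 ≤ P.2) :
    upper P ∈ (b.stack b').virtual ↔ P ∈ b.virtual :=
  and_congr (upper_mem_stack_crossingSet h) (not_congr (upper_mem_stack_real h))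

theorem lower_mem_stack_virtual {P : ℝ × ℝ} (h : P.2 ≤ 1) :
    lower P ∈ (b.stack b').virtual ↔ P ∈ b'.virtual :=
  and_congr (lower_mem_stack_crossingSet h) (not_congr (lower_mem_stack_real h))

theorem upper_mem_stack_events {P : ℝ × ℝ} (h : 0 ≤ P.2) :
    upper P ∈ (b.stack b').events ↔ P ∈ b.events :=
  or_congr (upper_mem_stack_crossingSet h) (upper_mem_stack_bars h)

theorem lower_mem_stack_events {P : ℝ × ℝ} (h : P.2 ≤ 1) :
    lower P ∈ (b.stack b').events ↔ P ∈ b'.events :=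
  or_congr (lower_mem_stack_crossingSet h) (lower_mem_stack_bars h)

theorem stack_leftCount_upper {P : ℝ × ℝ} (h : 0 ≤ P.2) (a : ℝ) :
    (b.stack b').leftCount a (upper P) = b.leftCount a P := by
  simp only [leftCount, upper, stack_pos_upper b b' _ h]

theorem stack_leftCount_lower {P : ℝ × ℝ} (h : P.2 ≤ 1) (a : ℝ) :
    (b.stack b').leftCount a (lower P) = b'.leftCount a P := by
  simp only [leftCount, lower, stack_pos_lower b b' _ h]
  exact Set.ncard_preimage_of_injective_subset_range
    (s := {i | a < b'.pos i P.2 ∧ b'.pos i P.2 < P.1}) b.perm.injective (by simp)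

theorem stack_eventIs_upper {P : ℝ × ℝ} (h : 0 ≤ P.2) {a : ℝ} {k : ℕ} {g : Gen k} :
    (b.stack b').EventIs a (upper P) g ↔ b.EventIs a P g := by
  cases g <;> simp only [EventIs, upper_mem_stack_real h, upper_mem_stack_virtual h,
    upper_mem_stack_bars h, stack_leftCount_upper h]

theorem stack_eventIs_lower {P : ℝ × ℝ} (h : P.2 ≤ 1) {a : ℝ} {k : ℕ} {g : Gen k} :
    (b.stack b').EventIs a (lower P) g ↔ b'.EventIs a P g := by
  cases g <;> simp only [EventIs, lower_mem_stack_real h, lower_mem_stack_virtual h,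
    lower_mem_stack_bars h, stack_leftCount_lower h]

theorem ShowsInBox.stack_upper {a c p q : ℝ} (hp : 0 ≤ p) (hq : q ≤ 1) {k : ℕ} {w : List (Gen k)}
    (h : b.ShowsInBox a c p q w) (d : Diagram n) :
    (b.stack d).ShowsInBox a c ((p + 1) / 2) ((q + 1) / 2) w := by
  obtain ⟨h1, h2, L, h3, h4, h5, h6⟩ := h
  have hf : ∀ (i : Fin n) (S : Set ℝ), (∀ y ∈ Icc ((p + 1) / 2) ((q + 1) / 2),
      (b.stack d).pos i y ∈ S) ↔ ∀ y ∈ Icc p q, b.pos i y ∈ S := by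
    intro i S
    constructor
    · intro h y hy
      rw [← stack_pos_upper b d i (hp.trans hy.1)]
      exact h _ ⟨by linarith [hy.1], by linarith [hy.2]⟩
    · intro h y hy
      have : y = ((2 * y - 1) + 1) / 2 := by ring
      rw [this, stack_pos_upper b d i (by linarith [hy.1])]
      exact h _ ⟨by linarith [hy.1], by linarith [hy.2]⟩
  refine ⟨fun i => ?_, ?_, L.map upper, ?_, ?_, ?_, ?_⟩
  · exact (h1 i).imp (hf i _).mpr (hf i (Icc a c)ᶜ).mpr
  · simp only [hf, h2]
  · rw [List.pairwise_map]
    refine h3.imp fun h => ?_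
    simp only [upper]
    linarith
  · intro P
    rw [List.mem_map]
    constructor
    · rintro ⟨Q, hQ, rfl⟩
      obtain ⟨h7, h8, h9⟩ := (h4 Q).mp hQ
      refine ⟨(upper_mem_stack_events (hp.trans h9.1)).mpr h7, h8, ?_⟩
      simp only [upper]
      exact ⟨by linarith [h9.1], by linarith [h9.2]⟩
    · rintro ⟨h7, h8, h9⟩
      obtain ⟨Q, hQ, rfl⟩ := exists_upper (P := P) ⟨by linarith [h9.1], by linarith [h9.2]⟩
      simp only [upper] at h9
      exact ⟨Q, (h4 Q).mpr ⟨(upper_mem_stack_events hQ.1).mp h7, h8,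
        ⟨by linarith [h9.1], by linarith [h9.2]⟩⟩, rfl⟩
  · intro P hP
    obtain ⟨Q, hQ, rfl⟩ := List.mem_map.mp hP
    have := h5 Q hQ
    simp only [upper]
    exact ⟨by linarith [this.1], by linarith [this.2]⟩
  · rw [List.forall₂_map_left_iff]
    have hL : ∀ Q ∈ L, 0 ≤ Q.2 := fun Q hQ => hp.trans (h5 Q hQ).1.le
    clear h3 h4 h5
    induction h6 with
    | nil => exact List.Forall₂.nil
    | cons h _ ih =>
      exact List.Forall₂.cons ((stack_eventIs_upper (hL _ List.mem_cons_self)).mpr h)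
        (ih fun Q hQ => hL Q (List.mem_cons_of_mem _ hQ))

theorem ShowsInBox.stack_lower {a c p q : ℝ} (hp : 0 ≤ p) (hq : q ≤ 1) {k : ℕ} {w : List (Gen k)}
    (h : b.ShowsInBox a c p q w) (d : Diagram n) :
    (d.stack b).ShowsInBox a c (p / 2) (q / 2) w := by
  obtain ⟨h1, h2, L, h3, h4, h5, h6⟩ := h
  have hf : ∀ (i : Fin n) (S : Set ℝ), (∀ y ∈ Icc (p / 2) (q / 2),
      (d.stack b).pos i y ∈ S) ↔ ∀ y ∈ Icc p q, b.pos (d.perm i) y ∈ S := by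
    intro i S
    constructor
    · intro h y hy
      rw [← stack_pos_lower d b i (hy.2.trans hq)]
      exact h _ ⟨by linarith [hy.1], by linarith [hy.2]⟩
    · intro h y hy
      have : y = (2 * y) / 2 := by ring
      rw [this, stack_pos_lower d b i (by linarith [hy.2])]
      exact h _ ⟨by linarith [hy.1], by linarith [hy.2]⟩
  refine ⟨fun i => ?_, ?_, L.map lower, ?_, ?_, ?_, ?_⟩
  · exact (h1 _).imp (hf i _).mpr (hf i (Icc a c)ᶜ).mpr
  · simp only [hf]
    rw [← h2]
    exact Set.ncard_preimage_of_injective_subset_range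
      (s := {i | ∀ y ∈ Icc p q, b.pos i y ∈ Ioo a c}) d.perm.injective (by simp)
  · rw [List.pairwise_map]
    refine h3.imp fun h => ?_
    simp only [lower]
    linarith
  · intro P
    rw [List.mem_map]
    constructor
    · rintro ⟨Q, hQ, rfl⟩
      obtain ⟨h7, h8, h9⟩ := (h4 Q).mp hQ
      refine ⟨(lower_mem_stack_events (h9.2.trans hq)).mpr h7, h8, ?_⟩
      simp only [lower]
      exact ⟨by linarith [h9.1], by linarith [h9.2]⟩
    · rintro ⟨h7, h8, h9⟩
      obtain ⟨Q, hQ, rfl⟩ := exists_lower (P := P) ⟨by linarith [h9.1], by linarith [h9.2]⟩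
      simp only [lower] at h9
      exact ⟨Q, (h4 Q).mpr ⟨(lower_mem_stack_events hQ.2).mp h7, h8,
        ⟨by linarith [h9.1], by linarith [h9.2]⟩⟩, rfl⟩
  · intro P hP
    obtain ⟨Q, hQ, rfl⟩ := List.mem_map.mp hP
    have := h5 Q hQ
    simp only [lower]
    exact ⟨by linarith [this.1], by linarith [this.2]⟩
  · rw [List.forall₂_map_left_iff]
    have hL : ∀ Q ∈ L, Q.2 ≤ 1 := fun Q hQ => (h5 Q hQ).2.le.trans hq
    clear h3 h4 h5
    induction h6 with
    | nil => exact List.Forall₂.nil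
    | cons h _ ih =>
      exact List.Forall₂.cons ((stack_eventIs_lower (hL _ List.mem_cons_self)).mpr h)
        (ih fun Q hQ => hL Q (List.mem_cons_of_mem _ hQ))

theorem image_union_sdiff_congr {f : ℝ × ℝ → ℝ × ℝ} {S S' t t' : Set (ℝ × ℝ)} (X : Set (ℝ × ℝ))
    (h : S \ t = S' \ t) (ht : ∀ P, f P ∈ t' ↔ P ∈ t) :
    (f '' S ∪ X) \ t' = (f '' S' ∪ X) \ t' := by
  have key : ∀ S S' : Set (ℝ × ℝ), S \ t = S' \ t → (f '' S ∪ X) \ t' ⊆ (f '' S' ∪ X) \ t' := by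
    rintro S S' h P ⟨⟨Q, hQ, rfl⟩ | hP, hn⟩
    · have hQt : Q ∉ t := fun h => hn ((ht Q).mpr h)
      exact ⟨Or.inl ⟨Q, (mem_diff_iff h hQt).mp hQ, rfl⟩, hn⟩
    · exact ⟨Or.inr hP, hn⟩
  exact (key S S' h).antisymm (key S' S h.symm)

theorem LocalMove.stack_right (h : LocalMove b b') (d : Diagram n) :
    LocalMove (b.stack d) (b'.stack d) := by
  obtain ⟨k, w, w', hw, a, c, p, q, hac, hp, hpq, hq, hb, hb', hst, hre, hba⟩ := h
  have ht : ∀ P, upper P ∈ Ioo a c ×ˢ Ioo ((p + 1) / 2) ((q + 1) / 2) ↔ P ∈ Ioo a c ×ˢ Ioo p q := by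
    intro P
    refine and_congr Iff.rfl ?_
    simp only [upper, mem_Ioo]
    constructor <;> intro h <;> constructor <;> linarith [h.1, h.2]
  -- The bottom points lie outside the open box since `0 ≤ p`, so the strands end at the same
  -- places. Therefore `d` is attached in the same way to both diagrams.
  have hperm : b.perm = b'.perm := by
    ext i
    have h0 : b.pt i 0 ∉ Ioo a c ×ˢ Ioo p q := fun h => absurd h.2.1 (not_lt.mpr hp)
    have := ((mem_diff_iff (hst i) h0).mp (b.pt_mem_graphOf zero_mem_Icc)).2
    simp only [pt_fst, pt_snd, b.bottom, b'.bottom] at this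
    exact_mod_cast add_right_cancel this
  refine ⟨k, w, w', hw, a, c, (p + 1) / 2, (q + 1) / 2, hac, by linarith, by linarith, by linarith,
    hb.stack_upper hp hq d, hb'.stack_upper hp hq d, fun i => ?_,
    image_union_sdiff_congr _ hre ht, image_union_sdiff_congr _ hba ht⟩
  rw [stack_strand, stack_strand, hperm]
  exact image_union_sdiff_congr _ (hst i) ht

theorem LocalMove.stack_left (h : LocalMove b b') (d : Diagram n) :
    LocalMove (d.stack b) (d.stack b') := by
  obtain ⟨k, w, w', hw, a, c, p, q, hac, hp, hpq, hq, hb, hb', hst, hre, hba⟩ := h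
  have ht : ∀ P, lower P ∈ Ioo a c ×ˢ Ioo (p / 2) (q / 2) ↔ P ∈ Ioo a c ×ˢ Ioo p q := by
    intro P
    refine and_congr Iff.rfl ?_
    simp only [lower, mem_Ioo]
    constructor <;> intro h <;> constructor <;> linarith [h.1, h.2]
  refine ⟨k, w, w', hw, a, c, p / 2, q / 2, hac, by linarith, by linarith, by linarith,
    hb.stack_lower hp hq d, hb'.stack_lower hp hq d, fun i => ?_, ?_, ?_⟩
  · rw [stack_strand, stack_strand, union_comm, union_comm (upper '' _)]
    exact image_union_sdiff_congr _ (hst _) ht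
  · rw [stack_real, stack_real, union_comm, union_comm (upper '' _)]
    exact image_union_sdiff_congr _ hre ht
  · rw [stack_bars, stack_bars, union_comm, union_comm (upper '' _)]
    exact image_union_sdiff_congr _ hba ht

theorem setoid_stack_right (h : (Diagram.setoid n).r b b') (d : Diagram n) :
    (Diagram.setoid n).r (b.stack d) (b'.stack d) := by
  induction h with
  | rel x y h => exact .rel _ _ (h.imp (fun h => h.stack (.refl d)) fun h => h.stack_right d)
  | refl x => exact .refl _
  | symm _ _ _ ih => exact .symm _ _ ih
  | trans _ _ _ _ _ ih1 ih2 => exact .trans _ _ _ ih1 ih2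

theorem setoid_stack_left (h : (Diagram.setoid n).r b b') (d : Diagram n) :
    (Diagram.setoid n).r (d.stack b) (d.stack b') := by
  induction h with
  | rel x y h => exact .rel _ _ (h.imp (fun h => (Isotopic.refl d).stack h) fun h => h.stack_left d)
  | refl x => exact .refl _
  | symm _ _ _ ih => exact .symm _ _ ih
  | trans _ _ _ _ _ ih1 ih2 => exact .trans _ _ _ ih1 ih2

end Diagram

end TwistedVirtualTwin

namespace TwistedVirtualTwin

open Filter Topology

namespace Diagram

variable {n : ℕ} {b b' : Diagram n}

/-! ### The heights of the events -/

/-- The heights of the crossings and bars. -/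
def heights (b : Diagram n) : Set ℝ := Prod.snd '' b.events

theorem finite_heights (b : Diagram n) : b.heights.Finite := by
  refine (b.finite_valid.image Ev.y).subset ?_
  rintro _ ⟨P, hP, rfl⟩
  obtain ⟨e, he, rfl⟩ := exists_valid_of_mem_events hP
  exact ⟨e, he, rfl⟩

theorem heights_subset (b : Diagram n) : b.heights ⊆ Ioo 0 1 := by
  rintro _ ⟨P, hP, rfl⟩
  obtain ⟨e, he, rfl⟩ := exists_valid_of_mem_events hP
  exact Valid.mem_Ioo he

theorem mem_heights_of_pos_eq {i j : Fin n} (hij : i ≠ j) {y : ℝ} (hy : y ∈ Icc (0 : ℝ) 1)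
    (h : b.pos i y = b.pos j y) : y ∈ b.heights :=
  ⟨b.pt i y, Or.inl (b.pt_mem_crossingSet hij hy h), rfl⟩

theorem mem_heights_of_real {i : Fin n} {y : ℝ} (h : b.pt i y ∈ b.real) : y ∈ b.heights :=
  ⟨b.pt i y, Or.inl (b.real_subset h), rfl⟩

theorem mem_heights_of_bars {i : Fin n} {y : ℝ} (h : b.pt i y ∈ b.bars) : y ∈ b.heights :=
  ⟨b.pt i y, Or.inr h, rfl⟩

theorem pos_lt_iff_of_heights {u v : ℝ} (hu : 0 ≤ u) (huv : u ≤ v) (hv : v ≤ 1)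
    (h : ∀ y ∈ Icc u v, y ∉ b.heights) (i j : Fin n) :
    b.pos i u < b.pos j u ↔ b.pos i v < b.pos j v := by
  by_cases hij : i = j
  · simp [hij]
  · exact b.pos_lt_iff_of_forall_ne hu huv hv fun y hy he =>
      h y hy (mem_heights_of_pos_eq hij ⟨hu.trans hy.1, hy.2.trans hv⟩ he)

theorem pos_one_lt_iff (i j : Fin n) : b.pos i 1 < b.pos j 1 ↔ i < j := by
  rw [b.top, b.top]
  simp

/-- Near the top there are no events. -/
theorem exists_top_margin (b : Diagram n) :
    ∃ η ∈ Ioo (0 : ℝ) 1, ∀ y ∈ Icc η 1, y ∉ b.heights ∧ ∀ i j, b.pos i y < b.pos j y ↔ i < j := by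
  have h1 : ∀ᶠ η in 𝓝[<] (1 : ℝ), ∀ y ∈ b.heights, y < η := by
    rw [eventually_all_finite b.finite_heights]
    intro y hy
    filter_upwards [Ioo_mem_nhdsLT (b.heights_subset hy).2] with η hη
    exact hη.1
  obtain ⟨η, hη, hη'⟩ := (h1.and (Ioo_mem_nhdsLT (zero_lt_one (α := ℝ)))).exists
  have hno : ∀ y ∈ Icc η 1, y ∉ b.heights := fun y hy h => absurd (hη y h) (not_lt.mpr hy.1)
  refine ⟨η, hη', fun y hy => ⟨hno y hy, fun i j => ?_⟩⟩
  rw [← pos_one_lt_iff (b := b)]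
  exact pos_lt_iff_of_heights (hη'.1.le.trans hy.1) hy.2 le_rfl
    (fun z hz => hno z ⟨hy.1.trans hz.1, hz.2⟩) i j

/-- Near the bottom there are no events. -/
theorem exists_bottom_margin (b : Diagram n) :
    ∃ η ∈ Ioo (0 : ℝ) 1, ∀ y ∈ Icc 0 η, y ∉ b.heights ∧
      ∀ i j, b.pos i y < b.pos j y ↔ b.perm i < b.perm j := by
  have h1 : ∀ᶠ η in 𝓝[>] (0 : ℝ), ∀ y ∈ b.heights, η < y := by
    rw [eventually_all_finite b.finite_heights]
    intro y hy
    filter_upwards [Ioo_mem_nhdsGT (b.heights_subset hy).1] with η hη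
    exact hη.2
  obtain ⟨η, hη, hη'⟩ := (h1.and (Ioo_mem_nhdsGT (zero_lt_one (α := ℝ)))).exists
  have hno : ∀ y ∈ Icc 0 η, y ∉ b.heights := fun y hy h => absurd (hη y h) (not_lt.mpr hy.2)
  refine ⟨η, hη', fun y hy => ⟨hno y hy, fun i j => ?_⟩⟩
  rw [← pos_zero_lt_iff]
  exact (pos_lt_iff_of_heights le_rfl hy.1 (hy.2.trans hη'.2.le)
    (fun z hz => hno z ⟨hz.1, hz.2.trans hy.2⟩) i j).symm

/-! ### Diagrams all of whose events are at the height `1 / 2` -/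

/-- Straight strands from `i` to `σ i` meet at most pairwise, and only at the height `1 / 2`. -/
def IsLevel (σ : Equiv.Perm (Fin n)) : Prop :=
  ∀ i j, i < j → σ j < σ i → (j : ℕ) = i + 1 ∧ (σ i : ℕ) = σ j + 1

/-- The straight strand from `i` to `σ i`. -/
noncomputable def levelPos (σ : Equiv.Perm (Fin n)) (i : Fin n) (y : ℝ) : ℝ :=
  (1 - y) * (((σ i : ℕ) : ℝ) + 1) + y * (((i : ℕ) : ℝ) + 1)

theorem levelPos_lt {σ : Equiv.Perm (Fin n)} {i j : Fin n} (hij : i < j)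
    (h : σ i < σ j) {y : ℝ} (hy : y ∈ Icc (0 : ℝ) 1) : levelPos σ i y < levelPos σ j y := by
  have h1 : ((i : ℕ) : ℝ) < (j : ℕ) := by exact_mod_cast hij
  have h2 : ((σ i : ℕ) : ℝ) < (σ j : ℕ) := by exact_mod_cast h
  obtain ⟨h3, h4⟩ := hy
  unfold levelPos
  rcases h3.eq_or_lt with rfl | h3
  · linarith
  · nlinarith

/-- Inverted strands are neighbours at both ends, so their difference runs linearly from `1` at the
bottom to `-1` at the top and all crossings are at height `1 / 2`. -/
theorem IsLevel.levelPos_sub {σ : Equiv.Perm (Fin n)} (hσ : IsLevel σ) {i j : Fin n} (hij : i < j)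
    (h : σ j < σ i) (y : ℝ) : levelPos σ i y - levelPos σ j y = 1 - 2 * y := by
  obtain ⟨h1, h2⟩ := hσ i j hij h
  unfold levelPos
  rw [h1, h2]
  push_cast
  ring

theorem IsLevel.eq_half {σ : Equiv.Perm (Fin n)} (hσ : IsLevel σ) {i j : Fin n} (hij : i < j) {y : ℝ}
    (hy : y ∈ Icc (0 : ℝ) 1) (h : levelPos σ i y = levelPos σ j y) : y = 1 / 2 ∧ σ j < σ i := by
  rcases lt_trichotomy (σ i) (σ j) with h1 | h1 | h1
  · exact absurd h (levelPos_lt hij h1 hy).ne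
  · exact absurd (σ.injective h1) hij.ne
  · have := hσ.levelPos_sub hij h1 y
    exact ⟨by linarith, h1⟩

theorem IsLevel.adjacent {σ : Equiv.Perm (Fin n)} (hσ : IsLevel σ) {i j : Fin n} (hij : i ≠ j)
    {y : ℝ} (hy : y ∈ Icc (0 : ℝ) 1) (h : levelPos σ i y = levelPos σ j y) :
    y = 1 / 2 ∧ ((i < j ∧ σ j < σ i) ∨ (j < i ∧ σ i < σ j)) := by
  rcases hij.lt_or_gt with h1 | h1
  · obtain ⟨h2, h3⟩ := hσ.eq_half h1 hy h
    exact ⟨h2, Or.inl ⟨h1, h3⟩⟩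
  · obtain ⟨h2, h3⟩ := hσ.eq_half h1 hy h.symm
    exact ⟨h2, Or.inr ⟨h1, h3⟩⟩

theorem levelPos_contDiff (σ : Equiv.Perm (Fin n)) (i : Fin n) : ContDiff ℝ ∞ (levelPos σ i) := by
  unfold levelPos
  fun_prop

/-- The diagram with straight strands from `i` to `σ i`, whose real crossings are those on the
strands in `R`, and with bars on the strands in `T` that have no crossing. -/
noncomputable def level (σ : Equiv.Perm (Fin n)) (hσ : IsLevel σ) (R T : Set (Fin n)) :
    Diagram n where
  pos := levelPos σ
  perm := σ
  piecewiseSmooth i := .of_contDiff (levelPos_contDiff σ i)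
  top i := by simp [levelPos]
  bottom i := by simp [levelPos]
  double y hy i j k hij hjk := by
    by_contra hc
    push Not at hc
    obtain ⟨h1, h2, h3⟩ := hc
    obtain ⟨-, h4⟩ := hσ.adjacent h1 hy hij
    obtain ⟨-, h5⟩ := hσ.adjacent h2 hy hjk
    obtain ⟨-, h6⟩ := hσ.adjacent h3 hy (hij.trans hjk)
    -- Strands that meet start next to each other, and three integers cannot be pairwise
    -- consecutive.
    have key : ∀ i j : Fin n, ((i < j ∧ σ j < σ i) ∨ (j < i ∧ σ i < σ j)) →
        (j : ℕ) = i + 1 ∨ (i : ℕ) = j + 1 := by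
      rintro i j (⟨h, h'⟩ | ⟨h, h'⟩)
      · exact Or.inl (hσ i j h h').1
      · exact Or.inr (hσ j i h h').1
    have h4 := key _ _ h4
    have h5 := key _ _ h5
    have h6 := key _ _ h6
    omega
  transverse i j hij y hy h := by
    have key : ∀ i j : Fin n, i < j → σ j < σ i →
        CrossTransversally (levelPos σ i) (levelPos σ j) y := by
      intro i j hij h
      have he : (fun u => levelPos σ i u - levelPos σ j u) = fun u => 1 - 2 * u :=
        funext (hσ.levelPos_sub hij h)
      have hd : HasDerivAt (fun u : ℝ => 1 - 2 * u) (-2) y := by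
        simpa using ((hasDerivAt_id y).const_mul (2 : ℝ)).const_sub 1
      refine ⟨-2, -2, ?_, ?_, by norm_num⟩
      · rw [he]
        exact hd.hasDerivWithinAt
      · rw [he]
        exact hd.hasDerivWithinAt
    rcases (hσ.adjacent hij hy h).2 with ⟨h1, h2⟩ | ⟨h1, h2⟩
    · exact key i j h1 h2
    · exact (key j i h1 h2).symm
  real := {P | P ∈ crossingSet (levelPos σ) ∧ ∃ i ∈ R, P ∈ graphOf (levelPos σ i)}
  real_subset := fun _ h => h.1
  bars := {P | P ∉ crossingSet (levelPos σ) ∧ P.2 = 1 / 2 ∧ ∃ i ∈ T, P ∈ graphOf (levelPos σ i)}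
  bars_finite := by
    refine (finite_range fun i : Fin n => (levelPos σ i (1 / 2), (1 / 2 : ℝ))).subset ?_
    rintro P ⟨-, h, i, -, hi⟩
    refine ⟨i, Prod.ext ?_ h.symm⟩
    rw [← h]
    exact hi.2.symm
  bars_strand := by
    rintro P ⟨-, h, i, -, hi⟩
    rw [h]
    exact ⟨by norm_num, i, hi⟩
  bars_crossing := fun _ h => h.1

theorem isLevel_one : IsLevel (1 : Equiv.Perm (Fin n)) := fun _ _ h h' => absurd h h'.asymm

/-- The diagram without crossings and bars. -/
noncomputable def trivial (n : ℕ) : Diagram n := level 1 isLevel_one ∅ ∅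

theorem trivial_pos (i : Fin n) (y : ℝ) : (trivial n).pos i y = ((i : ℕ) : ℝ) + 1 := by
  change levelPos 1 i y = _
  simp only [levelPos, Equiv.Perm.one_apply]
  ring

theorem trivial_real : (trivial n).real = ∅ := by
  ext P
  simp [trivial, level]

theorem trivial_bars : (trivial n).bars = ∅ := by
  ext P
  simp [trivial, level]

/-! ### Associativity and units -/

theorem stack_pt_upper (b b' : Diagram n) (i : Fin n) {y : ℝ} (hy : 0 ≤ y) :
    (b.stack b').pt i ((y + 1) / 2) = upper (b.pt i y) :=
  Prod.ext (stack_pos_upper b b' i hy) rfl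

theorem stack_pt_lower (b b' : Diagram n) (i : Fin n) {y : ℝ} (hy : y ≤ 1) :
    (b.stack b').pt i (y / 2) = lower (b'.pt (b.perm i) y) :=
  Prod.ext (stack_pos_lower b b' i hy) rfl

theorem half_cases {y : ℝ} (hy : y ∈ Icc (0 : ℝ) 1) :
    (∃ z ∈ Icc (0 : ℝ) 1, y = (z + 1) / 2) ∨ ∃ z ∈ Icc (0 : ℝ) 1, y = z / 2 := by
  rcases le_total (1 / 2) y with h | h
  · exact Or.inl ⟨2 * y - 1, ⟨by linarith, by linarith [hy.2]⟩, by ring⟩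
  · exact Or.inr ⟨2 * y, ⟨by linarith [hy.1], by linarith⟩, by ring⟩

theorem setoid_of_isotopic (h : Isotopic b b') : (Diagram.setoid n).r b b' :=
  .rel _ _ (Or.inl h)

theorem setoid_of_localMove (h : LocalMove b b') : (Diagram.setoid n).r b b' :=
  .rel _ _ (Or.inr h)

theorem stack_assoc (a b c : Diagram n) :
    (Diagram.setoid n).r ((a.stack b).stack c) (a.stack (b.stack c)) := by
  set X := (a.stack b).stack c with hX
  set Y := a.stack (b.stack c) with hY
  -- The diagrams are separated at the heights `1/2`, `3/4` in `X` and `1/4`, `1/2` in `Y`. One bend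
  -- has a single corner, so two are composed: the inner one takes `1/4`, `1/2` to `2/5`, `3/5`, and
  -- the outer one takes these to `1/2`, `3/4`.
  have h1 : (3 / 5 : ℝ) ∈ Ioo (0 : ℝ) 1 := by norm_num
  have h2 : (3 / 4 : ℝ) ∈ Ioo (0 : ℝ) 1 := by norm_num
  have h3 : (1 / 4 : ℝ) ∈ Ioo (0 : ℝ) 1 := by norm_num
  have h4 : (2 / 5 : ℝ) ∈ Ioo (0 : ℝ) 1 := by norm_num
  refine .trans _ _ _ (setoid_of_isotopic (X.isotopic_reparam h1 h2)) <|
    .trans _ _ _ (setoid_of_isotopic ((X.reparam h1 h2).isotopic_reparam h3 h4)) <|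
      setoid_of_isotopic (SamePattern.isotopic ?_)
  have hφ : ∀ y, bend (3 / 5) (3 / 4) (bend (1 / 4) (2 / 5) y) =
      if y ≤ 1 / 4 then 2 * y else if y ≤ 1 / 2 then y + 1 / 4 else (y + 1) / 2 := by
    intro y
    split_ifs with h5 h6
    · rw [bend_of_le h3 h5, bend_of_le h1 (by linarith)]
      ring
    · push Not at h5
      rw [bend_of_ge h3 h5.le, bend_of_le h1 (by linarith)]
      ring
    · push Not at h5 h6
      rw [bend_of_ge h3 h5.le, bend_of_ge h1 (by linarith)]
      ring
  have key : ∀ y ∈ Icc (0 : ℝ) 1, ∀ i,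
      X.pos i (bend (3 / 5) (3 / 4) (bend (1 / 4) (2 / 5) y)) = Y.pos i y ∧
      (X.pt i (bend (3 / 5) (3 / 4) (bend (1 / 4) (2 / 5) y)) ∈ X.real ↔ Y.pt i y ∈ Y.real) ∧
      (X.pt i (bend (3 / 5) (3 / 4) (bend (1 / 4) (2 / 5) y)) ∈ X.bars ↔ Y.pt i y ∈ Y.bars) := by
    intro y hy i
    rcases half_cases hy with ⟨z, hz, rfl⟩ | ⟨z, hz, rfl⟩
    · have hb : bend (3 / 5) (3 / 4) (bend (1 / 4) (2 / 5) ((z + 1) / 2)) =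
          ((z + 1) / 2 + 1) / 2 := by
        rw [hφ, if_neg (by linarith [hz.1])]
        split_ifs with h5
        · have : z = 0 := by linarith [hz.1]
          subst this
          norm_num
        · rfl
      have hz' : 0 ≤ (z + 1) / 2 := by linarith [hz.1]
      rw [hb, hX, hY, stack_pos_upper _ _ _ hz', stack_pos_upper _ _ _ hz.1,
        stack_pos_upper _ _ _ hz.1, stack_pt_upper _ _ _ hz', stack_pt_upper _ _ _ hz.1,
        stack_pt_upper _ _ _ hz.1, upper_mem_stack_real (by simpa [upper] using hz'),
        upper_mem_stack_real (by simpa using hz.1), upper_mem_stack_real (by simpa using hz.1),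
        upper_mem_stack_bars (by simpa [upper] using hz'),
        upper_mem_stack_bars (by simpa using hz.1), upper_mem_stack_bars (by simpa using hz.1)]
      exact ⟨rfl, Iff.rfl, Iff.rfl⟩
    rcases half_cases hz with ⟨x, hx, rfl⟩ | ⟨x, hx, rfl⟩
    · have hb : bend (3 / 5) (3 / 4) (bend (1 / 4) (2 / 5) ((x + 1) / 2 / 2)) =
          (x / 2 + 1) / 2 := by
        rw [hφ]
        split_ifs with h5 h6
        · have : x = 0 := by linarith [hx.1]
          subst this
          norm_num
        · ring
        · linarith [hx.2]
      have hx1 : 0 ≤ x / 2 := by linarith [hx.1]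
      have hx2 : (x + 1) / 2 ≤ 1 := by linarith [hx.2]
      rw [hb, hX, hY, stack_pos_upper _ _ _ hx1, stack_pos_lower _ _ _ hx.2,
        stack_pos_lower _ _ _ hx2, stack_pos_upper _ _ _ hx.1,
        stack_pt_upper _ _ _ hx1, stack_pt_lower _ _ _ hx.2, stack_pt_lower _ _ _ hx2,
        stack_pt_upper _ _ _ hx.1, upper_mem_stack_real (by simpa [lower] using hx1),
        lower_mem_stack_real (by simpa using hx.2), lower_mem_stack_real (by simpa [upper] using hx2),
        upper_mem_stack_real (by simpa using hx.1), upper_mem_stack_bars (by simpa [lower] using hx1),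
        lower_mem_stack_bars (by simpa using hx.2), lower_mem_stack_bars (by simpa [upper] using hx2),
        upper_mem_stack_bars (by simpa using hx.1)]
      exact ⟨rfl, Iff.rfl, Iff.rfl⟩
    · have hb : bend (3 / 5) (3 / 4) (bend (1 / 4) (2 / 5) (x / 2 / 2)) = x / 2 := by
        rw [hφ, if_pos (by linarith [hx.2])]
        ring
      have hx2 : x / 2 ≤ 1 := by linarith [hx.2]
      rw [hb, hX, hY, stack_pos_lower _ _ _ hx.2, stack_pos_lower _ _ _ hx2,
        stack_pos_lower _ _ _ hx.2, stack_pt_lower _ _ _ hx.2, stack_pt_lower _ _ _ hx2,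
        stack_pt_lower _ _ _ hx.2, lower_mem_stack_real (by simpa using hx.2),
        lower_mem_stack_real (by simpa [lower] using hx2), lower_mem_stack_real (by simpa using hx.2),
        lower_mem_stack_bars (by simpa using hx.2), lower_mem_stack_bars (by simpa [lower] using hx2),
        lower_mem_stack_bars (by simpa using hx.2)]
      exact ⟨rfl, Iff.rfl, Iff.rfl⟩
  refine ⟨fun y hy i j => ?_, fun y hy i => ?_, fun y hy i => ?_⟩
  · rw [reparam_pos, reparam_pos, reparam_pos, reparam_pos, (key y hy i).1, (key y hy j).1]
  · rw [reparam_real_iff _ _ hy, reparam_real_iff _ _ (bend_mem h3 h4 hy), (key y hy i).2.1]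
  · rw [reparam_bars_iff _ _ hy, reparam_bars_iff _ _ (bend_mem h3 h4 hy), (key y hy i).2.2]

/-- There are no events of `b` above the height `η`. Squeezing `[0, η]` linearly onto `[0, η / 2]`
gives `b` at height `2 * y` there, exactly as in the stack, and above `η / 2` both diagrams have the
strands in their initial order and no events. -/
theorem trivial_stack (b : Diagram n) : (Diagram.setoid n).r ((trivial n).stack b) b := by
  obtain ⟨η, hη, hno⟩ := b.exists_top_margin
  have ht : η / 2 ∈ Ioo (0 : ℝ) 1 := ⟨by linarith [hη.1], by linarith [hη.2]⟩
  refine .trans _ (b.reparam ht hη) _ (.symm _ _ (setoid_of_isotopic (SamePattern.isotopic ?_)))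
    (.symm _ _ (setoid_of_isotopic (b.isotopic_reparam ht hη)))
  have hlow : ∀ y, y ≤ η / 2 → bend (η / 2) η y = 2 * y := by
    intro y hy
    have := hη.1.ne'
    rw [bend_of_le ht hy]
    field_simp
  have hhigh : ∀ y ∈ Icc (0 : ℝ) 1, η / 2 < y → bend (η / 2) η y ∈ Icc η 1 := by
    intro y hy h
    refine ⟨?_, (bend_mem ht hη hy).2⟩
    have := (bend_strictMono ht hη).monotone h.le
    rwa [hlow _ le_rfl, mul_div_cancel₀ _ two_ne_zero] at this
  have hup : ∀ y ∈ Icc (0 : ℝ) 1, η / 2 < y →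
      (∀ i j, ((trivial n).stack b).pos i y < ((trivial n).stack b).pos j y ↔ i < j) ∧
      ∀ i, ((trivial n).stack b).pt i y ∉ ((trivial n).stack b).real ∧
        ((trivial n).stack b).pt i y ∉ ((trivial n).stack b).bars := by
    intro y hy h
    rcases half_cases hy with ⟨z, hz, rfl⟩ | ⟨z, hz, rfl⟩
    · refine ⟨fun i j => ?_, fun i => ?_⟩
      · rw [stack_pos_upper _ _ _ hz.1, stack_pos_upper _ _ _ hz.1, trivial_pos, trivial_pos]
        simp
      · rw [stack_pt_upper _ _ _ hz.1, upper_mem_stack_real (by simpa using hz.1),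
          upper_mem_stack_bars (by simpa using hz.1), trivial_real, trivial_bars]
        simp
    · have hzI : z ∈ Icc η 1 := ⟨by linarith, hz.2⟩
      refine ⟨fun i j => ?_, fun i => ?_⟩
      · rw [stack_pos_lower _ _ _ hz.2, stack_pos_lower _ _ _ hz.2]
        exact (hno z hzI).2 i j
      · rw [stack_pt_lower _ _ _ hz.2, lower_mem_stack_real (by simpa using hz.2),
          lower_mem_stack_bars (by simpa using hz.2)]
        exact ⟨fun h => (hno z hzI).1 (mem_heights_of_real h),
          fun h => (hno z hzI).1 (mem_heights_of_bars h)⟩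
  refine ⟨fun y hy i j => ?_, fun y hy i => ?_, fun y hy i => ?_⟩
  · rw [reparam_pos, reparam_pos]
    rcases le_or_gt y (η / 2) with h | h
    · rw [hlow y h, show y = (2 * y) / 2 by ring, stack_pos_lower _ _ _ (by linarith [hη.2]),
        stack_pos_lower _ _ _ (by linarith [hη.2]), mul_div_cancel₀ _ two_ne_zero]
      rfl
    · rw [(hno _ (hhigh y hy h)).2, (hup y hy h).1]
  · rw [reparam_real_iff _ _ hy]
    rcases le_or_gt y (η / 2) with h | h
    · have h2 : 2 * y ≤ 1 := by linarith [hη.2]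
      have := stack_pt_lower (trivial n) b i h2
      rw [mul_div_cancel_left₀ _ two_ne_zero] at this
      rw [hlow y h, this, lower_mem_stack_real (by simpa using h2)]
      rfl
    · exact iff_of_false (fun h' => (hno _ (hhigh y hy h)).1 (mem_heights_of_real h'))
        ((hup y hy h).2 i).1
  · rw [reparam_bars_iff _ _ hy]
    rcases le_or_gt y (η / 2) with h | h
    · have h2 : 2 * y ≤ 1 := by linarith [hη.2]
      have := stack_pt_lower (trivial n) b i h2
      rw [mul_div_cancel_left₀ _ two_ne_zero] at this
      rw [hlow y h, this, lower_mem_stack_bars (by simpa using h2)]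
      rfl
    · exact iff_of_false (fun h' => (hno _ (hhigh y hy h)).1 (mem_heights_of_bars h'))
        ((hup y hy h).2 i).2

theorem stack_trivial (b : Diagram n) : (Diagram.setoid n).r (b.stack (trivial n)) b := by
  obtain ⟨η, hη, hno⟩ := b.exists_bottom_margin
  have ht : (η + 1) / 2 ∈ Ioo (0 : ℝ) 1 := ⟨by linarith [hη.1], by linarith [hη.2]⟩
  refine .trans _ (b.reparam ht hη) _ (.symm _ _ (setoid_of_isotopic (SamePattern.isotopic ?_)))
    (.symm _ _ (setoid_of_isotopic (b.isotopic_reparam ht hη)))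
  have hhigh : ∀ y, (η + 1) / 2 ≤ y → bend ((η + 1) / 2) η y = 2 * y - 1 := by
    intro y hy
    rw [bend_of_ge ht hy]
    have h1 : 1 - (η + 1) / 2 = (1 - η) / 2 := by ring
    have h2 : 1 - η ≠ 0 := by linarith [hη.2]
    rw [h1]
    field_simp
    ring
  have hlow : ∀ y ∈ Icc (0 : ℝ) 1, y < (η + 1) / 2 → bend ((η + 1) / 2) η y ∈ Icc 0 η := by
    intro y hy h
    refine ⟨(bend_mem ht hη hy).1, ?_⟩
    have := (bend_strictMono ht hη).monotone h.le
    rw [hhigh _ le_rfl] at this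
    linarith
  have hlo : ∀ y ∈ Icc (0 : ℝ) 1, y < (η + 1) / 2 →
      (∀ i j, (b.stack (trivial n)).pos i y < (b.stack (trivial n)).pos j y ↔
        b.perm i < b.perm j) ∧
      ∀ i, (b.stack (trivial n)).pt i y ∉ (b.stack (trivial n)).real ∧
        (b.stack (trivial n)).pt i y ∉ (b.stack (trivial n)).bars := by
    intro y hy h
    rcases half_cases hy with ⟨z, hz, rfl⟩ | ⟨z, hz, rfl⟩
    · have hzI : z ∈ Icc 0 η := ⟨hz.1, by linarith⟩
      refine ⟨fun i j => ?_, fun i => ?_⟩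
      · rw [stack_pos_upper _ _ _ hz.1, stack_pos_upper _ _ _ hz.1]
        exact (hno z hzI).2 i j
      · rw [stack_pt_upper _ _ _ hz.1, upper_mem_stack_real (by simpa using hz.1),
          upper_mem_stack_bars (by simpa using hz.1)]
        exact ⟨fun h => (hno z hzI).1 (mem_heights_of_real h),
          fun h => (hno z hzI).1 (mem_heights_of_bars h)⟩
    · refine ⟨fun i j => ?_, fun i => ?_⟩
      · rw [stack_pos_lower _ _ _ hz.2, stack_pos_lower _ _ _ hz.2, trivial_pos, trivial_pos]
        simp
      · rw [stack_pt_lower _ _ _ hz.2, lower_mem_stack_real (by simpa using hz.2),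
          lower_mem_stack_bars (by simpa using hz.2), trivial_real, trivial_bars]
        simp
  have hpt : ∀ y, (η + 1) / 2 ≤ y → ∀ i,
      (b.stack (trivial n)).pt i y = upper (b.pt i (2 * y - 1)) := by
    intro y hy i
    rw [← stack_pt_upper b (trivial n) i (by linarith [hη.1] : 0 ≤ 2 * y - 1)]
    congr 1
    ring
  refine ⟨fun y hy i j => ?_, fun y hy i => ?_, fun y hy i => ?_⟩
  · rw [reparam_pos, reparam_pos]
    rcases lt_or_ge y ((η + 1) / 2) with h | h
    · rw [(hno _ (hlow y hy h)).2, (hlo y hy h).1]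
    · have h1 := congrArg Prod.fst (hpt y h i)
      have h2 := congrArg Prod.fst (hpt y h j)
      simp only [pt_fst, upper] at h1 h2
      rw [hhigh y h, h1, h2]
  · rw [reparam_real_iff _ _ hy]
    rcases lt_or_ge y ((η + 1) / 2) with h | h
    · exact iff_of_false (fun h' => (hno _ (hlow y hy h)).1 (mem_heights_of_real h'))
        ((hlo y hy h).2 i).1
    · rw [hhigh y h, hpt y h, upper_mem_stack_real (by simp only [pt_snd]; linarith [hη.1])]
  · rw [reparam_bars_iff _ _ hy]
    rcases lt_or_ge y ((η + 1) / 2) with h | h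
    · exact iff_of_false (fun h' => (hno _ (hlow y hy h)).1 (mem_heights_of_bars h'))
        ((hlo y hy h).2 i).2
    · rw [hhigh y h, hpt y h, upper_mem_stack_bars (by simp only [pt_snd]; linarith [hη.1])]

end Diagram

/-- Twisted virtual twins form a monoid under stacking. -/
noncomputable scoped instance twinMonoid (n : ℕ) : Monoid (Twin n) where
  mul := Quotient.map₂ Diagram.stack fun _ b' h d d' h' =>
    (Diagram.setoid n).trans (Diagram.setoid_stack_right h d) (Diagram.setoid_stack_left h' b')
  mul_assoc := by
    rintro ⟨a⟩ ⟨b⟩ ⟨c⟩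
    exact Quotient.sound (Diagram.stack_assoc a b c)
  one := Twin.mk (Diagram.trivial n)
  one_mul := by
    rintro ⟨b⟩
    exact Quotient.sound (Diagram.trivial_stack b)
  mul_one := by
    rintro ⟨b⟩
    exact Quotient.sound (Diagram.stack_trivial b)

theorem Twin.mk_mul_mk {n : ℕ} (b b' : Diagram n) :
    Twin.mk b * Twin.mk b' = Twin.mk (b.stack b') := rfl

theorem Twin.mk_eq_of_isotopic {n : ℕ} {b b' : Diagram n} (h : Diagram.Isotopic b b') :
    Twin.mk b = Twin.mk b' := Quotient.sound (Diagram.setoid_of_isotopic h)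

theorem Twin.mk_eq_of_localMove {n : ℕ} {b b' : Diagram n} (h : Diagram.LocalMove b b') :
    Twin.mk b = Twin.mk b' := Quotient.sound (Diagram.setoid_of_localMove h)

end TwistedVirtualTwin

namespace TwistedVirtualTwin

open Filter Topology

namespace Diagram

variable {n : ℕ} {b b' : Diagram n}

/-! ### Diagrams in a column -/

theorem ShowsInBox.append {a c p m q : ℝ} (hpm : p ≤ m) (hmq : m ≤ q) {k : ℕ} {w w' : List (Gen k)}
    (h : b.ShowsInBox a c m q w) (h' : b.ShowsInBox a c p m w') :
    b.ShowsInBox a c p q (w ++ w') := by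
  obtain ⟨h1, h2, L, h3, h4, h5, h6⟩ := h
  obtain ⟨h1', h2', L', h3', h4', h5', h6'⟩ := h'
  have hin : ∀ i, (∀ y ∈ Icc m q, b.pos i y ∈ Ioo a c) → ∀ y ∈ Icc p q, b.pos i y ∈ Ioo a c := by
    intro i hi y hy
    rcases le_total m y with hm | hm
    · exact hi y ⟨hm, hy.2⟩
    · rcases h1' i with h | h
      · exact h y ⟨hy.1, hm⟩
      · exact absurd (Ioo_subset_Icc_self (hi m ⟨le_rfl, hmq⟩)) (h m ⟨hpm, le_rfl⟩)
  refine ⟨fun i => ?_, ?_, L ++ L', ?_, fun P => ?_, ?_, List.rel_append h6 h6'⟩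
  · rcases h1 i with h | h
    · exact Or.inl (hin i h)
    · refine Or.inr fun y hy => ?_
      rcases le_total m y with hm | hm
      · exact h y ⟨hm, hy.2⟩
      · rcases h1' i with h' | h'
        · exact absurd (Ioo_subset_Icc_self (h' m ⟨hpm, le_rfl⟩)) (h m ⟨le_rfl, hmq⟩)
        · exact h' y ⟨hy.1, hm⟩
  · rw [← h2]
    congr 1
    ext i
    exact ⟨fun h y hy => h y ⟨hpm.trans hy.1, hy.2⟩, hin i⟩
  · refine List.pairwise_append.mpr ⟨h3, h3', fun P hP Q hQ => ?_⟩
    exact (h5' Q hQ).2.trans (h5 P hP).1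
  · rw [List.mem_append, h4, h4', ← and_or_left, mem_prod, mem_prod, mem_prod, ← and_or_left,
      ← mem_union, union_comm, Icc_union_Icc_eq_Icc hpm hmq]
  · intro P hP
    rcases List.mem_append.mp hP with h | h
    · exact ⟨hpm.trans_lt (h5 P h).1, (h5 P h).2⟩
    · exact ⟨(h5' P h).1, (h5' P h).2.trans_le hmq⟩

theorem ShowsInBox.stack {a c : ℝ} {k : ℕ} {w w' : List (Gen k)} (h : b.ShowsInBox a c 0 1 w)
    (h' : b'.ShowsInBox a c 0 1 w') : (b.stack b').ShowsInBox a c 0 1 (w ++ w') := by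
  have h1 := h.stack_upper le_rfl le_rfl b'
  have h2 := h'.stack_lower le_rfl le_rfl b
  norm_num at h1 h2
  exact h1.append (by norm_num) (by norm_num) h2

/-- The diagrams differ only inside the column `(a, c) × [0, 1]`. -/
structure AgreeOff (a c : ℝ) (b b' : Diagram n) : Prop where
  pos : ∀ i, (∀ y ∈ Icc (0 : ℝ) 1, b.pos i y ∈ Ioo a c ∧ b'.pos i y ∈ Ioo a c) ∨
    ∀ y ∈ Icc (0 : ℝ) 1, b.pos i y = b'.pos i y ∧ b.pos i y ∉ Icc a c
  real : ∀ P : ℝ × ℝ, P.1 ∉ Ioo a c → (P ∈ b.real ↔ P ∈ b'.real)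
  bars : ∀ P : ℝ × ℝ, P.1 ∉ Ioo a c → (P ∈ b.bars ↔ P ∈ b'.bars)

theorem AgreeOff.symm {a c : ℝ} (h : AgreeOff a c b b') : AgreeOff a c b' b where
  pos i := by
    rcases h.pos i with h | h
    · exact Or.inl fun y hy => (h y hy).symm
    · exact Or.inr fun y hy => ⟨(h y hy).1.symm, (h y hy).1 ▸ (h y hy).2⟩
  real P hP := (h.real P hP).symm
  bars P hP := (h.bars P hP).symm

theorem AgreeOff.trans {a c : ℝ} {d : Diagram n} (h : AgreeOff a c b b') (h' : AgreeOff a c b' d) :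
    AgreeOff a c b d where
  pos i := by
    have h0 : (0 : ℝ) ∈ Icc (0 : ℝ) 1 := zero_mem_Icc
    rcases h.pos i with h1 | h1 <;> rcases h'.pos i with h2 | h2
    · exact Or.inl fun y hy => ⟨(h1 y hy).1, (h2 y hy).2⟩
    · exact absurd (Ioo_subset_Icc_self (h1 0 h0).2) (h2 0 h0).2
    · exact absurd (Ioo_subset_Icc_self ((h1 0 h0).1 ▸ (h2 0 h0).1)) (h1 0 h0).2
    · exact Or.inr fun y hy => ⟨(h1 y hy).1.trans (h2 y hy).1, (h1 y hy).2⟩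
  real P hP := (h.real P hP).trans (h'.real P hP)
  bars P hP := (h.bars P hP).trans (h'.bars P hP)

theorem AgreeOff.stack {a c : ℝ} {d d' : Diagram n} (h : AgreeOff a c b b')
    (h' : AgreeOff a c d d') : AgreeOff a c (b.stack d) (b'.stack d') where
  pos i := by
    have e := b.stack_match d i
    have e' := b'.stack_match d' i
    rcases h.pos i with h1 | h1
    · refine Or.inl fun y hy => ?_
      rcases half_cases hy with ⟨z, hz, rfl⟩ | ⟨z, hz, rfl⟩
      · rw [stack_pos_upper _ _ _ hz.1, stack_pos_upper _ _ _ hz.1]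
        exact h1 z hz
      · rw [stack_pos_lower _ _ _ hz.2, stack_pos_lower _ _ _ hz.2]
        have h2 := h1 0 zero_mem_Icc
        rw [e, e'] at h2
        constructor
        · rcases h'.pos (b.perm i) with h3 | h3
          · exact (h3 z hz).1
          · exact absurd (Ioo_subset_Icc_self h2.1) (h3 1 one_mem_Icc).2
        · rcases h'.pos (b'.perm i) with h3 | h3
          · exact (h3 z hz).2
          · rw [← (h3 1 one_mem_Icc).1] at h2
            exact absurd (Ioo_subset_Icc_self h2.2) (h3 1 one_mem_Icc).2
    · refine Or.inr fun y hy => ?_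
      rcases half_cases hy with ⟨z, hz, rfl⟩ | ⟨z, hz, rfl⟩
      · rw [stack_pos_upper _ _ _ hz.1, stack_pos_upper _ _ _ hz.1]
        exact h1 z hz
      · have h2 := h1 0 zero_mem_Icc
        have hp : b.perm i = b'.perm i := by
          have := h2.1
          rw [b.bottom, b'.bottom] at this
          exact Fin.ext (by exact_mod_cast add_right_cancel this)
        rw [stack_pos_lower _ _ _ hz.2, stack_pos_lower _ _ _ hz.2, ← hp]
        rcases h'.pos (b.perm i) with h3 | h3
        · rw [e] at h2
          exact absurd (Ioo_subset_Icc_self (h3 1 one_mem_Icc).1) h2.2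
        · exact h3 z hz
  real P hP := by
    refine or_congr ?_ ?_
    · exact exists_congr fun Q => and_congr_left (by rintro rfl; exact h.real Q hP)
    · exact exists_congr fun Q => and_congr_left (by rintro rfl; exact h'.real Q hP)
  bars P hP := by
    refine or_congr ?_ ?_
    · exact exists_congr fun Q => and_congr_left (by rintro rfl; exact h.bars Q hP)
    · exact exists_congr fun Q => and_congr_left (by rintro rfl; exact h'.bars Q hP)

theorem notMem_Ioo_zero_one {P : ℝ × ℝ} (h : P.2 ∈ Icc (0 : ℝ) 1) (h' : P.2 ∉ Ioo (0 : ℝ) 1) :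
    P.2 = 0 ∨ P.2 = 1 := by
  by_contra hc
  push Not at hc
  exact h' ⟨lt_of_le_of_ne h.1 (Ne.symm hc.1), lt_of_le_of_ne h.2 hc.2⟩

theorem AgreeOff.strand_sdiff {a c : ℝ} (h : AgreeOff a c b b') (hp : b.perm = b'.perm) (i : Fin n) :
    b.strand i \ Ioo a c ×ˢ Ioo 0 1 ⊆ b'.strand i \ Ioo a c ×ˢ Ioo 0 1 := by
  rintro P ⟨hP, hn⟩
  refine ⟨⟨hP.1, hP.2.trans ?_⟩, hn⟩
  rcases h.pos i with h1 | h1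
  · have h2 : P.2 ∉ Ioo (0 : ℝ) 1 := fun h2 => hn ⟨by rw [hP.2]; exact (h1 _ hP.1).1, h2⟩
    rcases notMem_Ioo_zero_one hP.1 h2 with h3 | h3
    · rw [h3, b.bottom, b'.bottom, hp]
    · rw [h3, b.top, b'.top]
  · exact (h1 _ hP.1).1

/-- The box is the whole column. Its bottom edge is not in the open box, so the strands inside must
also end at the same places, which is the role of `hp`. -/
theorem LocalMove.of_agreeOff {a c : ℝ} (hac : a < c) {k : ℕ} {w w' : List (Gen k)}
    (hw : MovePicture k w w') (h : b.ShowsInBox a c 0 1 w) (h' : b'.ShowsInBox a c 0 1 w')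
    (ho : AgreeOff a c b b') (hp : b.perm = b'.perm) : LocalMove b b' := by
  refine ⟨k, w, w', hw, a, c, 0, 1, hac, le_rfl, zero_lt_one, le_rfl, h, h',
    fun i => (ho.strand_sdiff hp i).antisymm (ho.symm.strand_sdiff hp.symm i), ?_, ?_⟩
  · have key : ∀ b b' : Diagram n, AgreeOff a c b b' →
        b.real \ Ioo a c ×ˢ Ioo 0 1 ⊆ b'.real \ Ioo a c ×ˢ Ioo 0 1 := by
      rintro b b' ho P ⟨hP, hn⟩
      refine ⟨(ho.real P fun h1 => hn ⟨h1, ?_⟩).mp hP, hn⟩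
      exact b.heights_subset ⟨P, Or.inl (b.real_subset hP), rfl⟩
    exact (key _ _ ho).antisymm (key _ _ ho.symm)
  · have key : ∀ b b' : Diagram n, AgreeOff a c b b' →
        b.bars \ Ioo a c ×ˢ Ioo 0 1 ⊆ b'.bars \ Ioo a c ×ˢ Ioo 0 1 := by
      rintro b b' ho P ⟨hP, hn⟩
      exact ⟨(ho.bars P fun h1 => hn ⟨h1, (b.bars_strand P hP).1⟩).mp hP, hn⟩
    exact (key _ _ ho).antisymm (key _ _ ho.symm)

end Diagram

end TwistedVirtualTwin

namespace TwistedVirtualTwin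

open Filter Topology

namespace Diagram

variable {n : ℕ} {σ τ : Equiv.Perm (Fin n)} {R R' T T' : Set (Fin n)} {o k : ℕ}

/-! ### Columns of level diagrams -/

/-- A counting argument. A strand starting left of `i` must end left of `σ j`, or it would be
inverted with `j` without being its neighbour; hence `i ≤ σ j`. Dually `σ i ≤ j`, and the adjacency
of `i, j` and of their images leaves only one possibility. -/
theorem IsLevel.swap (hσ : IsLevel σ) {i j : Fin n} (hij : i < j) (h : σ j < σ i) :
    σ i = j ∧ σ j = i := by
  obtain ⟨h1, h2⟩ := hσ i j hij h
  have h3 : (i : ℕ) ≤ σ j := by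
    rw [← Fin.card_Iio i, ← Fin.card_Iio (σ j)]
    refine Finset.card_le_card_of_injOn σ (fun l hl => ?_) σ.injective.injOn
    simp only [Finset.coe_Iio, mem_Iio] at hl ⊢
    by_contra hc
    have h4 := (hσ l j (hl.trans hij)
      (lt_of_le_of_ne (not_lt.mp hc) (σ.injective.ne (hl.trans hij).ne'))).1
    have : (l : ℕ) < i := hl
    omega
  have h5 : n - 1 - j ≤ n - 1 - (σ i : ℕ) := by
    rw [← Fin.card_Ioi j, ← Fin.card_Ioi (σ i)]
    refine Finset.card_le_card_of_injOn σ (fun l hl => ?_) σ.injective.injOn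
    simp only [Finset.coe_Ioi, mem_Ioi] at hl ⊢
    by_contra hc
    have h4 := (hσ i l (hij.trans hl)
      (lt_of_le_of_ne (not_lt.mp hc) (σ.injective.ne (hij.trans hl).ne'))).1
    have : (j : ℕ) < l := hl
    omega
  have h6 := (σ i).isLt
  have h7 := j.isLt
  constructor <;> ext <;> omega

/-- The straight strands of `σ` do not meet the vertical line between the positions `m - 1` and
`m`. -/
def Cut (σ : Equiv.Perm (Fin n)) (m : ℕ) : Prop :=
  ∀ i : Fin n, (i : ℕ) < m ↔ (σ i : ℕ) < m

theorem Cut.levelPos_lt {m : ℕ} (h : Cut σ m) {i : Fin n} (hi : (i : ℕ) < m) {y : ℝ}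
    (hy : y ∈ Icc (0 : ℝ) 1) : levelPos σ i y < m + 1 / 2 := by
  have h1 : ((i : ℕ) : ℝ) + 1 ≤ m := by exact_mod_cast hi
  have h2 : ((σ i : ℕ) : ℝ) + 1 ≤ m := by exact_mod_cast (h i).mp hi
  unfold levelPos
  nlinarith [mul_le_mul_of_nonneg_left h1 hy.1, mul_le_mul_of_nonneg_left h2 (sub_nonneg.mpr hy.2)]

theorem Cut.lt_levelPos {m : ℕ} (h : Cut σ m) {i : Fin n} (hi : m ≤ (i : ℕ)) {y : ℝ}
    (hy : y ∈ Icc (0 : ℝ) 1) : m + 1 / 2 < levelPos σ i y := by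
  have h1 : (m : ℝ) ≤ (i : ℕ) := by exact_mod_cast hi
  have h2 : (m : ℝ) ≤ (σ i : ℕ) := by
    exact_mod_cast not_lt.mp (mt (h i).mpr (not_lt.mpr hi))
  unfold levelPos
  nlinarith [mul_le_mul_of_nonneg_left h1 hy.1, mul_le_mul_of_nonneg_left h2 (sub_nonneg.mpr hy.2)]

/-- Strand `l` starts at the abscissa `l + 1`, so the line at `o + 1 / 2` runs between the strands
`o - 1` and `o`. The column thus bounded contains the `k` strands from `o` on. -/
theorem levelPos_mem_Ioo (ho : Cut σ o) (hk : Cut σ (o + k)) {i : Fin n} (h1 : o ≤ i)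
    (h2 : (i : ℕ) < o + k) {y : ℝ} (hy : y ∈ Icc (0 : ℝ) 1) :
    levelPos σ i y ∈ Ioo ((o : ℝ) + 1 / 2) (o + k + 1 / 2) :=
  ⟨ho.lt_levelPos h1 hy, by exact_mod_cast hk.levelPos_lt h2 hy⟩

theorem levelPos_notMem_Icc (ho : Cut σ o) (hk : Cut σ (o + k)) {i : Fin n}
    (h : (i : ℕ) < o ∨ o + k ≤ i) {y : ℝ} (hy : y ∈ Icc (0 : ℝ) 1) :
    levelPos σ i y ∉ Icc ((o : ℝ) + 1 / 2) (o + k + 1 / 2) := by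
  rintro ⟨h1, h2⟩
  rcases h with h | h
  · linarith [ho.levelPos_lt h hy]
  · have := hk.lt_levelPos h hy
    push_cast at this
    linarith

theorem block_cases (o k : ℕ) (i : Fin n) :
    (o ≤ i ∧ (i : ℕ) < o + k) ∨ ((i : ℕ) < o ∨ o + k ≤ i) := by omega

theorem half_mem_Icc : (1 / 2 : ℝ) ∈ Icc (0 : ℝ) 1 := by norm_num

theorem level_column (hσ : IsLevel σ) (hn : o + k ≤ n) (ho : Cut σ o) (hk : Cut σ (o + k)) :
    (∀ i, (∀ y ∈ Icc (0 : ℝ) 1, (level σ hσ R T).pos i y ∈ Ioo ((o : ℝ) + 1 / 2) (o + k + 1 / 2)) ∨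
      ∀ y ∈ Icc (0 : ℝ) 1, (level σ hσ R T).pos i y ∉ Icc ((o : ℝ) + 1 / 2) (o + k + 1 / 2)) ∧
    {i : Fin n | ∀ y ∈ Icc (0 : ℝ) 1,
      (level σ hσ R T).pos i y ∈ Ioo ((o : ℝ) + 1 / 2) (o + k + 1 / 2)}.ncard = k := by
  constructor
  · intro i
    rcases block_cases o k i with h | h
    · exact Or.inl fun y hy => levelPos_mem_Ioo ho hk h.1 h.2 hy
    · exact Or.inr fun y hy => levelPos_notMem_Icc ho hk h hy
  · have : {i : Fin n | ∀ y ∈ Icc (0 : ℝ) 1,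
        (level σ hσ R T).pos i y ∈ Ioo ((o : ℝ) + 1 / 2) (o + k + 1 / 2)} =
        range fun l : Fin k => (⟨o + l, by omega⟩ : Fin n) := by
      ext i
      simp only [mem_ofPred_eq, mem_range]
      constructor
      · intro h
        rcases block_cases o k i with h1 | h1
        · exact ⟨⟨i - o, by omega⟩, Fin.ext (by simp only; omega)⟩
        · exact absurd (Ioo_subset_Icc_self (h _ half_mem_Icc))
            (levelPos_notMem_Icc ho hk h1 half_mem_Icc)
      · rintro ⟨l, rfl⟩ y hy
        exact levelPos_mem_Ioo ho hk (by simp) (by simp) hy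
    rw [this, ← Set.image_univ, ncard_image_of_injective, ncard_univ, Nat.card_fin]
    intro l l' h
    simp only [Fin.mk.injEq] at h
    omega

theorem IsLevel.crossing (hσ : IsLevel σ) {P : ℝ × ℝ} (h : P ∈ crossingSet (levelPos σ)) :
    ∃ i j, i < j ∧ σ i = j ∧ σ j = i ∧ P = (levelPos σ i (1 / 2), 1 / 2) := by
  have key : ∀ i j, i < j → P ∈ graphOf (levelPos σ i) → P ∈ graphOf (levelPos σ j) →
      ∃ i j, i < j ∧ σ i = j ∧ σ j = i ∧ P = (levelPos σ i (1 / 2), 1 / 2) := by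
    intro i j hij hi hj
    obtain ⟨h1, h2⟩ := hσ.eq_half hij hi.1 (hi.2.symm.trans hj.2)
    exact ⟨i, j, hij, (hσ.swap hij h2).1, (hσ.swap hij h2).2, Prod.ext (h1 ▸ hi.2) h1⟩
  obtain ⟨i, j, hij, hi, hj⟩ := h
  rcases hij.lt_or_gt with h | h
  · exact key i j h hi hj
  · exact key j i h hj hi

theorem level_events (hσ : IsLevel σ) {P : ℝ × ℝ} (h : P ∈ (level σ hσ R T).events) :
    ∃ l, (σ l ≠ l ∨ l ∈ T) ∧ P = (levelPos σ l (1 / 2), 1 / 2) := by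
  rcases h with h | ⟨-, h, l, hl, hP⟩
  · obtain ⟨i, j, hij, h1, h2, h3⟩ := hσ.crossing h
    exact ⟨i, Or.inl (h1 ▸ hij.ne'), h3⟩
  · exact ⟨l, Or.inr hl, Prod.ext (h ▸ hP.2) h⟩

theorem level_events_column (hσ : IsLevel σ) (ho : Cut σ o) (hk : Cut σ (o + k)) {P : ℝ × ℝ}
    (h : P ∈ (level σ hσ R T).events)
    (hP : P ∈ Icc ((o : ℝ) + 1 / 2) (o + k + 1 / 2) ×ˢ Icc (0 : ℝ) 1) :
    ∃ l : Fin n, (o ≤ l ∧ (l : ℕ) < o + k) ∧ (σ l ≠ l ∨ l ∈ T) ∧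
      P = (levelPos σ l (1 / 2), 1 / 2) := by
  obtain ⟨l, h1, rfl⟩ := level_events hσ h
  refine ⟨l, (block_cases o k l).resolve_right fun h2 => ?_, h1, rfl⟩
  exact levelPos_notMem_Icc ho hk h2 half_mem_Icc hP.1

theorem level_shows_nil (hσ : IsLevel σ) (hn : o + k ≤ n) (ho : Cut σ o) (hk : Cut σ (o + k))
    (hfix : ∀ l : Fin n, o ≤ l → (l : ℕ) < o + k → σ l = l ∧ l ∉ T) :
    (level σ hσ R T).ShowsInBox (o + 1 / 2) (o + k + 1 / 2) 0 1 ([] : List (Gen k)) := by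
  obtain ⟨h1, h2⟩ := level_column (R := R) (T := T) hσ hn ho hk
  refine ⟨h1, h2, [], .nil, fun P => ?_, by simp, .nil⟩
  refine iff_of_false (by simp) fun h => ?_
  obtain ⟨l, h3, h4, -⟩ := level_events_column hσ ho hk h.1 h.2
  have h5 := hfix l h3.1 h3.2
  exact h4.elim (fun h => h h5.1) h5.2

theorem level_shows_singleton (hσ : IsLevel σ) (hn : o + k ≤ n) (ho : Cut σ o) (hk : Cut σ (o + k))
    {i : Fin n} (hi1 : o ≤ i) (hi2 : (i : ℕ) < o + k)
    (he : (levelPos σ i (1 / 2), (1 / 2 : ℝ)) ∈ (level σ hσ R T).events)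
    (hu : ∀ l : Fin n, o ≤ l → (l : ℕ) < o + k → (σ l ≠ l ∨ l ∈ T) →
      levelPos σ l (1 / 2) = levelPos σ i (1 / 2)) {g : Gen k}
    (hg : (level σ hσ R T).EventIs (o + 1 / 2) (levelPos σ i (1 / 2), (1 / 2 : ℝ)) g) :
    (level σ hσ R T).ShowsInBox (o + 1 / 2) (o + k + 1 / 2) 0 1 [g] := by
  obtain ⟨h1, h2⟩ := level_column (R := R) (T := T) hσ hn ho hk
  refine ⟨h1, h2, [(levelPos σ i (1 / 2), 1 / 2)], by simp, fun P => ?_, ?_, ?_⟩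
  · rw [List.mem_singleton]
    constructor
    · rintro rfl
      exact ⟨he, Ioo_subset_Icc_self (levelPos_mem_Ioo ho hk hi1 hi2 half_mem_Icc), half_mem_Icc⟩
    · rintro ⟨h3, h4⟩
      obtain ⟨l, h5, h6, rfl⟩ := level_events_column hσ ho hk h3 h4
      rw [hu l h5.1 h5.2 h6]
  · simp only [List.mem_singleton, forall_eq]
    norm_num
  · exact .cons hg .nil

theorem levelPos_of_fixed {l : Fin n} (h : σ l = l) (y : ℝ) : levelPos σ l y = ((l : ℕ) : ℝ) + 1 := by
  rw [levelPos, h]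
  ring

theorem levelPos_of_swap {i j : Fin n} (h1 : σ i = j) (h2 : σ j = i) :
    levelPos σ i (1 / 2) = levelPos σ j (1 / 2) := by
  rw [levelPos, levelPos, h1, h2]
  ring

theorem level_leftCount (hσ : IsLevel σ) {x : ℝ} {m : ℕ} (hn : o + m ≤ n)
    (h : ∀ l : Fin n, ((o : ℝ) + 1 / 2 < levelPos σ l (1 / 2) ∧ levelPos σ l (1 / 2) < x) ↔
      o ≤ l ∧ (l : ℕ) < o + m) :
    (level σ hσ R T).leftCount (o + 1 / 2) (x, 1 / 2) = m := by
  have : {i : Fin n | (o : ℝ) + 1 / 2 < (level σ hσ R T).pos i (1 / 2) ∧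
      (level σ hσ R T).pos i (1 / 2) < x} =
      range fun l : Fin m => (⟨o + l, by omega⟩ : Fin n) := by
    ext i
    rw [mem_ofPred_eq]
    refine (h i).trans ?_
    simp only [mem_range]
    constructor
    · intro h
      exact ⟨⟨i - o, by omega⟩, Fin.ext (by simp only; omega)⟩
    · rintro ⟨l, rfl⟩
      simp
  rw [leftCount]
  simp only
  rw [this, ← Set.image_univ, ncard_image_of_injective, ncard_univ, Nat.card_fin]
  intro l l' h
  simp only [Fin.mk.injEq] at h
  omega

section Cross

variable {i j : Fin n} {m : ℕ}

theorem levelPos_cross (hij : (j : ℕ) = i + 1) (h1 : σ i = j) :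
    levelPos σ i (1 / 2) = (i : ℕ) + 3 / 2 := by
  rw [levelPos, h1, hij]
  push_cast
  ring

theorem level_leftCount_cross (hσ : IsLevel σ) (ho : Cut σ o) (hk : Cut σ (o + k))
    (hi : (i : ℕ) = o + m) (hm : m + 1 < k) (hij : (j : ℕ) = i + 1) (h1 : σ i = j) (h2 : σ j = i)
    (hfix : ∀ l : Fin n, o ≤ l → (l : ℕ) < o + k → l ≠ i → l ≠ j → σ l = l) :
    (level σ hσ R T).leftCount (o + 1 / 2) (levelPos σ i (1 / 2), 1 / 2) = m := by
  have hx := levelPos_cross hij h1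
  refine level_leftCount hσ (by omega) fun l => ?_
  rcases block_cases o k l with h | h
  · have h3 := (levelPos_mem_Ioo ho hk h.1 h.2 half_mem_Icc).1
    simp only [h3, true_and, h.1]
    by_cases hl : l = i
    · subst hl
      simp [hi]
    by_cases hl' : l = j
    · subst hl'
      rw [levelPos_of_swap h1 h2]
      simp only [lt_self_iff_false, false_iff]
      omega
    rw [levelPos_of_fixed (hfix l h.1 h.2 hl hl'), hx]
    have h4 : (l : ℕ) ≠ i := fun h => hl (Fin.ext h)
    constructor
    · intro h5
      have h6 : ((l : ℕ) : ℝ) < (i : ℕ) + 1 := by linarith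
      have h7 : (l : ℕ) < i + 1 := by exact_mod_cast h6
      omega
    · intro h5
      have h6 : ((l : ℕ) : ℝ) < (i : ℕ) := by exact_mod_cast (by omega : (l : ℕ) < i)
      linarith
  · refine iff_of_false (fun h3 => ?_) (by omega)
    refine levelPos_notMem_Icc ho hk h half_mem_Icc ⟨h3.1.le, h3.2.le.trans ?_⟩
    rw [hx]
    have : ((i : ℕ) : ℝ) + 2 ≤ o + k := by exact_mod_cast (by omega : (i : ℕ) + 2 ≤ o + k)
    linarith

theorem level_cross_mem (h1 : σ i = j) (h2 : σ j = i) (hij : i ≠ j) :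
    (levelPos σ i (1 / 2), (1 / 2 : ℝ)) ∈ crossingSet (levelPos σ) :=
  ⟨i, j, hij, ⟨half_mem_Icc, rfl⟩, ⟨half_mem_Icc, levelPos_of_swap h1 h2⟩⟩

theorem level_cross_real (hσ : IsLevel σ) (hij : (j : ℕ) = i + 1) (h1 : σ i = j) (h2 : σ j = i) :
    (levelPos σ i (1 / 2), (1 / 2 : ℝ)) ∈ (level σ hσ R T).real ↔ i ∈ R ∨ j ∈ R := by
  have hne : i ≠ j := by
    rintro rfl
    omega
  constructor
  · rintro ⟨-, r, hr, h3⟩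
    by_cases hri : r = i
    · exact Or.inl (hri ▸ hr)
    by_cases hrj : r = j
    · exact Or.inr (hrj ▸ hr)
    rcases (level σ hσ R T).double _ half_mem_Icc r i j h3.2.symm (levelPos_of_swap h1 h2) with
      h | h | h
    · exact absurd h hri
    · exact absurd h hne
    · exact absurd h hrj
  · rintro (h | h)
    · exact ⟨level_cross_mem h1 h2 hne, i, h, half_mem_Icc, rfl⟩
    · exact ⟨level_cross_mem h1 h2 hne, j, h, half_mem_Icc, levelPos_of_swap h1 h2⟩

theorem level_shows_cross (hσ : IsLevel σ) (hn : o + k ≤ n) (ho : Cut σ o) (hk : Cut σ (o + k))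
    (hi : (i : ℕ) = o + m) (hm : m + 1 < k) (hij : (j : ℕ) = i + 1) (h1 : σ i = j) (h2 : σ j = i)
    (hfix : ∀ l : Fin n, o ≤ l → (l : ℕ) < o + k → l ≠ i → l ≠ j → σ l = l ∧ l ∉ T) {g : Gen k}
    (hg : ((i ∈ R ∨ j ∈ R) ∧ g = .s m hm) ∨ (¬(i ∈ R ∨ j ∈ R) ∧ g = .rho m hm)) :
    (level σ hσ R T).ShowsInBox (o + 1 / 2) (o + k + 1 / 2) 0 1 [g] := by
  have hne : i ≠ j := by
    rintro rfl
    omega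
  have hc := level_cross_mem h1 h2 hne
  refine level_shows_singleton hσ hn ho hk (i := i) (by omega) (by omega) (Or.inl hc) ?_ ?_
  · intro l h3 h4 h5
    by_cases hl : l = i
    · rw [hl]
    by_cases hl' : l = j
    · rw [hl', levelPos_of_swap h1 h2]
    exact absurd h5 (by simp [hfix l h3 h4 hl hl'])
  · have hL := level_leftCount_cross (R := R) (T := T) hσ ho hk hi hm hij h1 h2
      fun l h3 h4 h5 h6 => (hfix l h3 h4 h5 h6).1
    rcases hg with ⟨hR, rfl⟩ | ⟨hR, rfl⟩
    · exact ⟨(level_cross_real hσ hij h1 h2).mpr hR, hL⟩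
    · exact ⟨⟨hc, mt (level_cross_real hσ hij h1 h2).mp hR⟩, hL⟩

theorem level_shows_bar (hσ : IsLevel σ) (hn : o + k ≤ n) (ho : Cut σ o) (hk : Cut σ (o + k))
    (hi : (i : ℕ) = o + m) (hm : m < k) (hT : i ∈ T)
    (hfix : ∀ l : Fin n, o ≤ l → (l : ℕ) < o + k → σ l = l)
    (hT' : ∀ l ∈ T, o ≤ (l : ℕ) → (l : ℕ) < o + k → l = i) :
    (level σ hσ R T).ShowsInBox (o + 1 / 2) (o + k + 1 / 2) 0 1 [Gen.gamma m hm] := by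
  have hbar : (levelPos σ i (1 / 2), (1 / 2 : ℝ)) ∈ (level σ hσ R T).bars := by
    refine ⟨?_, rfl, i, hT, half_mem_Icc, rfl⟩
    intro hc
    obtain ⟨l, l', h1, h2, h3, h4⟩ := hσ.crossing hc
    have h5 : levelPos σ i (1 / 2) = levelPos σ l (1 / 2) := (Prod.ext_iff.mp h4).1
    have h6 := (levelPos_of_swap h2 h3).symm
    rcases block_cases o k l with h | h
    · exact h1.ne' (h2.symm.trans (hfix l h.1 h.2))
    · exact levelPos_notMem_Icc ho hk h half_mem_Icc
        (h5 ▸ Ioo_subset_Icc_self (levelPos_mem_Ioo ho hk (by omega) (by omega) half_mem_Icc))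
  refine level_shows_singleton hσ hn ho hk (i := i) (by omega) (by omega) (Or.inr hbar) ?_
    ⟨hbar, ?_⟩
  · intro l h3 h4 h5
    rw [hT' l (h5.resolve_left (by simp [hfix l h3 h4])) h3 h4]
  · refine level_leftCount hσ (by omega) fun l => ?_
    have hx := levelPos_of_fixed (hfix i (by omega) (by omega)) (1 / 2)
    rcases block_cases o k l with h | h
    · have h3 := (levelPos_mem_Ioo ho hk h.1 h.2 half_mem_Icc).1
      simp only [h3, true_and, h.1]
      rw [levelPos_of_fixed (hfix l h.1 h.2), hx, ← hi]
      simp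
    · refine iff_of_false (fun h3 => ?_) (by omega)
      refine levelPos_notMem_Icc ho hk h half_mem_Icc ⟨h3.1.le, h3.2.le.trans ?_⟩
      exact (levelPos_mem_Ioo ho hk (by omega) (by omega) half_mem_Icc).2.le

end Cross

theorem level_agreeOff (hσ : IsLevel σ) (hτ : IsLevel τ) (ho : Cut σ o) (hk : Cut σ (o + k))
    (ho' : Cut τ o) (hk' : Cut τ (o + k))
    (h : ∀ l : Fin n, ((l : ℕ) < o ∨ o + k ≤ l) → σ l = τ l ∧ (l ∈ R ↔ l ∈ R') ∧ (l ∈ T ↔ l ∈ T')) :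
    AgreeOff ((o : ℝ) + 1 / 2) (o + k + 1 / 2) (level σ hσ R T) (level τ hτ R' T') := by
  have hpos : ∀ l : Fin n, ((l : ℕ) < o ∨ o + k ≤ l) → levelPos σ l = levelPos τ l := by
    intro l hl
    funext y
    rw [levelPos, levelPos, (h l hl).1]
  have hout : ∀ {σ : Equiv.Perm (Fin n)}, Cut σ o → Cut σ (o + k) → ∀ {P : ℝ × ℝ},
      P.1 ∉ Ioo ((o : ℝ) + 1 / 2) (o + k + 1 / 2) → ∀ l, P ∈ graphOf (levelPos σ l) →
        ((l : ℕ) < o ∨ o + k ≤ l) := by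
    intro σ ho hk P hP l hl
    refine (block_cases o k l).resolve_left fun h1 => hP ?_
    rw [hl.2]
    exact levelPos_mem_Ioo ho hk h1.1 h1.2 hl.1
  have hgr : ∀ {P : ℝ × ℝ}, P.1 ∉ Ioo ((o : ℝ) + 1 / 2) (o + k + 1 / 2) → ∀ l,
      P ∈ graphOf (levelPos σ l) ↔ P ∈ graphOf (levelPos τ l) := by
    intro P hP l
    constructor
    · intro hl
      rwa [← hpos l (hout ho hk hP l hl)]
    · intro hl
      rwa [hpos l (hout ho' hk' hP l hl)]
  have hcr : ∀ {P : ℝ × ℝ}, P.1 ∉ Ioo ((o : ℝ) + 1 / 2) (o + k + 1 / 2) →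
      (P ∈ crossingSet (levelPos σ) ↔ P ∈ crossingSet (levelPos τ)) := by
    intro P hP
    simp only [crossingSet, mem_ofPred_eq, hgr hP]
  refine ⟨fun i => ?_, fun P hP => ?_, fun P hP => ?_⟩
  · rcases block_cases o k i with h1 | h1
    · exact Or.inl fun y hy => ⟨levelPos_mem_Ioo ho hk h1.1 h1.2 hy,
        levelPos_mem_Ioo ho' hk' h1.1 h1.2 hy⟩
    · exact Or.inr fun y hy => ⟨congrFun (hpos i h1) y, levelPos_notMem_Icc ho hk h1 hy⟩
  · refine and_congr (hcr hP) (exists_congr fun l => ?_)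
    rw [hgr hP]
    exact and_congr_left fun hl => (h l (hout ho' hk' hP l hl)).2.1
  · refine and_congr (not_congr (hcr hP)) (and_congr_right fun _ => exists_congr fun l => ?_)
    rw [hgr hP]
    exact and_congr_left fun hl => (h l (hout ho' hk' hP l hl)).2.2

end Diagram

end TwistedVirtualTwin

namespace TwistedVirtualTwin

open Filter Topology

/-! ### Elementary diagrams -/

section Elementary

variable {n : ℕ}

/-- The permutation that a generator induces. -/
def Gen.perm : Gen n → Equiv.Perm (Fin n)
  | .s i h => Equiv.swap ⟨i, by omega⟩ ⟨i + 1, h⟩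
  | .rho i h => Equiv.swap ⟨i, by omega⟩ ⟨i + 1, h⟩
  | .gamma _ _ => 1

/-- The left strand of the real crossing, if the generator is one. -/
def Gen.reals : Gen n → Set (Fin n)
  | .s i h => {⟨i, by omega⟩}
  | .rho _ _ => ∅
  | .gamma _ _ => ∅

/-- The strand that carries the bar, if the generator is one. -/
def Gen.barred : Gen n → Set (Fin n)
  | .s _ _ => ∅
  | .rho _ _ => ∅
  | .gamma j h => {⟨j, h⟩}

theorem Gen.outside (g : Gen n) {l : Fin n} (h : (l : ℕ) < g.idx ∨ g.idx + g.kind.width ≤ l) :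
    g.perm l = l ∧ l ∉ g.reals ∧ l ∉ g.barred := by
  cases g <;> simp only [Gen.idx, Gen.kind, Kind.width] at h <;>
    refine ⟨?_, ?_, ?_⟩ <;>
    simp only [Gen.perm, Gen.reals, Gen.barred, mem_singleton_iff, mem_empty_iff_false,
      not_false_eq_true, Fin.ext_iff, Equiv.Perm.one_apply] <;>
    first
    | omega
    | rw [Equiv.swap_apply_of_ne_of_ne] <;> simp only [ne_eq, Fin.ext_iff] <;> omega

theorem Gen.perm_mul_self (g : Gen n) : g.perm * g.perm = 1 := by
  cases g <;> simp [Gen.perm]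

theorem Gen.cut_perm (g : Gen n) {m : ℕ} (h : m ≤ g.idx ∨ g.idx + g.kind.width ≤ m) :
    Diagram.Cut g.perm m := by
  have key : ∀ l : Fin n, (l : ℕ) < m → (g.perm l : ℕ) < m := by
    intro l hl
    by_contra hc
    by_cases hout : (l : ℕ) < g.idx ∨ g.idx + g.kind.width ≤ l
    · rw [(g.outside hout).1] at hc
      exact hc hl
    · have h2 : ¬((g.perm l : ℕ) < g.idx ∨ g.idx + g.kind.width ≤ (g.perm l : ℕ)) := by
        intro h3
        have h4 := (g.outside h3).1
        rw [← Equiv.Perm.mul_apply, g.perm_mul_self, Equiv.Perm.one_apply] at h4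
        rw [← h4] at h3
        exact hout h3
      omega
  refine fun l => ⟨key l, fun h' => ?_⟩
  have := key _ h'
  rwa [← Equiv.Perm.mul_apply, g.perm_mul_self, Equiv.Perm.one_apply] at this

theorem Gen.isLevel_perm (g : Gen n) : Diagram.IsLevel g.perm := by
  have key : ∀ (i : ℕ) (h : i + 1 < n),
      Diagram.IsLevel (Equiv.swap (⟨i, by omega⟩ : Fin n) ⟨i + 1, h⟩) := by
    intro i h a c hac hca
    simp only [Fin.lt_def, Equiv.swap_apply_def, Fin.ext_iff] at hac hca ⊢
    split_ifs at hca ⊢ <;> (try dsimp only at hca) <;> (try dsimp only) <;> omega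
  cases g with
  | s i h => exact key i h
  | rho i h => exact key i h
  | gamma j h => exact Diagram.isLevel_one

/-- The generator on `n` strands obtained by adding `o` strands on the left. -/
def Gen.shift (o : ℕ) {k : ℕ} (h : o + k ≤ n) : Gen k → Gen n
  | .s i hi => .s (o + i) (by omega)
  | .rho i hi => .rho (o + i) (by omega)
  | .gamma j hj => .gamma (o + j) (by omega)

theorem Gen.shift_idx {o k : ℕ} (h : o + k ≤ n) (g : Gen k) : (g.shift o h).idx = o + g.idx := by
  cases g <;> rfl

theorem Gen.shift_kind {o k : ℕ} (h : o + k ≤ n) (g : Gen k) : (g.shift o h).kind = g.kind := by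
  cases g <;> rfl

/-- A uniform access to R2, V2 and T2: every generator sits in a column of its own width, in which
its square can be cancelled. -/
theorem Gen.exists_shift (g : Gen n) : ∃ (h : g.idx + g.kind.width ≤ n) (g₀ : Gen g.kind.width),
    g₀.shift g.idx h = g ∧ Diagram.MovePicture g.kind.width [g₀, g₀] [] := by
  refine ⟨g.idx_lt, ?_⟩
  cases g with
  | s i h => exact ⟨.s 0 (by simp [Gen.kind, Kind.width]), rfl, .R2⟩
  | rho i h => exact ⟨.rho 0 (by simp [Gen.kind, Kind.width]), rfl, .V2⟩
  | gamma j h => exact ⟨.gamma 0 (by simp [Gen.kind, Kind.width]), rfl, .T2⟩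

namespace Diagram

/-- The diagram whose only event is the one that `g` names. -/
noncomputable def elem (g : Gen n) : Diagram n := level g.perm g.isLevel_perm g.reals g.barred

theorem cut_one (m : ℕ) : Cut (1 : Equiv.Perm (Fin n)) m := fun _ => Iff.rfl

section Column

variable {o k : ℕ}

theorem Gen.shift_cut (ho : o + k ≤ n) (g : Gen k) :
    Cut (g.shift o ho).perm o ∧ Cut (g.shift o ho).perm (o + k) := by
  have h := g.idx_lt
  constructor <;> refine Gen.cut_perm _ ?_ <;> rw [Gen.shift_idx, Gen.shift_kind] <;> omega

theorem elem_shows (ho : o + k ≤ n) (g : Gen k) :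
    (elem (g.shift o ho)).ShowsInBox (o + 1 / 2) (o + k + 1 / 2) 0 1 [g] := by
  obtain ⟨h1, h2⟩ := Gen.shift_cut ho g
  cases g with
  | s i hi =>
    refine level_shows_cross (i := ⟨o + i, by omega⟩) (j := ⟨o + i + 1, by omega⟩) _ ho h1 h2 rfl hi
      rfl (by simp [Gen.shift, Gen.perm]) (by simp [Gen.shift, Gen.perm]) ?_
      (Or.inl ⟨Or.inl (by simp [Gen.shift, Gen.reals]), rfl⟩)
    intro l _ _ h3 h4
    exact ⟨Equiv.swap_apply_of_ne_of_ne h3 h4, notMem_empty _⟩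
  | rho i hi =>
    refine level_shows_cross (i := ⟨o + i, by omega⟩) (j := ⟨o + i + 1, by omega⟩) _ ho h1 h2 rfl hi
      rfl (by simp [Gen.shift, Gen.perm]) (by simp [Gen.shift, Gen.perm]) ?_
      (Or.inr ⟨by simp [Gen.shift, Gen.reals], rfl⟩)
    intro l _ _ h3 h4
    exact ⟨Equiv.swap_apply_of_ne_of_ne h3 h4, notMem_empty _⟩
  | gamma j hj =>
    refine level_shows_bar (i := ⟨o + j, by omega⟩) _ ho h1 h2 rfl hj
      (by simp [Gen.shift, Gen.barred]) (fun l _ _ => rfl) ?_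
    intro l hl _ _
    simpa [Gen.shift, Gen.barred] using hl

theorem trivial_shows (ho : o + k ≤ n) :
    (trivial n).ShowsInBox (o + 1 / 2) (o + k + 1 / 2) 0 1 ([] : List (Gen k)) :=
  level_shows_nil _ ho (cut_one _) (cut_one _) fun _ _ _ => ⟨rfl, notMem_empty _⟩

theorem elem_agreeOff (ho : o + k ≤ n) (g : Gen k) :
    AgreeOff ((o : ℝ) + 1 / 2) (o + k + 1 / 2) (elem (g.shift o ho)) (trivial n) := by
  obtain ⟨h1, h2⟩ := Gen.shift_cut ho g
  refine level_agreeOff _ _ h1 h2 (cut_one _) (cut_one _) fun l hl => ?_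
  have h3 := g.idx_lt
  obtain ⟨h4, h5, h6⟩ := (g.shift o ho).outside (l := l) (by
    rw [Gen.shift_idx, Gen.shift_kind]
    omega)
  exact ⟨h4, by simp [h5], by simp [h6]⟩

/-- The agreement of a diagram with itself off a column that it does not meet, or that contains its
events. -/
theorem AgreeOff.refl_of {a c : ℝ} {b b' : Diagram n} (h : AgreeOff a c b b') : AgreeOff a c b b :=
  h.trans h.symm

theorem column_lt (o k : ℕ) (hk : 0 < k) : (o : ℝ) + 1 / 2 < o + k + 1 / 2 := by
  have : (0 : ℝ) < k := by exact_mod_cast hk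
  linarith

/-- A stack of elementary diagrams. -/
noncomputable def word (w : List (Gen n)) : Diagram n :=
  w.foldr (fun g d => (elem g).stack d) (trivial n)

theorem word_shows (ho : o + k ≤ n) (w : List (Gen k)) :
    (word (w.map (Gen.shift o ho))).ShowsInBox (o + 1 / 2) (o + k + 1 / 2) 0 1 w := by
  induction w with
  | nil => exact trivial_shows ho
  | cons g w ih => exact (elem_shows ho g).stack ih

theorem trivial_stack_agreeOff (ho : o + k ≤ n) :
    AgreeOff ((o : ℝ) + 1 / 2) (o + k + 1 / 2) ((trivial n).stack (trivial n)) (trivial n) := by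
  have hp : ∀ i, ∀ y ∈ Icc (0 : ℝ) 1,
      ((trivial n).stack (trivial n)).pos i y = (trivial n).pos i y := by
    intro i y hy
    rcases half_cases hy with ⟨z, hz, rfl⟩ | ⟨z, hz, rfl⟩
    · rw [stack_pos_upper _ _ _ hz.1, trivial_pos, trivial_pos]
    · rw [stack_pos_lower _ _ _ hz.2, trivial_pos, trivial_pos]
      rfl
  refine ⟨fun i => ?_, fun P hP => ?_, fun P hP => ?_⟩
  · rcases (trivial_shows ho).1 i with h | h
    · exact Or.inl fun y hy => ⟨by rw [hp i y hy]; exact h y hy, h y hy⟩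
    · exact Or.inr fun y hy => ⟨hp i y hy, by rw [hp i y hy]; exact h y hy⟩
  · rw [stack_real, trivial_real]
    simp
  · rw [stack_bars, trivial_bars]
    simp

theorem word_agreeOff (ho : o + k ≤ n) (w : List (Gen k)) :
    AgreeOff ((o : ℝ) + 1 / 2) (o + k + 1 / 2) (word (w.map (Gen.shift o ho))) (trivial n) := by
  induction w with
  | nil => exact (trivial_stack_agreeOff ho).symm.refl_of
  | cons g w ih => exact ((elem_agreeOff ho g).stack ih).trans (trivial_stack_agreeOff ho)

theorem swap_braid {α : Type*} [DecidableEq α] {x y z : α} (hxy : x ≠ y) (hxz : x ≠ z)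
    (hyz : y ≠ z) : Equiv.swap x y * (Equiv.swap y z * Equiv.swap x y) =
      Equiv.swap y z * (Equiv.swap x y * Equiv.swap y z) := by
  rw [← mul_assoc, ← mul_assoc, Equiv.swap_mul_swap_mul_swap hxy hxz, Equiv.swap_comm x y,
    Equiv.swap_comm y z, Equiv.swap_mul_swap_mul_swap hyz.symm hxz.symm, Equiv.swap_comm]

theorem word_perm (w : List (Gen n)) : (word w).perm = ((w.map Gen.perm).reverse).prod := by
  induction w with
  | nil => rfl
  | cons g w ih =>
    rw [List.map_cons, List.reverse_cons, List.prod_append, List.prod_singleton, ← ih]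
    rfl

theorem MovePicture.perm_eq {w w' : List (Gen k)} (h : MovePicture k w w') (ho : o + k ≤ n) :
    (word (w.map (Gen.shift o ho))).perm = (word (w'.map (Gen.shift o ho))).perm := by
  rw [word_perm, word_perm]
  cases h <;>
    simp only [List.map_cons, List.map_nil, List.reverse_cons, List.reverse_nil, List.nil_append,
      List.cons_append, List.prod_cons, List.prod_nil, mul_one, one_mul, Gen.shift, Gen.perm,
      Equiv.swap_mul_self, add_zero]
  -- Real and virtual crossings induce the same transpositions, so V3 and all versions of V4 reduce
  -- to the braid relation; the remaining moves only need squares.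
  all_goals exact swap_braid (by simp) (by simp [add_assoc]) (by simp)

end Column

end Diagram

/-! ### Relations between elementary twins. -/

/-- The twin that an elementary diagram represents. -/
noncomputable def Twin.of (g : Gen n) : Twin n := Twin.mk (Diagram.elem g)

theorem Twin.mk_word (w : List (Gen n)) : Twin.mk (Diagram.word w) = (w.map Twin.of).prod := by
  induction w with
  | nil => rfl
  | cons g w ih =>
    rw [List.map_cons, List.prod_cons, ← ih]
    rfl

theorem Diagram.MovePicture.pos {k : ℕ} {w w' : List (Gen k)} (h : MovePicture k w w') : 0 < k := by
  cases h <;> norm_num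

/-- Both words are realised as stacks that differ only in one column and have the same permutation,
so a single local move with the full column as its box relates them. -/
theorem Twin.prod_eq_of_movePicture {k : ℕ} {w w' : List (Gen k)}
    (h : Diagram.MovePicture k w w') {o : ℕ} (ho : o + k ≤ n) :
    ((w.map (Gen.shift o ho)).map Twin.of).prod =
      ((w'.map (Gen.shift o ho)).map Twin.of).prod := by
  rw [← Twin.mk_word, ← Twin.mk_word]
  exact Twin.mk_eq_of_localMove (.of_agreeOff (Diagram.column_lt o k h.pos) h
    (Diagram.word_shows ho w) (Diagram.word_shows ho w')
    ((Diagram.word_agreeOff ho w).trans (Diagram.word_agreeOff ho w').symm) (h.perm_eq ho))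

theorem Twin.of_mul_self (g : Gen n) : Twin.of g * Twin.of g = 1 := by
  obtain ⟨h, g₀, hg, hm⟩ := g.exists_shift
  simpa [hg] using Twin.prod_eq_of_movePicture hm h

/-- In the stack `g g' g` the column of `g` shows its generator twice and nothing of `g'`. One
cancelling move there gives `g g' g = g'`, and since `g` is an involution this is commutation. -/
theorem Twin.of_mul_of_comm {g g' : Gen n}
    (h : g'.idx + g'.kind.width ≤ g.idx ∨ g.idx + g.kind.width ≤ g'.idx) :
    Twin.of g * Twin.of g' = Twin.of g' * Twin.of g := by
  obtain ⟨ho, g₀, hg, hm⟩ := g.exists_shift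
  have hc1 : Diagram.Cut g'.perm g.idx := g'.cut_perm (by omega)
  have hc2 : Diagram.Cut g'.perm (g.idx + g.kind.width) := g'.cut_perm (by omega)
  have h1 := Diagram.elem_shows ho g₀
  have h2 := Diagram.elem_agreeOff ho g₀
  rw [hg] at h1 h2
  have h3 := Diagram.trivial_shows ho
  have h4 : (Diagram.elem g').ShowsInBox (g.idx + 1 / 2) (g.idx + g.kind.width + 1 / 2) 0 1
      ([] : List (Gen g.kind.width)) := by
    refine Diagram.level_shows_nil _ ho hc1 hc2 fun l hl hl' => ?_
    obtain ⟨h5, -, h6⟩ := g'.outside (l := l) (by omega)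
    exact ⟨h5, h6⟩
  have h5 : Diagram.AgreeOff ((g.idx : ℝ) + 1 / 2) (g.idx + g.kind.width + 1 / 2)
      (Diagram.elem g') (Diagram.elem g') :=
    Diagram.level_agreeOff _ _ hc1 hc2 hc1 hc2 fun l _ => ⟨rfl, Iff.rfl, Iff.rfl⟩
  have hd : Equiv.Perm.Disjoint g.perm g'.perm := by
    intro l
    by_cases hl : (l : ℕ) < g.idx ∨ g.idx + g.kind.width ≤ l
    · exact Or.inl (g.outside hl).1
    · exact Or.inr (g'.outside (by omega)).1
  have hp : ((Diagram.elem g).stack ((Diagram.elem g').stack (Diagram.elem g))).perm =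
      ((Diagram.trivial n).stack ((Diagram.elem g').stack (Diagram.trivial n))).perm := by
    change g.perm * g'.perm * g.perm = 1 * g'.perm * 1
    rw [hd.commute.eq, mul_assoc, g.perm_mul_self, one_mul]
  have h6 := Twin.mk_eq_of_localMove (.of_agreeOff (Diagram.column_lt _ _ hm.pos) hm
    (h1.stack (h4.stack h1)) (h3.stack (h4.stack h3)) (h2.stack (h5.stack h2)) hp)
  have h7 : Twin.of g * (Twin.of g' * Twin.of g) = 1 * (Twin.of g' * 1) := h6
  rw [one_mul, mul_one] at h7
  calc Twin.of g * Twin.of g' = Twin.of g * (Twin.of g' * Twin.of g) * Twin.of g := by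
        rw [mul_assoc, mul_assoc, Twin.of_mul_self, mul_one]
    _ = _ := by rw [h7]

end Elementary

end TwistedVirtualTwin

namespace TwistedVirtualTwin

open Filter Topology

namespace Diagram

variable {n : ℕ} {σ : Equiv.Perm (Fin n)}

/-! ### Level diagrams are products of elementary ones -/

/-- Events of a diagram that one column shows as a single generator can be moved below the
diagram. -/
theorem mk_eq_mul_of_of_shows {b b' : Diagram n} {o k : ℕ} (ho : o + k ≤ n) {g₀ : Gen k}
    (hm : MovePicture k [g₀, g₀] []) (h : b.ShowsInBox (o + 1 / 2) (o + k + 1 / 2) 0 1 [g₀])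
    (h' : b'.ShowsInBox (o + 1 / 2) (o + k + 1 / 2) 0 1 ([] : List (Gen k)))
    (hoff : AgreeOff ((o : ℝ) + 1 / 2) (o + k + 1 / 2) b b')
    (hp : b'.perm = (g₀.shift o ho).perm * b.perm) :
    Twin.mk b = Twin.mk b' * Twin.of (g₀.shift o ho) := by
  -- A further copy of the generator is placed below `b`. The column then shows it twice, so both
  -- copies cancel and `b'` remains.
  have h1 := Twin.mk_eq_of_localMove (.of_agreeOff (column_lt o k hm.pos) hm
    (h.stack (elem_shows ho g₀)) (h'.stack (trivial_shows ho)) (hoff.stack (elem_agreeOff ho g₀))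
    hp.symm)
  have h2 : Twin.mk b * Twin.of (g₀.shift o ho) = Twin.mk b' * 1 := h1
  rw [mul_one] at h2
  rw [← h2, mul_assoc, Twin.of_mul_self, mul_one]

/-- Any other strand passing this line would be inverted with `i` or `j` without being its
neighbour. -/
theorem IsLevel.cut_left (hσ : IsLevel σ) {i j : Fin n} (hij : i < j) (h1 : σ i = j) (h2 : σ j = i) :
    Cut σ i := by
  have hadj := (hσ i j hij (by rwa [h1, h2])).1
  intro l
  rw [← Fin.lt_def, ← Fin.lt_def]
  constructor
  · intro hl
    by_contra hc
    have h3 : σ j < σ l := lt_of_le_of_ne (h2 ▸ not_lt.mp hc)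
      (σ.injective.ne (hl.trans hij).ne')
    have := (hσ l j (hl.trans hij) h3).1
    rw [Fin.lt_def] at hl
    omega
  · intro hl
    by_contra hc
    rcases (not_lt.mp hc).eq_or_lt with rfl | h3
    · exact (hl.trans hij).ne h1
    · have h4 := (hσ i l h3 (by rw [h1]; exact hl.trans hij)).1
      have : l = j := Fin.ext (by omega)
      subst this
      exact hl.ne h2

/-- The positions below `i + 2` are those below `i` together with `i` and `j`, which `σ` exchanges.
-/
theorem IsLevel.cut_right (hσ : IsLevel σ) {i j : Fin n} (hij : i < j) (h1 : σ i = j)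
    (h2 : σ j = i) : Cut σ (i + 2) := by
  have hadj := (hσ i j hij (by rwa [h1, h2])).1
  have hc := hσ.cut_left hij h1 h2
  have key : ∀ l : Fin n, (l : ℕ) < i + 2 ↔ (l : ℕ) < i ∨ l = i ∨ l = j := by
    intro l
    rw [Fin.ext_iff, Fin.ext_iff]
    omega
  intro l
  rw [key, key, ← hc, ← σ.injective.eq_iff (a := l) (b := i),
    ← σ.injective.eq_iff (a := l) (b := j), h1, h2]
  tauto

section Smooth

variable {i j : Fin n}

theorem swap_mul_apply_of_ne (h1 : σ i = j) (h2 : σ j = i) {l : Fin n} (hi : l ≠ i) (hj : l ≠ j) :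
    (Equiv.swap i j * σ) l = σ l :=
  Equiv.swap_apply_of_ne_of_ne (h2 ▸ σ.injective.ne hj) (h1 ▸ σ.injective.ne hi)

/-- The cuts on both sides separate `i`, `j` from all other strands, so uncrossing them creates no
inversion with a third strand. -/
theorem IsLevel.swap_mul (hσ : IsLevel σ) (hij : i < j) (h1 : σ i = j) (h2 : σ j = i) :
    IsLevel (Equiv.swap i j * σ) := by
  have hadj := (hσ i j hij (by rwa [h1, h2])).1
  have hi : (Equiv.swap i j * σ) i = i := by simp [h1]
  have hj : (Equiv.swap i j * σ) j = j := by simp [h2]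
  have hc := hσ.cut_left hij h1 h2
  have hc' := hσ.cut_right hij h1 h2
  have hin : ∀ l : Fin n, l ≠ i → l ≠ j → (l : ℕ) < i ∨ (i : ℕ) + 2 ≤ l := by
    intro l h3 h4
    have h5 : (l : ℕ) ≠ i := fun h => h3 (Fin.ext h)
    have h6 : (l : ℕ) ≠ j := fun h => h4 (Fin.ext h)
    omega
  intro a c hac hca
  have hac' : (a : ℕ) < c := hac
  by_cases ha : a = i ∨ a = j
  · have ha' : ((Equiv.swap i j * σ) a : ℕ) = a ∧ ((a : ℕ) = i ∨ (a : ℕ) = i + 1) := by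
      rcases ha with rfl | rfl
      · exact ⟨by rw [hi], Or.inl rfl⟩
      · exact ⟨by rw [hj], Or.inr hadj⟩
    by_cases hcc : c = i ∨ c = j
    · have : ((Equiv.swap i j * σ) c : ℕ) = c := by
        rcases hcc with rfl | rfl
        · rw [hi]
        · rw [hj]
      rw [Fin.lt_def] at hca
      omega
    · push Not at hcc
      have h3 := hin c hcc.1 hcc.2
      have h4 := hc' c
      rw [Fin.lt_def, swap_mul_apply_of_ne h1 h2 hcc.1 hcc.2] at hca
      omega
  · push Not at ha
    have h3 := hin a ha.1 ha.2
    have h4 := hc a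
    rw [Fin.lt_def, swap_mul_apply_of_ne h1 h2 ha.1 ha.2] at hca
    rw [swap_mul_apply_of_ne h1 h2 ha.1 ha.2]
    by_cases hcc : c = i ∨ c = j
    · have : ((Equiv.swap i j * σ) c : ℕ) = c ∧ ((c : ℕ) = i ∨ (c : ℕ) = i + 1) := by
        rcases hcc with rfl | rfl
        · exact ⟨by rw [hi], Or.inl rfl⟩
        · exact ⟨by rw [hj], Or.inr hadj⟩
      omega
    · push Not at hcc
      rw [swap_mul_apply_of_ne h1 h2 hcc.1 hcc.2] at hca ⊢
      exact hσ a c hac hca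

theorem Cut.swap_mul {m : ℕ} (h : Cut σ m) (hij : (i : ℕ) < m ↔ (j : ℕ) < m) :
    Cut (Equiv.swap i j * σ) m := by
  intro l
  rw [h, Equiv.Perm.mul_apply, Equiv.swap_apply_def]
  split_ifs with h1 h2
  · rw [h1, hij]
  · rw [h2, hij]
  · rfl

/-- The crossing of `i` and `j` is pushed below the diagram. The strands `i`, `j` are removed from
`T`: membership had no effect while they crossed, but it would create bars once they are uncrossed.
-/
theorem mk_level_cross (hσ : IsLevel σ) (hij : i < j) (h1 : σ i = j) (h2 : σ j = i)
    (R T : Set (Fin n)) : ∃ g : Gen n, Twin.mk (level σ hσ R T) =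
      Twin.mk (level _ (hσ.swap_mul hij h1 h2) R (T \ {i, j})) * Twin.of g := by
  have hadj := (hσ i j hij (by rwa [h1, h2])).1
  have ho : (i : ℕ) + 2 ≤ n := by omega
  have hc := hσ.cut_left hij h1 h2
  have hc' := hσ.cut_right hij h1 h2
  have hc2 : Cut (Equiv.swap i j * σ) i := hc.swap_mul (by omega)
  have hc2' : Cut (Equiv.swap i j * σ) (i + 2) := hc'.swap_mul (by omega)
  have hin : ∀ l : Fin n, (i : ℕ) ≤ l → (l : ℕ) < i + 2 → l = i ∨ l = j := by
    intro l h3 h4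
    rw [Fin.ext_iff, Fin.ext_iff]
    omega
  have hoff : AgreeOff (((i : ℕ) : ℝ) + 1 / 2) ((i : ℕ) + (2 : ℕ) + 1 / 2) (level σ hσ R T)
      (level _ (hσ.swap_mul hij h1 h2) R (T \ {i, j})) := by
    refine level_agreeOff _ _ hc hc' hc2 hc2' fun l hl => ?_
    have h3 : l ≠ i := by
      rintro rfl
      omega
    have h4 : l ≠ j := by
      rintro rfl
      omega
    exact ⟨(swap_mul_apply_of_ne h1 h2 h3 h4).symm, Iff.rfl, by simp [h3, h4]⟩
  have hnil : (level _ (hσ.swap_mul hij h1 h2) R (T \ {i, j})).ShowsInBox ((i : ℕ) + 1 / 2)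
      ((i : ℕ) + (2 : ℕ) + 1 / 2) 0 1 ([] : List (Gen 2)) := by
    refine level_shows_nil _ ho hc2 hc2' fun l h3 h4 => ?_
    rcases hin l h3 h4 with rfl | rfl
    · simp [h1]
    · simp [h2]
  have hfix : ∀ l : Fin n, (i : ℕ) ≤ l → (l : ℕ) < i + 2 → l ≠ i → l ≠ j → σ l = l ∧ l ∉ T :=
    fun l h3 h4 h5 h6 => absurd (hin l h3 h4) (by simp [h5, h6])
  have hsw : Equiv.swap i j = Equiv.swap (⟨i + 0, by omega⟩ : Fin n) ⟨i + 0 + 1, by omega⟩ := by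
    congr 1
    exact Fin.ext hadj
  by_cases hR : i ∈ R ∨ j ∈ R
  · exact ⟨_, mk_eq_mul_of_of_shows ho .R2 (level_shows_cross hσ ho hc hc' rfl (by norm_num) hadj
      h1 h2 hfix (Or.inl ⟨hR, rfl⟩)) hnil hoff (congrArg (· * σ) hsw)⟩
  · exact ⟨_, mk_eq_mul_of_of_shows ho .V2 (level_shows_cross hσ ho hc hc' rfl (by norm_num) hadj
      h1 h2 hfix (Or.inr ⟨hR, rfl⟩)) hnil hoff (congrArg (· * σ) hsw)⟩

theorem mk_level_bar {T : Set (Fin n)} (hi : i ∉ T) (R : Set (Fin n)) :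
    ∃ g : Gen n, Twin.mk (level 1 isLevel_one R (insert i T)) =
      Twin.mk (level 1 isLevel_one R T) * Twin.of g := by
  have ho : (i : ℕ) + 1 ≤ n := by omega
  have hin : ∀ l : Fin n, (i : ℕ) ≤ l → (l : ℕ) < i + 1 → l = i := fun l h3 h4 =>
    Fin.ext (by omega)
  have h1 : (level 1 isLevel_one R (insert i T)).ShowsInBox ((i : ℕ) + 1 / 2)
      ((i : ℕ) + (1 : ℕ) + 1 / 2) 0 1 [Gen.gamma 0 one_pos] :=
    level_shows_bar isLevel_one ho (cut_one _) (cut_one _) rfl one_pos (mem_insert i T)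
      (fun _ _ _ => rfl) fun l _ h3 h4 => hin l h3 h4
  have h2 : (level 1 isLevel_one R T).ShowsInBox ((i : ℕ) + 1 / 2)
      ((i : ℕ) + (1 : ℕ) + 1 / 2) 0 1 ([] : List (Gen 1)) :=
    level_shows_nil isLevel_one ho (cut_one _) (cut_one _) fun l h3 h4 => ⟨rfl, hin l h3 h4 ▸ hi⟩
  have h3 : AgreeOff (((i : ℕ) : ℝ) + 1 / 2) ((i : ℕ) + (1 : ℕ) + 1 / 2)
      (level 1 isLevel_one R (insert i T)) (level 1 isLevel_one R T) := by
    refine level_agreeOff isLevel_one isLevel_one (cut_one _) (cut_one _) (cut_one _) (cut_one _)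
      fun l hl => ⟨rfl, Iff.rfl, ?_⟩
    have : l ≠ i := by
      rintro rfl
      omega
    simp [this]
  exact ⟨_, mk_eq_mul_of_of_shows ho .T2 h1 h2 h3 (mul_one (1 : Equiv.Perm (Fin n))).symm⟩

end Smooth

/-- The products of elementary twins. -/
noncomputable def generated (n : ℕ) : Submonoid (Twin n) := Submonoid.closure (range Twin.of)

theorem of_mem_generated (g : Gen n) : Twin.of g ∈ generated n :=
  Submonoid.subset_closure (mem_range_self g)

theorem mk_level_one_mem (R T : Set (Fin n)) :
    Twin.mk (level 1 isLevel_one R T) ∈ generated n := by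
  induction T, T.toFinite using Set.Finite.induction_on with
  | empty =>
    -- Without crossings the set `R` has no effect.
    have h : Twin.mk (level 1 isLevel_one R ∅) = Twin.mk (trivial n) := by
      refine Twin.mk_eq_of_isotopic (SamePattern.isotopic ⟨fun _ _ _ _ => Iff.rfl,
        fun y hy i => iff_of_false ?_ ?_, fun _ _ _ => Iff.rfl⟩)
      · intro h
        obtain ⟨i, j, hij, h1, -⟩ := isLevel_one.crossing h.1
        exact hij.ne h1
      · rw [trivial_real]
        exact notMem_empty _
    rw [h]
    exact Submonoid.one_mem _
  | insert hi _ ih =>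
    obtain ⟨g, hg⟩ := mk_level_bar hi R
    rw [hg]
    exact Submonoid.mul_mem _ ih (of_mem_generated _)

theorem exists_inversion (hσ : σ ≠ 1) : ∃ i j, i < j ∧ σ j < σ i := by
  by_contra hc
  push Not at hc
  have h1 : StrictMono σ := fun i j hij => lt_of_le_of_ne (hc i j hij) (σ.injective.ne hij.ne)
  exact hσ (Equiv.ext fun i => congrFun h1.eq_id i)

/-- Induction on the number of strands that `σ` moves: uncrossing a pair makes both of its strands
fixed. -/
theorem mk_level_mem (hσ : IsLevel σ) (R T : Set (Fin n)) :
    Twin.mk (level σ hσ R T) ∈ generated n := by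
  induction hN : σ.support.card using Nat.strong_induction_on generalizing σ T with
  | _ N ih =>
    by_cases h1 : σ = 1
    · subst h1
      exact mk_level_one_mem R T
    · obtain ⟨i, j, hij, h⟩ := exists_inversion h1
      obtain ⟨h2, h3⟩ := hσ.swap hij h
      obtain ⟨g, hg⟩ := mk_level_cross hσ hij h2 h3 R T
      rw [hg]
      refine Submonoid.mul_mem _ (ih _ ?_ _ _ rfl) (of_mem_generated g)
      have := Equiv.Perm.card_support_swap_mul (f := σ) (x := i) (h2 ▸ hij.ne')
      rwa [h2, hN] at this

end Diagram

end TwistedVirtualTwin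

namespace TwistedVirtualTwin

open Filter Topology

namespace Diagram

variable {n : ℕ} {b b' : Diagram n}

/-! ### Cutting a diagram into slices -/

theorem exists_of_mem_heights {y : ℝ} (h : y ∈ b.heights) :
    (∃ i j, i ≠ j ∧ b.pos i y = b.pos j y) ∨ ∃ i, b.pt i y ∈ b.bars := by
  obtain ⟨P, hP | hP, rfl⟩ := h
  · obtain ⟨i, j, hij, hi, hj⟩ := hP
    exact Or.inl ⟨i, j, hij, hi.2.symm.trans hj.2⟩
  · obtain ⟨-, i, hi⟩ := b.bars_strand P hP
    exact Or.inr ⟨i, by rwa [← b.eq_pt_of_mem hi]⟩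

theorem mem_heights_of_transport {e : Equiv.Perm (Fin n)} {φ : ℝ → ℝ} {pos' : Fin n → ℝ → ℝ}
    {π : Equiv.Perm (Fin n)} (h : IsTransport b e φ pos' π) {y : ℝ}
    (hy : y ∈ (b.transport e φ pos' π h).heights) : φ y ∈ b.heights := by
  have hI := Ioo_subset_Icc_self (heights_subset _ hy)
  rcases exists_of_mem_heights hy with ⟨i, j, hij, he⟩ | ⟨i, hi⟩
  · exact mem_heights_of_pos_eq (e.injective.ne hij) (h.maps y hI) ((h.eq_iff y hI i j).mp he)
  · exact mem_heights_of_bars ((transport_bars_iff h hI).mp hi)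

/-- The order of the strands at a height without crossings. -/
theorem exists_rank {y : ℝ} (hy : y ∈ Icc (0 : ℝ) 1) (h : y ∉ b.heights) :
    ∃ r : Equiv.Perm (Fin n), ∀ i j, b.pos i y < b.pos j y ↔ r i < r j := by
  have hinj : Function.Injective fun i => b.pos i y := fun i j hij => by
    by_contra hne
    exact h (mem_heights_of_pos_eq hne hy hij)
  have hm : StrictMono ((fun i => b.pos i y) ∘ Tuple.sort fun i => b.pos i y) :=
    (Tuple.monotone_sort _).strictMono_of_injective (hinj.comp (Equiv.injective _))
  refine ⟨(Tuple.sort fun i => b.pos i y).symm, fun i j => ?_⟩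
  rw [← hm.lt_iff_lt]
  simp

theorem exists_gap {y : ℝ} (h : y ∉ b.heights) :
    ∃ δ > 0, ∀ z ∈ b.heights, δ < dist z y := by
  obtain ⟨δ, h1, h2⟩ := Metric.isOpen_iff.mp b.finite_heights.isClosed.isOpen_compl y h
  refine ⟨δ / 2, by linarith, fun z hz => ?_⟩
  by_contra hc
  exact h2 (Metric.mem_ball.mpr (by linarith)) hz

/-- A diagram without events at the height `1 / 2` has the pattern of one whose strands are at the
standard positions there. -/
theorem exists_straight (h : 1 / 2 ∉ b.heights) : ∃ (b' : Diagram n) (r : Equiv.Perm (Fin n)),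
    SamePattern b b' ∧ b'.heights ⊆ b.heights ∧
      ∀ i, b'.pos i (1 / 2) = ((r i : ℕ) : ℝ) + 1 := by
  obtain ⟨r, hr⟩ := exists_rank half_mem_Icc h
  obtain ⟨δ₀, h1, h2⟩ := exists_gap h
  set δ := min δ₀ (1 / 4) with hδ
  have hδ0 : 0 < δ := lt_min h1 (by norm_num)
  have hδ1 : δ ≤ 1 / 4 := min_le_right _ _
  have hgap : ∀ z ∈ b.heights, δ < dist z (1 / 2) := fun z hz => (min_le_left _ _).trans_lt (h2 z hz)
  -- Near height `1 / 2` the strands are mixed with the standard positions by a bump function. It is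
  -- `1` at `1 / 2` and vanishes at distance `δ`, before any event is reached; `δ ≤ 1 / 4` keeps the
  -- endpoints unchanged.
  let χ : ContDiffBump (1 / 2 : ℝ) := ⟨δ / 2, δ, by linarith, by linarith⟩
  have hχ0 : ∀ y, δ ≤ dist y (1 / 2) → χ y = 0 := fun y hy => χ.zero_of_le_dist hy
  have hχ1 : χ (1 / 2) = 1 := χ.one_of_mem_closedBall (Metric.mem_closedBall_self (by
    change 0 ≤ δ / 2
    linarith))
  have hend0 : χ 0 = 0 := hχ0 _ (by rw [Real.dist_eq]; norm_num; linarith)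
  have hend1 : χ 1 = 0 := hχ0 _ (by rw [Real.dist_eq]; norm_num; linarith)
  let pos' : Fin n → ℝ → ℝ := fun i y => (1 - χ y) * b.pos i y + χ y * (((r i : ℕ) : ℝ) + 1)
  have hnear : ∀ y, dist y (1 / 2) < δ → ∀ i j,
      b.pos i y < b.pos j y ↔ ((r i : ℕ) : ℝ) + 1 < ((r j : ℕ) : ℝ) + 1 := by
    intro y hy i j
    have hr' : b.pos i (1 / 2) < b.pos j (1 / 2) ↔
        ((r i : ℕ) : ℝ) + 1 < ((r j : ℕ) : ℝ) + 1 := by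
      rw [hr]
      simp
    rw [Real.dist_eq, abs_lt] at hy
    rw [← hr']
    rcases le_total y (1 / 2) with h | h
    · refine pos_lt_iff_of_heights (by linarith) h (by norm_num) (fun z hz hz' => ?_) i j
      have := hgap z hz'
      rw [Real.dist_eq, lt_abs] at this
      rcases this with h' | h' <;> linarith [hz.1, hz.2]
    · refine (pos_lt_iff_of_heights (by norm_num) h (by linarith) (fun z hz hz' => ?_) i j).symm
      have := hgap z hz'
      rw [Real.dist_eq, lt_abs] at this
      rcases this with h' | h' <;> linarith [hz.1, hz.2]
  have hlt : ∀ y, ∀ i j, pos' i y < pos' j y ↔ b.pos i y < b.pos j y := by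
    intro y i j
    rcases lt_or_ge (dist y (1 / 2)) δ with h | h
    · exact convex_lt_iff (hnear y h i j) (hnear y h j i) χ.nonneg χ.le_one
    · simp only [pos', hχ0 y h]
      simp
  have htr : IsTransport b 1 id pos' b.perm := by
    refine ⟨fun i => ?_, fun i => ?_, fun i => ?_, fun y hy => hy, Function.injective_id,
      fun y _ i j => eq_iff_of_lt_iff (hlt y i j) (hlt y j i), fun i j hij y hy he => ?_,
      pt_zero_notMem_bars, pt_one_notMem_bars⟩
    · exact ((PiecewiseSmooth.of_contDiff (contDiff_const.sub χ.contDiff)).mul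
        (b.piecewiseSmooth i)).add (.of_contDiff (χ.contDiff.mul contDiff_const))
    · simp only [pos', hend1, b.top]
      ring
    · simp only [pos', hend0, b.bottom]
      ring
    -- Crossings are farther than `δ` from `1 / 2`, so near each of them the new strands equal the
    -- old ones.
    · have he' := (eq_iff_of_lt_iff (hlt y i j) (hlt y j i)).mp he
      have hd := hgap y (mem_heights_of_pos_eq hij hy he')
      have hev : ∀ᶠ z in 𝓝 y, χ z = 0 := by
        have hc : Continuous fun z : ℝ => dist z (1 / 2) := continuous_id.dist continuous_const
        filter_upwards [hc.continuousAt.eventually (lt_mem_nhds hd)] with z hz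
        exact hχ0 z hz.le
      refine (b.transverse i j hij y hy he').congr ?_ ?_ <;>
      · filter_upwards [hev] with z hz
        simp [pos', hz]
  refine ⟨b.transport 1 id pos' b.perm htr, r, ⟨fun y _ i j => (hlt y i j).symm,
    fun y hy i => (transport_real_iff htr hy).symm, fun y hy i => (transport_bars_iff htr hy).symm⟩,
    fun y hy => mem_heights_of_transport htr hy, fun i => ?_⟩
  change pos' i (1 / 2) = _
  simp only [pos', hχ1]
  ring

theorem crossTransversally_comp_affine {f g : ℝ → ℝ} {y c d : ℝ} (hc : 0 < c)
    (h : CrossTransversally f g (c * y + d)) :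
    CrossTransversally (fun z => f (c * z + d)) (fun z => g (c * z + d)) y := by
  have hd : HasDerivAt (fun z : ℝ => c * z + d) c y := by
    simpa using ((hasDerivAt_id y).const_mul c).add_const d
  refine CrossTransversally.comp (φ := fun z => c * z + d) h (fun u v huv => ?_)
    hd.hasDerivWithinAt hd.hasDerivWithinAt hc hc
  have := mul_le_mul_of_nonneg_left huv hc.le
  simp only
  linarith

theorem piecewiseSmooth_comp_affine {f : ℝ → ℝ} {c d : ℝ} (hf : PiecewiseSmooth f) (hc : 0 < c)
    (hm : ∀ y ∈ Icc (0 : ℝ) 1, c * y + d ∈ Icc (0 : ℝ) 1) :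
    PiecewiseSmooth fun y => f (c * y + d) := by
  refine hf.comp (.of_contDiff (by fun_prop)) (fun u v huv => ?_) hm
  have := mul_lt_mul_of_pos_left huv hc
  linarith

/-- A diagram whose strands are at the standard positions at the height `1 / 2` is a stack. -/
theorem exists_stack_of_straight {r : Equiv.Perm (Fin n)} (hno : 1 / 2 ∉ b.heights)
    (h : ∀ i, b.pos i (1 / 2) = ((r i : ℕ) : ℝ) + 1) :
    ∃ u l : Diagram n, SamePattern b (u.stack l) ∧
      (∀ y ∈ u.heights, 1 / 2 * y + 1 / 2 ∈ b.heights) ∧ ∀ y ∈ l.heights, 1 / 2 * y + 0 ∈ b.heights := by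
  have hm1 : ∀ y ∈ Icc (0 : ℝ) 1, 1 / 2 * y + 1 / 2 ∈ Icc (0 : ℝ) 1 := fun y hy =>
    ⟨by linarith [hy.1], by linarith [hy.2]⟩
  have hm2 : ∀ y ∈ Icc (0 : ℝ) 1, 1 / 2 * y + 0 ∈ Icc (0 : ℝ) 1 := fun y hy =>
    ⟨by linarith [hy.1], by linarith [hy.2]⟩
  have hi : ∀ d : ℝ, Function.Injective fun y : ℝ => 1 / 2 * y + d := fun d y z hyz => by
    simp only at hyz
    linarith
  have hu : IsTransport b 1 (fun y => 1 / 2 * y + 1 / 2) (fun i y => b.pos i (1 / 2 * y + 1 / 2)) r := by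
    refine ⟨fun i => piecewiseSmooth_comp_affine (b.piecewiseSmooth i) (by norm_num) hm1, fun i => ?_,
      fun i => ?_, hm1, hi _, fun y _ i j => Iff.rfl, fun i j hij y hy he =>
        crossTransversally_comp_affine (by norm_num) (b.transverse i j hij _ (hm1 y hy) he),
      fun i => ?_, fun i => ?_⟩
    · norm_num [b.top]
    · rw [mul_zero, zero_add, h]
    · rw [mul_zero, zero_add]
      exact fun h => hno (mem_heights_of_bars h)
    · rw [mul_one, add_halves]
      exact pt_one_notMem_bars i
  -- The lower diagram names its strands by their positions at the cut, hence the reindexing by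
  -- `r.symm`.
  have hl : IsTransport b r.symm (fun y => 1 / 2 * y + 0)
      (fun i y => b.pos (r.symm i) (1 / 2 * y + 0)) (r.symm.trans b.perm) := by
    refine ⟨fun i => piecewiseSmooth_comp_affine (b.piecewiseSmooth _) (by norm_num) hm2, fun i => ?_,
      fun i => ?_, hm2, hi _, fun y _ i j => Iff.rfl, fun i j hij y hy he =>
        crossTransversally_comp_affine (by norm_num)
          (b.transverse _ _ (r.symm.injective.ne hij) _ (hm2 y hy) he), fun i => ?_, fun i => ?_⟩
    · rw [mul_one, add_zero, h, r.apply_symm_apply]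
    · rw [mul_zero, zero_add, b.bottom]
      rfl
    · rw [mul_zero, zero_add]
      exact pt_zero_notMem_bars _
    · rw [mul_one, add_zero]
      exact fun h => hno (mem_heights_of_bars h)
  refine ⟨b.transport _ _ _ _ hu, b.transport _ _ _ _ hl, ?_,
    fun y hy => mem_heights_of_transport hu hy, fun y hy => mem_heights_of_transport hl hy⟩
  have hpos : ∀ y ∈ Icc (0 : ℝ) 1, ∀ i, ((b.transport _ _ _ _ hu).stack
      (b.transport _ _ _ _ hl)).pos i y = b.pos i y := by
    intro y hy i
    rcases half_cases hy with ⟨z, hz, rfl⟩ | ⟨z, hz, rfl⟩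
    · rw [stack_pos_upper _ _ _ hz.1]
      change b.pos i (1 / 2 * z + 1 / 2) = _
      congr 1
      ring
    · rw [stack_pos_lower _ _ _ hz.2]
      change b.pos (r.symm (r i)) (1 / 2 * z + 0) = _
      rw [r.symm_apply_apply]
      congr 1
      ring
  refine ⟨fun y hy i j => by rw [hpos y hy, hpos y hy], fun y hy i => ?_, fun y hy i => ?_⟩
  · rcases half_cases hy with ⟨z, hz, rfl⟩ | ⟨z, hz, rfl⟩
    · rw [stack_pt_upper _ _ _ hz.1, upper_mem_stack_real (by simpa using hz.1),
        transport_real_iff hu hz]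
      rw [show (z + 1) / 2 = 1 / 2 * z + 1 / 2 by ring]
      rfl
    · rw [stack_pt_lower _ _ _ hz.2, lower_mem_stack_real (by simpa using hz.2),
        transport_real_iff hl hz]
      change _ ↔ b.pt (r.symm (r i)) _ ∈ _
      rw [r.symm_apply_apply, show z / 2 = 1 / 2 * z + 0 by ring]
  · rcases half_cases hy with ⟨z, hz, rfl⟩ | ⟨z, hz, rfl⟩
    · rw [stack_pt_upper _ _ _ hz.1, upper_mem_stack_bars (by simpa using hz.1),
        transport_bars_iff hu hz]
      rw [show (z + 1) / 2 = 1 / 2 * z + 1 / 2 by ring]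
      rfl
    · rw [stack_pt_lower _ _ _ hz.2, lower_mem_stack_bars (by simpa using hz.2),
        transport_bars_iff hl hz]
      change _ ↔ b.pt (r.symm (r i)) _ ∈ _
      rw [r.symm_apply_apply, show z / 2 = 1 / 2 * z + 0 by ring]

theorem bend_left_self {t v : ℝ} (ht : t ∈ Ioo (0 : ℝ) 1) : bend t v t = v := by
  have := ht.1.ne'
  rw [bend_of_le ht le_rfl, div_mul_cancel₀ _ this]

/-- A diagram can be cut at a height without events. -/
theorem exists_slices {t : ℝ} (ht : t ∈ Ioo (0 : ℝ) 1) (hno : t ∉ b.heights) :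
    ∃ u l : Diagram n, Twin.mk b = Twin.mk u * Twin.mk l ∧
      u.heights.ncard ≤ (b.heights ∩ Ioi t).ncard ∧ l.heights.ncard ≤ (b.heights ∩ Iio t).ncard := by
  have hh : (1 / 2 : ℝ) ∈ Ioo (0 : ℝ) 1 := by norm_num
  -- The cut is first moved to the height `1 / 2`, where stacking joins its two diagrams.
  have hno' : 1 / 2 ∉ (b.reparam hh ht).heights := fun h => by
    have := mem_heights_of_transport _ h
    rw [bend_left_self hh] at this
    exact hno this
  obtain ⟨b₁, r, h1, h2, h3⟩ := exists_straight hno'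
  obtain ⟨u, l, h4, h5, h6⟩ := exists_stack_of_straight (fun h => hno' (h2 h)) h3
  have hmono := bend_strictMono hh ht
  have hmap : ∀ y ∈ b₁.heights, bend (1 / 2) t y ∈ b.heights := fun y hy =>
    mem_heights_of_transport _ (h2 hy)
  refine ⟨u, l, ?_, ?_, ?_⟩
  · rw [Twin.mk_mul_mk, Twin.mk_eq_of_isotopic (b.isotopic_reparam hh ht),
      Twin.mk_eq_of_isotopic h1.isotopic, Twin.mk_eq_of_isotopic h4.isotopic]
  · refine ncard_le_ncard_of_injOn (fun y => bend (1 / 2) t (1 / 2 * y + 1 / 2))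
      (fun y hy => ⟨hmap _ (h5 y hy), ?_⟩) (fun y _ z _ h => ?_) (b.finite_heights.inter_of_left _)
    · have := hmono (show 1 / 2 < 1 / 2 * y + 1 / 2 by linarith [(u.heights_subset hy).1])
      rwa [bend_left_self hh] at this
    · have := hmono.injective h
      linarith
  · refine ncard_le_ncard_of_injOn (fun y => bend (1 / 2) t (1 / 2 * y + 0))
      (fun y hy => ⟨hmap _ (h6 y hy), ?_⟩) (fun y _ z _ h => ?_) (b.finite_heights.inter_of_left _)
    · have := hmono (show 1 / 2 * y + 0 < 1 / 2 by linarith [(l.heights_subset hy).2])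
      rwa [bend_left_self hh] at this
    · have := hmono.injective h
      linarith

end Diagram

end TwistedVirtualTwin

namespace TwistedVirtualTwin

open Filter Topology

namespace Diagram

variable {n : ℕ} {b b' : Diagram n}

/-! ### Generation by elementary diagrams -/

/-- With all events at height `1 / 2` the order at every height is determined by the two ends: two
strands meet at `1 / 2` exactly when `perm` inverts them. This allows a comparison with a level
diagram of the same permutation. -/
theorem pos_lt_iff_of_subset_half (h : b.heights ⊆ {1 / 2}) {y : ℝ} (hy : y ∈ Icc (0 : ℝ) 1)
    (i j : Fin n) : b.pos i y < b.pos j y ↔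
      (if y < 1 / 2 then b.perm i < b.perm j
        else if 1 / 2 < y then i < j else i < j ∧ b.perm i < b.perm j) := by
  have hcr : ∀ i j, i ≠ j → ∀ z ∈ Icc (0 : ℝ) 1, b.pos i z = b.pos j z → z = 1 / 2 :=
    fun i j hij z hz he => h (mem_heights_of_pos_eq hij hz he)
  split_ifs with h1 h2
  · rw [← pos_zero_lt_iff]
    refine (pos_lt_iff_of_heights le_rfl hy.1 hy.2 (fun z hz hz' => ?_) i j).symm
    have : z = 1 / 2 := h hz'
    linarith [hz.2]
  · rw [← pos_one_lt_iff (b := b)]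
    refine pos_lt_iff_of_heights hy.1 hy.2 le_rfl (fun z hz hz' => ?_) i j
    have : z = 1 / 2 := h hz'
    linarith [hz.1]
  obtain rfl : y = 1 / 2 := le_antisymm (not_lt.mp h2) (not_lt.mp h1)
  by_cases hij : i = j
  · simp [hij]
  by_cases he : b.pos i (1 / 2) = b.pos j (1 / 2)
  · have := b.pos_lt_iff_of_cross hij le_rfl (by norm_num : (0 : ℝ) < 1 / 2) (by norm_num) le_rfl he
      (hcr i j hij)
    rw [pos_zero_lt_iff, pos_one_lt_iff] at this
    refine iff_of_false he.not_lt fun h' => ?_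
    exact h'.1.asymm (this.mp h'.2)
  · have hne : ∀ z ∈ Icc (0 : ℝ) 1, b.pos i z ≠ b.pos j z := by
      intro z hz hz'
      rw [hcr i j hij z hz hz'] at hz'
      exact he hz'
    have h3 := b.pos_lt_iff_of_forall_ne le_rfl hy.1 hy.2 fun z hz => hne z ⟨hz.1, hz.2.trans hy.2⟩
    have h4 := b.pos_lt_iff_of_forall_ne hy.1 hy.2 le_rfl fun z hz => hne z ⟨hy.1.trans hz.1, hz.2⟩
    rw [pos_zero_lt_iff] at h3
    rw [pos_one_lt_iff] at h4
    tauto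

theorem pos_half_lt_iff (h : b.heights ⊆ {1 / 2}) (i j : Fin n) :
    b.pos i (1 / 2) < b.pos j (1 / 2) ↔ i < j ∧ b.perm i < b.perm j := by
  rw [pos_lt_iff_of_subset_half h half_mem_Icc, if_neg (lt_irrefl _), if_neg (lt_irrefl _)]

/-- A strand that starts, or ends, between two crossing strands would be squeezed through their
crossing point at height `1 / 2`, and triple points are excluded. -/
theorem isLevel_perm_of_subset_half (h : b.heights ⊆ {1 / 2}) : IsLevel b.perm := by
  intro i j hij hji
  have hle : ∀ k l, ¬(l < k ∧ b.perm l < b.perm k) → b.pos k (1 / 2) ≤ b.pos l (1 / 2) :=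
    fun k l hkl => not_lt.mp (mt (pos_half_lt_iff h l k).mp hkl)
  have hijle := hle i j fun h' => hij.asymm h'.1
  have hjile := hle j i fun h' => hji.asymm h'.2
  have htriple : ∀ k, k ≠ i → k ≠ j → b.pos k (1 / 2) = b.pos i (1 / 2) → False := by
    intro k hki hkj hk
    rcases b.double _ half_mem_Icc k i j hk (hijle.antisymm hjile) with h' | h' | h'
    · exact hki h'
    · exact hij.ne h'
    · exact hkj h'
  constructor
  · by_contra hc
    have h1 : (i : ℕ) < j := hij
    have h2 := j.isLt
    let k : Fin n := ⟨i + 1, by omega⟩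
    have hik : i < k := Nat.lt_succ_self (i : ℕ)
    have hkj : k < j := by
      rw [Fin.lt_def]
      simp only [k]
      omega
    exact htriple k hik.ne' hkj.ne (le_antisymm ((hle k j fun h' => hkj.asymm h'.1).trans hjile)
      (hle i k fun h' => hik.asymm h'.1))
  · by_contra hc
    have h1 : (b.perm j : ℕ) < b.perm i := hji
    have h2 := (b.perm i).isLt
    obtain ⟨k, hk⟩ := b.perm.surjective ⟨(b.perm j : ℕ) + 1, by omega⟩
    have hjk : b.perm j < b.perm k := by
      rw [hk]
      exact Nat.lt_succ_self (b.perm j : ℕ)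
    have hki : b.perm k < b.perm i := by
      rw [hk, Fin.lt_def]
      simp only
      omega
    refine htriple k (fun h' => ?_) (fun h' => ?_) (le_antisymm
      (hle k i fun h' => hki.asymm h'.2)
      (hijle.trans (hle j k fun h' => hjk.asymm h'.2)))
    · exact hki.ne (congrArg b.perm h')
    · exact hjk.ne' (congrArg b.perm h')

theorem heights_level {σ : Equiv.Perm (Fin n)} (hσ : IsLevel σ) (R T : Set (Fin n)) :
    (level σ hσ R T).heights ⊆ {1 / 2} := by
  rintro _ ⟨P, hP, rfl⟩
  obtain ⟨l, -, rfl⟩ := level_events hσ hP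
  rfl

theorem samePattern_level (h : b.heights ⊆ {1 / 2}) :
    SamePattern b (level b.perm (isLevel_perm_of_subset_half h)
      {i | b.pt i (1 / 2) ∈ b.real} {i | b.pt i (1 / 2) ∈ b.bars}) := by
  set d := level b.perm (isLevel_perm_of_subset_half h)
    {i | b.pt i (1 / 2) ∈ b.real} {i | b.pt i (1 / 2) ∈ b.bars} with hd
  have hdh : d.heights ⊆ {1 / 2} := heights_level _ _ _
  have hlt : ∀ y ∈ Icc (0 : ℝ) 1, ∀ i j, b.pos i y < b.pos j y ↔ d.pos i y < d.pos j y := by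
    intro y hy i j
    rw [pos_lt_iff_of_subset_half h hy, pos_lt_iff_of_subset_half hdh hy]
    rfl
  have heq : ∀ i j, b.pos i (1 / 2) = b.pos j (1 / 2) ↔ d.pos i (1 / 2) = d.pos j (1 / 2) :=
    fun i j => eq_iff_of_lt_iff (hlt _ half_mem_Icc i j) (hlt _ half_mem_Icc j i)
  have hpt : ∀ {i j}, d.pt i (1 / 2) ∈ graphOf (d.pos j) → b.pt i (1 / 2) = b.pt j (1 / 2) :=
    fun {i j} hj => Prod.ext ((heq i j).mpr hj.2) rfl
  refine ⟨hlt, fun y _ i => ⟨fun hr => ?_, fun hr => ?_⟩, fun y _ i => ⟨fun hr => ?_, fun hr => ?_⟩⟩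
  · obtain rfl : y = 1 / 2 := h (mem_heights_of_real hr)
    refine ⟨?_, i, hr, half_mem_Icc, rfl⟩
    obtain ⟨j, k, hjk, hj, hk⟩ := b.real_subset hr
    exact ⟨j, k, hjk, ⟨half_mem_Icc, (heq i j).mp hj.2⟩, ⟨half_mem_Icc, (heq i k).mp hk.2⟩⟩
  · obtain rfl : y = 1 / 2 := hdh (mem_heights_of_real hr)
    obtain ⟨-, j, hj, hij⟩ := hr
    rw [hpt hij]
    exact hj
  · obtain rfl : y = 1 / 2 := h (mem_heights_of_bars hr)
    refine ⟨?_, rfl, i, hr, half_mem_Icc, rfl⟩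
    rintro ⟨j, k, hjk, hj, hk⟩
    exact b.bars_crossing _ hr ⟨j, k, hjk, ⟨half_mem_Icc, (heq i j).mpr hj.2⟩,
      ⟨half_mem_Icc, (heq i k).mpr hk.2⟩⟩
  · obtain rfl : y = 1 / 2 := hdh (mem_heights_of_bars hr)
    obtain ⟨-, -, j, hj, hij⟩ := hr
    rw [hpt hij]
    exact hj

theorem mk_mem_generated_of_subset_singleton {y : ℝ} (hy : y ∈ Ioo (0 : ℝ) 1)
    (h : b.heights ⊆ {y}) : Twin.mk b ∈ generated n := by
  have hh : (1 / 2 : ℝ) ∈ Ioo (0 : ℝ) 1 := by norm_num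
  have h1 : (b.reparam hh hy).heights ⊆ {1 / 2} := by
    intro z hz
    have h2 : bend (1 / 2) y z = y := h (mem_heights_of_transport _ hz)
    exact (bend_strictMono hh hy).injective (h2.trans (bend_left_self hh).symm)
  rw [Twin.mk_eq_of_isotopic (b.isotopic_reparam hh hy),
    Twin.mk_eq_of_isotopic (samePattern_level h1).isotopic]
  exact mk_level_mem _ _ _

/-- Every diagram is equivalent to a stack of elementary ones. -/
theorem mk_mem_generated (b : Diagram n) : Twin.mk b ∈ generated n := by
  induction hN : b.heights.ncard using Nat.strong_induction_on generalizing b with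
  | _ N ih =>
    subst hN
    rcases b.heights.subsingleton_or_nontrivial with hs | ⟨x, hx, y, hy, hxy⟩
    · rcases hs.eq_empty_or_singleton with he | ⟨y, he⟩
      · exact mk_mem_generated_of_subset_singleton (y := 1 / 2) (by norm_num) (by simp [he])
      · exact mk_mem_generated_of_subset_singleton (b.heights_subset (he ▸ mem_singleton y)) he.subset
    · have key : ∀ x y, x ∈ b.heights → y ∈ b.heights → x < y → Twin.mk b ∈ generated n := by
        intro x y hx hy hxy
        -- A cut between two event heights: the upper slice loses `x` and the lower slice loses `y`,
        -- so both have fewer event heights.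
        obtain ⟨t, ht, hno⟩ := (Ioo_infinite hxy).exists_notMem_finite b.finite_heights
        obtain ⟨u, l, h1, h2, h3⟩ := exists_slices (b := b) (t := t)
          ⟨(b.heights_subset hx).1.trans ht.1, ht.2.trans (b.heights_subset hy).2⟩ hno
        rw [h1]
        refine Submonoid.mul_mem _ (ih _ (h2.trans_lt ?_) u rfl) (ih _ (h3.trans_lt ?_) l rfl)
        · exact ncard_lt_ncard (ssubset_iff_subset_ne.mpr ⟨inter_subset_left, fun he =>
            ht.1.asymm (he.symm.subset hx).2⟩) b.finite_heights
        · exact ncard_lt_ncard (ssubset_iff_subset_ne.mpr ⟨inter_subset_left, fun he =>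
            ht.2.asymm (he.symm.subset hy).2⟩) b.finite_heights
      rcases hxy.lt_or_gt with h | h
      · exact key x y hx hy h
      · exact key y x hy hx h

theorem elem_depicts (g : Gen n) : (elem g).Depicts g := by
  have h := elem_shows (o := 0) (k := n) (zero_add n).le g
  have hg : g.shift 0 (zero_add n).le = g := by
    cases g <;> simp [Gen.shift]
  rw [hg] at h
  have := g.idx_lt
  refine ⟨_, _, column_lt 0 n ?_, h⟩
  cases g <;> simp only [Gen.idx, Gen.kind, Kind.width] at this <;> omega

end Diagram

/-! ### The group of twisted virtual twins and the isomorphism. -/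

section Group

variable {n : ℕ}

/-- Every twin is a product of elementary twins, which are involutions; reversing the product
inverts it. -/
theorem Twin.exists_inv (x : Twin n) : ∃ y, y * x = 1 := by
  obtain ⟨b, rfl⟩ := Quotient.exists_rep x
  have h := b.mk_mem_generated
  change ∃ y, y * Twin.mk b = 1
  generalize Twin.mk b = x at h
  induction h using Submonoid.closure_induction with
  | mem x hx =>
    obtain ⟨g, rfl⟩ := hx
    exact ⟨_, Twin.of_mul_self g⟩
  | one => exact ⟨1, one_mul 1⟩
  | mul x y _ _ hx hy =>
    obtain ⟨x', hx⟩ := hx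
    obtain ⟨y', hy⟩ := hy
    exact ⟨y' * x', by rw [mul_assoc, ← mul_assoc x', hx, one_mul, hy]⟩

/-- Twisted virtual twins form a group under stacking. -/
noncomputable scoped instance twinGroup (n : ℕ) : Group (Twin n) :=
  { twinMonoid n with
    inv := fun x => (Twin.exists_inv x).choose
    inv_mul_cancel := fun x => (Twin.exists_inv x).choose_spec }

/-- Squares and far commutation hold by the cancelling argument; the braid-like relations and the
twist are the moves V3, V4, T1 and T3 in a column. -/
theorem Twin.lift_of_rel {u v : FreeGroup (Gen n)} (h : Rel n u v) :
    FreeGroup.lift Twin.of u = FreeGroup.lift Twin.of v := by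
  have hm : ∀ {k : ℕ} {w w' : List (Gen k)}, Diagram.MovePicture k w w' → ∀ {o : ℕ} (ho : o + k ≤ n),
      ((w.map (Gen.shift o ho)).map Twin.of).prod = ((w'.map (Gen.shift o ho)).map Twin.of).prod :=
    fun {_ _ _} h {_} ho => Twin.prod_eq_of_movePicture h ho
  cases h with
  | s_sq i hi => simp [sq, Twin.of_mul_self]
  | r_sq i hi => simp [sq, Twin.of_mul_self]
  | g_sq i hi => simp [sq, Twin.of_mul_self]
  | s_s i j hi hj hij =>
    simpa using Twin.of_mul_of_comm (g := .s i hi) (g' := .s j hj)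
      (by simp only [Gen.idx, Gen.kind, Kind.width]; omega)
  | r_r i j hi hj hij =>
    simpa using Twin.of_mul_of_comm (g := .rho i hi) (g' := .rho j hj)
      (by simp only [Gen.idx, Gen.kind, Kind.width]; omega)
  | s_r i j hi hj hij =>
    simpa using Twin.of_mul_of_comm (g := .s i hi) (g' := .rho j hj)
      (by simp only [Gen.idx, Gen.kind, Kind.width]; omega)
  | g_r i j hi hj h1 h2 =>
    simpa using Twin.of_mul_of_comm (g := .gamma j hj) (g' := .rho i hi)
      (by simp only [Gen.idx, Gen.kind, Kind.width]; omega)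
  | s_g i j hi hj h1 h2 =>
    simpa using Twin.of_mul_of_comm (g := .s i hi) (g' := .gamma j hj)
      (by simp only [Gen.idx, Gen.kind, Kind.width]; omega)
  | g_g i j hi hj =>
    -- The relation for two bars includes equal indices, where the blocks are not disjoint but there
    -- is nothing to prove.
    by_cases hij : i = j
    · subst hij
      rfl
    · simpa using Twin.of_mul_of_comm (g := .gamma i hi) (g' := .gamma j hj)
        (by simp only [Gen.idx, Gen.kind, Kind.width]; omega)
  | r_r_r i hi hi' => simpa [Gen.shift, mul_assoc] using hm .V3 (o := i) hi'
  | r_s_r i hi hi' => simpa [Gen.shift, mul_assoc] using hm .V4_middle (o := i) hi'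
  | g_r_g i h0 hi => simpa [Gen.shift, mul_assoc] using hm .T1_left (o := i) hi
  | twist i h0 hi => simpa [Gen.shift, mul_assoc] using hm .T3 (o := i) hi

/-- The homomorphism that sends each generator to its elementary diagram. -/
noncomputable def TVT.toTwin (n : ℕ) : TVT n →* Twin n :=
  PresentedGroup.toGroup (f := Twin.of) <| by
    rintro _ ⟨u, v, h, rfl⟩
    rw [map_mul, map_inv, Twin.lift_of_rel h, mul_inv_cancel]

theorem TVT.toTwin_of (g : Gen n) : TVT.toTwin n (PresentedGroup.of g) = Twin.of g :=
  PresentedGroup.toGroup.of _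

/-- Reading off the events of a diagram is a homomorphism. -/
noncomputable def Twin.valueHom (n : ℕ) : Twin n →* TVT n :=
  MonoidHom.mk' Twin.value <| by
    rintro ⟨b⟩ ⟨b'⟩
    exact Diagram.value_stack b b'

/-- It suffices to check generators, and an elementary diagram reads exactly its generator. This
gives the injectivity of `TVT.toTwin`. -/
theorem Twin.valueHom_toTwin (x : TVT n) : Twin.valueHom n (TVT.toTwin n x) = x := by
  have h : (Twin.valueHom n).comp (TVT.toTwin n) = MonoidHom.id _ := by
    refine PresentedGroup.ext fun g => ?_
    change Twin.value (TVT.toTwin n (PresentedGroup.of g)) = _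
    rw [TVT.toTwin_of]
    exact Diagram.value_eq_of_depicts (Diagram.elem_depicts g)
  exact DFunLike.congr_fun h x

theorem TVT.toTwin_surjective : Function.Surjective (TVT.toTwin n) := by
  rintro ⟨b⟩
  have h : Diagram.generated n ≤ MonoidHom.mrange (TVT.toTwin n) := by
    refine Submonoid.closure_le.mpr ?_
    rintro _ ⟨g, rfl⟩
    exact ⟨_, TVT.toTwin_of g⟩
  exact h b.mk_mem_generated

/-- The twisted virtual twin group is the group of twisted virtual twins. -/
noncomputable def TVT.equivTwin (n : ℕ) : TVT n ≃* Twin n :=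
  MulEquiv.ofBijective (TVT.toTwin n)
    ⟨Function.LeftInverse.injective Twin.valueHom_toTwin, TVT.toTwin_surjective⟩

/-- Diagrams that depict the same generator need not be compared geometrically: they have the same
value, and the value determines the twin. -/
theorem TVT.equivTwin_of_depicts {g : Gen n} {b : Diagram n} (h : b.Depicts g) :
    TVT.equivTwin n (PresentedGroup.of g) = Twin.mk b := by
  obtain ⟨x, hx⟩ := TVT.toTwin_surjective (Twin.mk b)
  have h1 : x = PresentedGroup.of g := by
    rw [← Twin.valueHom_toTwin x, hx]
    exact Diagram.value_eq_of_depicts h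
  rw [← h1]
  exact hx

end Group

end TwistedVirtualTwin

theorem mainTheorem9 (n : ℕ) (hn : 1 ≤ n) :
    ∃ _ : Group (TwistedVirtualTwin.Twin n),
      (∀ b b' : TwistedVirtualTwin.Diagram n,
        TwistedVirtualTwin.Twin.mk b * TwistedVirtualTwin.Twin.mk b' =
          TwistedVirtualTwin.Twin.mk (b.stack b')) ∧
      ∃ e : TwistedVirtualTwin.TVT n ≃* TwistedVirtualTwin.Twin n,
        ∀ g : TwistedVirtualTwin.Gen n,
          (∃ b : TwistedVirtualTwin.Diagram n, b.Depicts g) ∧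
          ∀ b : TwistedVirtualTwin.Diagram n, b.Depicts g →
            e (PresentedGroup.of g) = TwistedVirtualTwin.Twin.mk b := by
  exact ⟨TwistedVirtualTwin.twinGroup n, fun _ _ => rfl, TwistedVirtualTwin.TVT.equivTwin n,
    fun g => ⟨⟨_, TwistedVirtualTwin.Diagram.elem_depicts g⟩,
      fun _ h => TwistedVirtualTwin.TVT.equivTwin_of_depicts h⟩⟩
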